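/- \textbf{The envelope game $G$.} Player 1 secretly puts a bit $x\in\{0,1\}$ in an envelope; player 2, without seeing $x$, chooses a bit $y$; then player 1 either opens or destroys the envelope. Player 1 gets $1$ if she opens the envelope and $x\neq y$, and $-1$ otherwise; player 2 gets the opposite. The only non-singleton information set is that of player 2. \textbf{Commitment scheme.} A secure commitment scheme with perfect binding consists of a probabilistic polynomial-time algorithm $C=(C_1,C_2)$ and a deterministic polynomial-time algorithm $R$ with values in $\{0,1,f\}$ such that, for all $k\ge 1$, bits $b$ and random strings $r$: $C_1(1^k,b,r)$ is a $k$-bit string and $C_2(1^k,b,r)$ is a $(k-1)$-bit string; $R(C_1(1^k,b,r),C_2(1^k,b,r))=b$; $R(C_1(1^k,b,r),s)=f$ for all $s\ne C_2(1^k,b,r)$; and the ensembles $\{C_1(1^k,0)\}_k$, $\{C_1(1^k,1)\}_k$ are computationally indistinguishable (hiding). Here machines are uniform Turing machines. \textbf{The sequence $\mathcal G=(G_1,G_2,\dots)$.} In $G_n$ player 1 sends a commitment string $c=C_1(1^n,b,r)$ (for some $b,r$); player 2, seeing $c$, chooses a bit $y$; player 1 then sends a string $s$ of length at most $n$. Player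 1 gets $1$ if $R(c,s)\in\{0,1\}$ and $R(c,s)\ne y$, and $-1$ otherwise; player 2 gets the opposite. $G_n$ has perfect information. \textbf{Strategies.} A strategy of a player in $G$ is a mixed strategy, that is, a probability distribution on deterministic strategies; call it \emph{efficient} if its probabilities can be computed up to a negligible error (in $n$) by a deterministic polynomial-time machine with input $1^n$. A (polynomial-time) strategy $M$ of player $i$ in $\mathcal G$ is a probabilistic polynomial-time machine that on input $1^n$, an information set of player $i$ in $G_n$ and a random tape (drawn once and kept for the whole play) outputs an available action. $\rho_{\vec\sigma}$ denotes the distribution on terminal histories of $G$ induced by $\vec\sigma$; given maps $f_n$ from the histories of $G_n$ to those of $G$, $\phi^{n}_{\vec M}$ denotes the image under $f_n$ of the distribution on terminal histories of $G_n$ induced by $\vec M$. $LA(h)$ is the last action of $h$. \textbf{Statement.} For every secure commitment scheme with perfect binding, $\mathcal G$ represents $G$. That is, $\mathcal G$ is a computable uniform sequence of games: actions in $G_n$ have length polynomial in $n$; a probabilistic polynomial-time algorithm determines from $1^n$ and a history $h\in\bigcup_m H_m$ of a game of the sequence whether $h$ is a history of $G_n$; the player to move and the utilities are computable from the history in polynomial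 time. Moreover: \begin{itemize} \item[UG1.] $G$ and all $G_n$ have the same players. \item[UG2.] For each $n\ge1$ there is a surjection $f_n$ from the histories of $G_n$ onto those of $G$ such that (a) $|f_n(h)|=|h|$; (b) $h$ is terminal iff $f_n(h)$ is, and otherwise the same player moves at both; (c) if $h'$ is a prefix of $h$, then $f_n(h')$ is a prefix of $f_n(h)$; (d) if $h,h'$ are in the same information set of $G_n$, then $f_n(h),f_n(h')$ are in the same information set of $G$; (e) if $h,h'$ are in the same information set of $G_n$ and $a$ is available there, then $LA(f_n(h\|a))=LA(f_n(h'\|a))$. \item[UG3.] For every terminal history $h$ of $G_n$, every player has the same utility in $h$ and in $f_n(h)$. \item[UG4.] There is a map $\mathcal F$ from efficient strategies of each player in $G$ to polynomial-time strategies of that player in $\mathcal G$ such that (a) for every profile $\vec\sigma$ of efficient strategies there is a negligible $\epsilon$ with $\sum_{h}|\phi^{n}_{\mathcal F(\vec\sigma)}(h)-\rho_{\vec\sigma}(h)|\le\epsilon(n)$ for all $n$, where $h$ ranges over the terminal histories of $G$; (b) for every efficient strategy $\sigma$ of player $i$ there is a polynomial-time machine $M^\sigma$ which, for every $n$ and every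 history $h$ of $G_n$ at which $i$ moves and random tape $r$ such that the moves of $i$ in $h$ are those of $\mathcal F(\sigma)$ with tape $r$, outputs, given $1^n$, the information set of $h$ and $r$, the action $LA(f_n(h\|a))$, where $a$ is the action that $\mathcal F(\sigma)$ plays there with tape $r$; (c) for every profile $\vec\sigma$ of efficient strategies, every player $i$ and every polynomial-time strategy $M_i'$ of $i$ in $\mathcal G$ there are mixed strategies $\sigma_1',\sigma_2',\dots$ of $i$ in $G$ such that $\{\phi^{n}_{(M_i',\mathcal F(\vec\sigma_{-i}))}\}_n$ and $\{\rho_{(\sigma'_n,\vec\sigma_{-i})}\}_n$ are computationally indistinguishable. \end{itemize} Furthermore, if a probabilistic polynomial-time algorithm (with success probability at least $2/3$) determines from $1^n$ and an arbitrary string $c$ whether $c$ is a commitment string $C_1(1^n,b,r)$, then one also determines, from $1^n$ and an arbitrary finite sequence $h$ of strings, whether $h$ is a history of $G_n$. -/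

import Mathlib

open MeasureTheory

noncomputable section

namespace CompGame

/-! ### Strings, polynomial time, probabilistic polynomial time -/

/-- Bit strings. -/
abbrev Str := List Bool

/-- Tuples of bit strings. A history is the tuple of the actions played so far. -/
abbrev Hist := List Str

/-- An infinite random tape. -/
abbrev Tape := ℕ → Bool

/-- The unary string `1^n`. -/
def unary (n : ℕ) : Str := List.replicate n true

/-- A tuple of bit strings as a word over `{0, 1, #}`: every component is followed by `#`. -/
def encTuple (x : List Str) : List (Option Bool) :=
  x.flatMap fun w => w.map some ++ [none]

/-- `g` is computed by a deterministic Turing machine in polynomial time. -/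
def IsPolyTime (g : List Str → Str) : Prop :=
  Nonempty (Turing.TM2ComputableInPolyTime encTuple (id : Str → List Bool) g)

/-- The first `m` bits of a tape. -/
def tapePrefix (r : Tape) (m : ℕ) : Str := List.ofFn fun j : Fin m => r j

/-- `A x r`, the output of `A` on input `x` with random tape `r`, is computed by a probabilistic
polynomial-time machine: the machine is deterministic in the input and in the random bits, and
uses only polynomially many of these. -/
def IsPPT (A : List Str → Tape → Str) : Prop :=
  ∃ (q : Polynomial ℕ) (g : List Str → Str), IsPolyTime g ∧
    ∀ x r, A x r = g (tapePrefix r (q.eval (encTuple x).length) :: x)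

/-- The uniform distribution on random tapes (independent fair coin tosses). -/
def coin : Measure Tape :=
  Measure.infinitePi fun _ : ℕ => (PMF.uniformOfFintype Bool).toMeasure

/-- Negligible functions. -/
def Negligible (ε : ℕ → ℝ) : Prop :=
  (∀ k, 0 ≤ ε k) ∧ ∀ c : ℕ, ∀ᶠ k : ℕ in Filter.atTop, ε k < 1 / (k : ℝ) ^ c

/-- The probability that `D(1^n, X) = 1`, where `X` is a tuple of strings drawn from the finitely
supported distribution with weights `X x` and `D` uses its own independent random tape. -/
def acceptProb (D : List Str → Tape → Str) (n : ℕ) (X : List Str → ℝ) : ℝ :=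
  ∑' x, X x * coin.real {r | D (unary n :: x) r = [true]}

/-- Computational indistinguishability of two ensembles of finitely supported distributions. -/
def CompIndist (X Y : ℕ+ → List Str → ℝ) : Prop :=
  ∀ D, IsPPT D → ∃ ε, Negligible ε ∧
    ∀ n : ℕ+, |acceptProb D n (X n) - acceptProb D n (Y n)| ≤ ε n

/-- A probabilistic polynomial-time machine that, given `1^n` and `h ∈ dom`, determines whether
`h ∈ S n` (with the usual success probability `2/3`). -/
def PPTDecides (dom : Set Hist) (S : ℕ+ → Set Hist) : Prop :=
  ∃ D, IsPPT D ∧ ∀ (n : ℕ+), ∀ h ∈ dom,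
    2 / 3 ≤ coin.real {r | D (unary n :: h) r = [true] ↔ h ∈ S n}

/-- The number `0.w` in binary. -/
def binFrac : Str → ℝ
  | [] => 0
  | b :: w => ((if b then 1 else 0) + binFrac w) / 2

/-- The real `p` can be approximated up to negligible precision in polynomial time. -/
def EffReal (p : ℝ) : Prop :=
  ∃ g, IsPolyTime g ∧ ∃ ε, Negligible ε ∧ ∀ n : ℕ+, |p - binFrac (g [unary n])| ≤ ε n

/-- The dyadic rational `± m / 2^k` coded by a sign bit (`true` is minus) followed by the binary
digits of `m`, the least significant digit first. -/
def dyadic (k : ℕ) : Str → ℝ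
  | [] => 0
  | s :: m => (if s then -1 else 1) * (Nat.ofDigits 2 (m.map Bool.toNat) : ℕ) / 2 ^ k

/-- The real-valued function `v` on `dom` is computable in polynomial time: on input `(1^k, h)`
a polynomial-time machine outputs a dyadic rational within `2^{-k}` of `v h`. -/
def PolyTimeRealOn (dom : Set Hist) (v : Hist → ℝ) : Prop :=
  ∃ g, IsPolyTime g ∧ ∀ h ∈ dom, ∀ k : ℕ, |v h - dyadic k (g (unary k :: h))| ≤ 1 / 2 ^ k

/-! ### Extensive-form games -/

/-- A finite extensive-form game with `c` players whose actions are bit strings. The information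
partition is given by labels: two nonterminal histories are in the same information set if and
only if they have the same label `obs`; the label is the representation of the information set. -/
structure Game (c : ℕ) where
  H : Set Hist
  finite : H.Finite
  nil_mem : [] ∈ H
  mem_of_append : ∀ h a, h ++ [a] ∈ H → h ∈ H
  P : Hist → Fin c
  u : Fin c → Hist → ℝ
  obs : Hist → List Str
  two_actions : ∀ h ∈ H, (∃ a, h ++ [a] ∈ H) → ∃ a b, a ≠ b ∧ h ++ [a] ∈ H ∧ h ++ [b] ∈ H
  obs_player : ∀ h h', (∃ a, h ++ [a] ∈ H) → (∃ a, h' ++ [a] ∈ H) → obs h = obs h' → P h = P h'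
  obs_actions : ∀ h h', (∃ a, h ++ [a] ∈ H) → (∃ a, h' ++ [a] ∈ H) → obs h = obs h' →
    ∀ a, h ++ [a] ∈ H ↔ h' ++ [a] ∈ H

namespace Game

variable {c : ℕ}

/-- Nonterminal histories. -/
def nonterminal (G : Game c) : Set Hist := {h | ∃ a, h ++ [a] ∈ G.H}

/-- Terminal histories. -/
def terminal (G : Game c) : Set Hist := {h | h ∈ G.H ∧ ∀ a, h ++ [a] ∉ G.H}

/-- The histories after which player `i` moves. -/
def turn (G : Game c) (i : Fin c) : Set Hist := {h | h ∈ G.nonterminal ∧ G.P h = i}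

/-- Two (nonterminal) histories are in the same information set. -/
def SameInfo (G : Game c) (h h' : Hist) : Prop :=
  h ∈ G.nonterminal ∧ h' ∈ G.nonterminal ∧ G.obs h = G.obs h'

/-- The information sets of player `i`, as labels. -/
def InfoSet (G : Game c) (i : Fin c) : Type := {I : List Str // ∃ h ∈ G.turn i, G.obs h = I}

/-- The actions available at an information set. -/
def actions (G : Game c) {i : Fin c} (I : G.InfoSet i) : Set Str :=
  {a | ∀ h ∈ G.turn i, G.obs h = I.1 → h ++ [a] ∈ G.H}

/-- Deterministic strategies of player `i`. -/
def PureStrategy (G : Game c) (i : Fin c) : Type := (I : G.InfoSet i) → G.actions I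

instance (G : Game c) (i : Fin c) : MeasurableSpace (G.PureStrategy i) := ⊤

/-- Mixed strategies of player `i`. -/
abbrev Mixed (G : Game c) (i : Fin c) : Type := PMF (G.PureStrategy i)

/-- The mixed strategies that a Turing machine can approximate: the probability of every set of
deterministic strategies can be approximated up to negligible precision in polynomial time. -/
def EffMixed (G : Game c) (i : Fin c) : Type :=
  {σ : G.Mixed i // ∀ S : Set (G.PureStrategy i), EffReal (σ.toMeasure.real S)}

/-- `ρ_σ`: the distribution on terminal histories when the players draw deterministic strategies
independently from `σ` and then follow them. A terminal history is the outcome if and only if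
every move in it is the one prescribed to the player who moves. -/
def outcomeDist (G : Game c) (σ : ∀ i, G.Mixed i) (h : Hist) : ℝ :=
  (Measure.pi fun i => (σ i).toMeasure).real
    {s | h ∈ G.terminal ∧ ∀ h' a, h' ++ [a] <+: h →
      ∀ (i : Fin c) (hi : h' ∈ G.turn i), (s i ⟨G.obs h', h', hi, rfl⟩ : Str) = a}

end Game

/-! ### Computational games -/

/-- Computable uniform sequences of games. -/
structure IsComputableUniform {c : ℕ} (𝒢 : ℕ+ → Game c) : Prop where
  /-- action sets consist of strings of polynomial length -/
  action_length : ∃ p : Polynomial ℕ, ∀ (n : ℕ+) h a, h ++ [a] ∈ (𝒢 n).H →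
    a.length ≤ p.eval (n : ℕ)
  /-- given `1^n` and a history (of some game of the sequence), one can determine in
  probabilistic polynomial time whether it is a history of the `n`th game -/
  histories : PPTDecides (⋃ n, (𝒢 n).H) fun n => (𝒢 n).H
  /-- the player who moves is a polynomial-time function of the history -/
  player : ∃ g, IsPolyTime g ∧ ∀ n, ∀ h ∈ (𝒢 n).nonterminal, g h = unary ((𝒢 n).P h)
  /-- the utilities are a polynomial-time function of the terminal history -/
  utility : ∀ i, ∃ v : Hist → ℝ, PolyTimeRealOn (⋃ n, (𝒢 n).terminal) v ∧
    ∀ n, ∀ h ∈ (𝒢 n).terminal, (𝒢 n).u i h = v h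

/-- A polynomial-time strategy for player `i` in a sequence of games: a probabilistic
polynomial-time machine that, given `1^n`, (the representation of) an information set and its
random tape, outputs an available action. The machine is stateful: the tape is drawn once, and
is the same in all rounds of a play. -/
structure Strategy {c : ℕ} (𝒢 : ℕ+ → Game c) (i : Fin c) where
  M : List Str → Tape → Str
  ppt : IsPPT M
  legal : ∀ (n : ℕ+), ∀ h ∈ (𝒢 n).turn i, ∀ r,
    h ++ [M (unary n :: (𝒢 n).obs h) r] ∈ (𝒢 n).H

/-- The moves of player `i` in `h` are those of the strategy `M` with random tape `r`, that is,
`h` and `r` make up a view that is reachable when player `i` plays `M`. -/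
def Strategy.Follows {c : ℕ} {𝒢 : ℕ+ → Game c} {i : Fin c} (M : Strategy 𝒢 i) (n : ℕ+)
    (r : Tape) (h : Hist) : Prop :=
  ∀ h' a, h' ++ [a] <+: h → h' ∈ (𝒢 n).turn i → M.M (unary n :: (𝒢 n).obs h') r = a

/-- `φ_M`: the image under `f` of the distribution on terminal histories of the `n`th game when
the players play `M` with independent random tapes. -/
def imageDist {c : ℕ} (𝒢 : ℕ+ → Game c) (f : Hist → Hist) (M : ∀ i, Strategy 𝒢 i) (n : ℕ+)
    (h : Hist) : ℝ :=
  (Measure.pi fun _ : Fin c => coin).real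
    {r | ∃ h' ∈ (𝒢 n).terminal, f h' = h ∧ ∀ i, (M i).Follows n (r i) h'}

/-- The ensembles `X` and `Y` of distributions on the terminal histories of `G` are
statistically close. -/
def StatClose {c : ℕ} (G : Game c) (X Y : ℕ+ → Hist → ℝ) : Prop :=
  ∃ ε, Negligible ε ∧ ∀ n : ℕ+, ∑ᶠ h ∈ G.terminal, |X n h - Y n h| ≤ ε n

/-- The structural conditions on the map `f` from the histories of `K` to those of `G`. -/
structure HistoryMap {c : ℕ} (K G : Game c) (f : Hist → Hist) : Prop where
  mapsTo : Set.MapsTo f K.H G.H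
  surjOn : Set.SurjOn f K.H G.H
  length_eq : ∀ h ∈ K.H, (f h).length = h.length
  terminal_iff : ∀ h ∈ K.H, f h ∈ G.terminal ↔ h ∈ K.terminal
  player_eq : ∀ h ∈ K.nonterminal, G.P (f h) = K.P h
  prefix_of : ∀ h ∈ K.H, ∀ h', h' <+: h → f h' <+: f h
  sameInfo : ∀ h h', K.SameInfo h h' → G.SameInfo (f h) (f h')
  lastAction : ∀ h h', K.SameInfo h h' → ∀ a, h ++ [a] ∈ K.H →
    (f (h ++ [a])).getLast? = (f (h' ++ [a])).getLast?

/-- The conditions on the map `F` from strategies of `G` to strategies of `𝒢`. -/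
structure StrategyMap {c : ℕ} (𝒢 : ℕ+ → Game c) (G : Game c) (f : ℕ+ → Hist → Hist)
    (F : ∀ i, G.EffMixed i → Strategy 𝒢 i) : Prop where
  /-- every strategy profile corresponds to its image -/
  corresponds : ∀ σ : ∀ i, G.EffMixed i,
    StatClose G (fun n => imageDist 𝒢 (f n) (fun i => F i (σ i)) n)
      (fun _ => G.outcomeDist fun i => (σ i).1)
  /-- the machine `F i σ` knows which action of `G` it plays -/
  knows : ∀ (i : Fin c) (σ : G.EffMixed i), ∃ N, IsPPT N ∧
    ∀ (n : ℕ+), ∀ h ∈ (𝒢 n).turn i, ∀ r, (F i σ).Follows n r h →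
      (f n (h ++ [(F i σ).M (unary n :: (𝒢 n).obs h) r])).getLast?
        = some (N (unary n :: (𝒢 n).obs h) r)
  /-- every polynomial-time deviation of one player is indistinguishable from a sequence of
  strategies of that player in `G` -/
  deviation : ∀ (σ : ∀ i, G.EffMixed i) (i : Fin c) (M' : Strategy 𝒢 i),
    ∃ σ' : ℕ+ → G.Mixed i,
      CompIndist
        (fun n => imageDist 𝒢 (f n) (Function.update (fun j => F j (σ j)) i M') n)
        (fun n => G.outcomeDist (Function.update (fun j => (σ j).1) i (σ' n)))

/-- The sequence `𝒢` is a computable uniform sequence that represents `G`. (That all games have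
the same players is part of the types.) -/
def Represents {c : ℕ} (𝒢 : ℕ+ → Game c) (G : Game c) : Prop :=
  IsComputableUniform 𝒢 ∧
    ∃ f : ℕ+ → Hist → Hist,
      (∀ n, HistoryMap (𝒢 n) G (f n)) ∧
      (∀ n, ∀ h ∈ (𝒢 n).terminal, ∀ i, (𝒢 n).u i h = G.u i (f n h)) ∧
      ∃ F : ∀ i, G.EffMixed i → Strategy 𝒢 i, StrategyMap 𝒢 G f F

/-! ### Commitment schemes -/

/-- The distribution of the one-component tuple `(A r)` for a uniformly random tape `r`. -/
def outputDist (A : Tape → Str) (x : List Str) : ℝ := coin.real {r | [A r] = x}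

/-- A secure commitment scheme with perfect binding: `C₁` gives the commitment string, `C₂` the
commitment key, and `R` opens a commitment (`none` is the failure symbol). -/
structure CommitmentScheme where
  C₁ : ℕ+ → Bool → Tape → Str
  C₂ : ℕ+ → Bool → Tape → Str
  R : Str → Str → Option Bool
  ppt_C₁ : ∃ A, IsPPT A ∧ ∀ (k : ℕ+) b r, A [unary k, [b]] r = C₁ k b r
  ppt_C₂ : ∃ A, IsPPT A ∧ ∀ (k : ℕ+) b r, A [unary k, [b]] r = C₂ k b r
  polyTime_R : ∃ g, IsPolyTime g ∧ ∀ c s, g [c, s] = (R c s).toList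
  length_C₁ : ∀ k b r, (C₁ k b r).length = k
  length_C₂ : ∀ k b r, (C₂ k b r).length = (k : ℕ) - 1
  is_hiding : CompIndist (fun k => outputDist (C₁ k false)) (fun k => outputDist (C₁ k true))
  opens : ∀ k b r, R (C₁ k b r) (C₂ k b r) = some b
  binding : ∀ k b r s, s ≠ C₂ k b r → R (C₁ k b r) s = none

/-- The commitment strings with security parameter `n`. -/
def CommitmentScheme.commitments (S : CommitmentScheme) (n : ℕ+) : Set Str :=
  {c | ∃ b r, c = S.C₁ n b r}

theorem CommitmentScheme.commitments_nontrivial (S : CommitmentScheme) (n : ℕ+) :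
    (S.commitments n).Nontrivial := by
  refine ⟨S.C₁ n false fun _ => false, ⟨_, _, rfl⟩, S.C₁ n true fun _ => false, ⟨_, _, rfl⟩, ?_⟩
  intro h
  have h0 := S.opens n false fun _ => false
  have h1 := S.opens n true fun _ => false
  rw [h] at h0
  by_cases hs : S.C₂ n false (fun _ => false) = S.C₂ n true (fun _ => false)
  · rw [hs, h1] at h0
    simp at h0
  · rw [S.binding n true _ _ hs] at h0
    simp at h0

theorem finite_length_le (m : ℕ) : {s : Str | s.length ≤ m}.Finite := List.finite_length_le Bool m

theorem CommitmentScheme.commitments_finite (S : CommitmentScheme) (n : ℕ+) :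
    (S.commitments n).Finite := by
  refine (finite_length_le n).subset ?_
  rintro _ ⟨b, r, rfl⟩
  exact (S.length_C₁ n b r).le

/-! ### The two games -/

/-- The strings `0` and `1`. -/
def bitStrings : Set Str := {[false], [true]}

/-- `h` has length at most three and its actions are in `A`, `B`, `D`, in this order. -/
def IsStageHist (A B D : Set Str) : Hist → Prop
  | [] => True
  | [a] => a ∈ A
  | [a, b] => a ∈ A ∧ b ∈ B
  | [a, b, d] => a ∈ A ∧ b ∈ B ∧ d ∈ D
  | _ => False

/-- The histories of length at most three with actions in `A`, `B`, `D`, in this order. -/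
def stageHist (A B D : Set Str) : Set Hist := {h | IsStageHist A B D h}

/-- The actions available after `k` moves. -/
def stageSet (A B D : Set Str) : ℕ → Set Str
  | 0 => A
  | 1 => B
  | 2 => D
  | _ => ∅

theorem append_mem_stageHist (A B D : Set Str) (h : Hist) (a : Str) :
    h ++ [a] ∈ stageHist A B D ↔ h ∈ stageHist A B D ∧ a ∈ stageSet A B D h.length := by
  rcases h with _ | ⟨x, _ | ⟨y, _ | ⟨z, _ | ⟨w, l⟩⟩⟩⟩ <;>
    simp [stageHist, IsStageHist, stageSet, and_assoc]

theorem stageHist_finite {A B D : Set Str} (hA : A.Finite) (hB : B.Finite) (hD : D.Finite) :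
    (stageHist A B D).Finite := by
  have h1 := hA.image fun a => ([a] : Hist)
  have h2 := (hA.prod hB).image fun p => ([p.1, p.2] : Hist)
  have h3 := (hA.prod (hB.prod hD)).image fun p => ([p.1, p.2.1, p.2.2] : Hist)
  refine ((((Set.finite_singleton ([] : Hist)).union h1).union h2).union h3).subset ?_
  rintro (_ | ⟨x, _ | ⟨y, _ | ⟨z, _ | ⟨w, l⟩⟩⟩⟩) h <;>
    simp_all [stageHist, IsStageHist, Set.image]

/-- The two-player game in which player `0` chooses an action in `A`, then player `1` chooses an
action in `B`, then player `0` chooses an action in `D`. The utility of player `0` is `win` and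
the utility of player `1` is the opposite. -/
def stageGame (A B D : Set Str) (hA : A.Finite) (hB : B.Finite) (hD : D.Finite)
    (hA' : A.Nontrivial) (hB' : B.Nontrivial) (hD' : D.Nontrivial)
    (win : Hist → ℝ) (obs : Hist → List Str)
    (hobs : ∀ h h', obs h = obs h' → h.length = h'.length) : Game 2 where
  H := stageHist A B D
  finite := stageHist_finite hA hB hD
  nil_mem := trivial
  mem_of_append h a hh := ((append_mem_stageHist A B D h a).1 hh).1
  P h := if h.length = 1 then 1 else 0
  u i h := if i = 0 then win h else -win h
  obs := obs
  two_actions := by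
    rintro h - ⟨a, ha⟩
    obtain ⟨hh, ha⟩ := (append_mem_stageHist A B D h a).1 ha
    have key : (stageSet A B D h.length).Nontrivial := by
      revert ha
      rcases h.length with _ | _ | _ | k <;> simp [stageSet, hA', hB', hD']
    obtain ⟨x, hx, y, hy, hxy⟩ := key
    exact ⟨x, y, hxy, (append_mem_stageHist A B D h x).2 ⟨hh, hx⟩,
      (append_mem_stageHist A B D h y).2 ⟨hh, hy⟩⟩
  obs_player h h' _ _ e := by rw [hobs h h' e]
  obs_actions := by
    rintro h h' ⟨a, ha⟩ ⟨b, hb⟩ e x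
    rw [append_mem_stageHist] at ha hb
    rw [append_mem_stageHist, append_mem_stageHist, hobs h h' e]
    exact ⟨fun t => ⟨hb.1, t.2⟩, fun t => ⟨ha.1, t.2⟩⟩

theorem bitStrings_finite : bitStrings.Finite := by simp [bitStrings]

theorem bitStrings_nontrivial : bitStrings.Nontrivial :=
  ⟨[false], by simp [bitStrings], [true], by simp [bitStrings], by simp⟩

/-- In the third move, `[true]` stands for opening and `[false]` for destroying the envelope. -/
def envelopeWin : Hist → ℝ
  | [x, y, d] => if d = [true] ∧ x ≠ y then 1 else -1
  | _ => 0

/-- The envelope game: player `0` puts a bit in an envelope, player `1`, who does not see it,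
chooses a bit, and player `0` opens or destroys the envelope. Player `0` wins if the envelope is
opened and the bits differ. After the first move all histories have the same label. -/
def envelopeGame : Game 2 :=
  stageGame bitStrings bitStrings bitStrings bitStrings_finite bitStrings_finite bitStrings_finite
    bitStrings_nontrivial bitStrings_nontrivial bitStrings_nontrivial envelopeWin
    (fun h => if h.length = 1 then [[]] else h)
    (by
      intro h h' e
      have e' := congrArg List.length e
      by_cases h1 : h.length = 1 <;> by_cases h2 : h'.length = 1 <;>
        simp only [h1, h2, if_true, if_false, List.length_singleton] at e' ⊢ <;> omega)

/-- Player `0` wins if the key `s` opens the commitment `x` to a bit different from `y`. -/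
def commitmentWin (S : CommitmentScheme) : Hist → ℝ
  | [x, y, s] => if ∃ b, S.R x s = some b ∧ y ≠ [b] then 1 else -1
  | _ => 0

theorem keys_nontrivial (n : ℕ+) : {s : Str | s.length ≤ n}.Nontrivial :=
  ⟨[], by simp, [true], (n.pos : 0 < (n : ℕ)), by simp⟩

/-- The sequence of commitment games: in the `n`th game player `0` sends a commitment string with
security parameter `n`, player `1` chooses a bit, and player `0` sends a string of length at most
`n` (the commitment key, which opens the commitment, or any other string, which destroys it).
This is a game of perfect information: every history is its own label. -/
def commitmentGame (S : CommitmentScheme) (n : ℕ+) : Game 2 :=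
  stageGame (S.commitments n) bitStrings {s | s.length ≤ n}
    (S.commitments_finite n) bitStrings_finite (finite_length_le n)
    (S.commitments_nontrivial n) bitStrings_nontrivial (keys_nontrivial n)
    (commitmentWin S) (fun h => h) (fun _ _ e => congrArg List.length e)

end CompGame

end

/-!
A commitment string stands for the bit to which it commits; as the scheme is perfectly binding,
each string has at most one such bit and one key. The third move stands for opening the envelope if
it is the key and for destroying it otherwise.

The committing player implements a mixed strategy of the envelope game by drawing, up to a
negligible error, a bit and a decision for every reply from half of her tape; the other half is the
randomness of the scheme, so that she can compute the key again when it is time to open. The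
guessing player draws a bit and ignores the commitment. When the committing player deviates, the
bit she commits to and what she then does with the key already form a mixed strategy of the envelope
game, and nothing is lost. When the guessing player deviates, her reply to a commitment to `0` and
her reply to a commitment to `1` have nearly the same distribution, since otherwise she would break
the hiding property; drawing the former is a mixed strategy with nearly the same outcome.

Polynomial time comes from the closure of the functions computed by machines with several stacks
under composition, tupling and case distinction, together with finite-state transducers for the
basic functions.
-/

open MeasureTheory

noncomputable section

namespace CompGame

open Turing

/-! ### Programs on stacks -/

/-- `b` is reached from `a` in exactly `n` steps. -/
def Steps {C : Type*} (f : C → Option C) : ℕ → C → C → Prop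
  | 0, a, b => a = b
  | n + 1, a, b => ∃ c, f a = some c ∧ Steps f n c b

theorem Steps.trans {C : Type*} {f : C → Option C} {m n : ℕ} {a b c : C}
    (h : Steps f m a b) (h' : Steps f n b c) : Steps f (m + n) a c := by
  induction m generalizing a with
  | zero => cases h; simpa only [Nat.zero_add] using h'
  | succ m ih =>
    obtain ⟨d, hd, h⟩ := h
    rw [Nat.add_right_comm]
    exact ⟨d, hd, ih h⟩

theorem steps_iff_iterate {C : Type*} (f : C → Option C) (n : ℕ) (a b : C) :
    Steps f n a b ↔ (flip bind f)^[n] (some a) = some b := by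
  have iterate_none : ∀ n, (flip bind f)^[n] none = none := fun n => Function.iterate_fixed rfl n
  induction n generalizing a with
  | zero => simp [Steps]
  | succ n ih =>
    rw [Function.iterate_succ_apply]
    change (∃ c, f a = some c ∧ Steps f n c b) ↔ (flip bind f)^[n] (f a) = some b
    cases h : f a with
    | none => rw [iterate_none]; simp
    | some c => simp [ih]

/-- How a machine with stacks `K`, labels `Λ` and variables `σ` runs as a part of a machine with
stacks `K'`, labels `Λ'` and variables `σ'`: the variables of the part are a factor of those of the
whole, `ρ` is the other factor, and where the part halts, the whole machine jumps to `exit`, or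
halts if `exit = none`. -/
structure SubMachine (K K' Λ Λ' σ ρ σ' : Type) where
  stack : K ↪ K'
  label : Λ → Λ'
  exit : Option Λ'
  var : σ' ≃ σ × ρ

namespace SubMachine

variable {K K' Λ Λ' σ ρ σ' : Type} {Γ : K' → Type} (E : SubMachine K K' Λ Λ' σ ρ σ')

/-- The value `v` of the variables of the part, written into the variables of the whole. -/
def setVar (v : σ) (s : σ') : σ' := E.var.symm (v, (E.var s).2)

/-- A statement of the part as a statement of the whole machine. -/
def liftStmt : TM2.Stmt (fun k => Γ (E.stack k)) Λ σ → TM2.Stmt Γ Λ' σ'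
  | .push k f q => .push (E.stack k) (fun s => f (E.var s).1) (liftStmt q)
  | .peek k f q => .peek (E.stack k) (fun s o => E.setVar (f (E.var s).1 o) s) (liftStmt q)
  | .pop k f q => .pop (E.stack k) (fun s o => E.setVar (f (E.var s).1 o) s) (liftStmt q)
  | .load f q => .load (fun s => E.setVar (f (E.var s).1) s) (liftStmt q)
  | .branch f q q' => .branch (fun s => f (E.var s).1) (liftStmt q) (liftStmt q')
  | .goto f => .goto fun s => E.label (f (E.var s).1)
  | .halt => E.exit.elim .halt fun l => .goto fun _ => l

/-- The configuration `c'` of the whole machine shows the configuration `c` of the part, the other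
variables being `b` and the other stacks being as in `S`. -/
structure Simulates (b : ρ) (S : ∀ k, List (Γ k))
    (c : TM2.Cfg (fun k => Γ (E.stack k)) Λ σ) (c' : TM2.Cfg Γ Λ' σ') : Prop where
  label_eq : c'.l = c.l.elim E.exit fun l => some (E.label l)
  var_eq : c'.var = E.var.symm (c.var, b)
  stack_eq : (fun k => c'.stk (E.stack k)) = c.stk
  other_eq : ∀ k ∉ Set.range E.stack, c'.stk k = S k

variable {E} {b : ρ} {S : ∀ k, List (Γ k)} [DecidableEq K] [DecidableEq K']

theorem simulates_stepAux (q : TM2.Stmt (fun k => Γ (E.stack k)) Λ σ) (v : σ)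
    (S' : ∀ k, List (Γ k)) (hS : ∀ k ∉ Set.range E.stack, S' k = S k) :
    E.Simulates b S (TM2.stepAux q v fun k => S' (E.stack k))
      (TM2.stepAux (E.liftStmt q) (E.var.symm (v, b)) S') := by
  have update_other {S' : ∀ k, List (Γ k)} (hS : ∀ k ∉ Set.range E.stack, S' k = S k) (i : K)
      (l : List (Γ (E.stack i))) :
      ∀ k ∉ Set.range E.stack, Function.update S' (E.stack i) l k = S k := fun k hk =>
    (Function.update_of_ne (fun h => hk ⟨i, h.symm⟩) _ _).trans (hS k hk)
  induction q generalizing v S' with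
  | push i f q ih =>
    simp only [liftStmt, TM2.stepAux, Equiv.apply_symm_apply,
      ← Function.update_comp_eq_of_injective' S' E.stack.injective]
    exact ih v _ (update_other hS i _)
  | peek i f q ih =>
    simp only [liftStmt, TM2.stepAux, setVar, Equiv.apply_symm_apply]
    exact ih _ S' hS
  | pop i f q ih =>
    simp only [liftStmt, TM2.stepAux, setVar, Equiv.apply_symm_apply,
      ← Function.update_comp_eq_of_injective' S' E.stack.injective]
    exact ih _ _ (update_other hS i _)
  | load f q ih =>
    simp only [liftStmt, TM2.stepAux, setVar, Equiv.apply_symm_apply]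
    exact ih _ S' hS
  | branch f q q' ih ih' =>
    simp only [liftStmt, TM2.stepAux, Equiv.apply_symm_apply]
    cases f v
    · exact ih' v S' hS
    · exact ih v S' hS
  | goto f => exact ⟨by simp [liftStmt], rfl, rfl, hS⟩
  | halt => cases h : E.exit <;> exact ⟨by simp [liftStmt, h], by simp [liftStmt, h],
      by simp [liftStmt, h], by simpa [liftStmt, h] using hS⟩

theorem Simulates.steps {M : Λ → TM2.Stmt (fun k => Γ (E.stack k)) Λ σ}
    {M' : Λ' → TM2.Stmt Γ Λ' σ'} (hM : ∀ l, M' (E.label l) = E.liftStmt (M l)) {n : ℕ}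
    {c d : TM2.Cfg (fun k => Γ (E.stack k)) Λ σ} {c' : TM2.Cfg Γ Λ' σ'}
    (h : E.Simulates b S c c') (hc : Steps (TM2.step M) n c d) :
    ∃ d', Steps (TM2.step M') n c' d' ∧ E.Simulates b S d d' := by
  induction n generalizing c c' with
  | zero => exact ⟨c', rfl, hc ▸ h⟩
  | succ n ih =>
    obtain ⟨c₁, hc₁, hc⟩ := hc
    obtain ⟨_ | l, v, T⟩ := c
    · simp [TM2.step] at hc₁
    obtain ⟨l', v', T'⟩ := c'
    obtain ⟨rfl, rfl, stack_eq, hT⟩ := h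
    obtain rfl : (fun k => T' (E.stack k)) = T := stack_eq
    obtain rfl : TM2.stepAux (M l) v (fun k => T' (E.stack k)) = c₁ := by
      simpa only [TM2.step, Option.some.injEq] using hc₁
    obtain ⟨d', hd', hd⟩ := ih (simulates_stepAux (M l) v T' hT) hc
    exact ⟨d', ⟨_, by simp only [TM2.step, Option.elim_some, hM], hd'⟩, hd⟩

end SubMachine

/-- A program for a machine with stacks `K`, whose labels and variables have finitely many
values. -/
structure StackProgram (K : Type) (Γ : K → Type) where
  Λ : Type
  σ : Type
  [finite_Λ : Finite Λ]
  [finite_σ : Finite σ]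
  main : Λ
  initialState : σ
  m : Λ → TM2.Stmt Γ Λ σ

attribute [instance] StackProgram.finite_Λ StackProgram.finite_σ

namespace StackProgram

variable {K : Type} [DecidableEq K] {Γ : K → Type}

/-- Started with stacks `S`, the program halts within `t` steps in the initial state with stacks
`T`. -/
def Runs (c : StackProgram K Γ) (S T : ∀ k, List (Γ k)) (t : ℕ) : Prop :=
  ∃ n ≤ t, Steps (TM2.step c.m) n ⟨some c.main, c.initialState, S⟩ ⟨none, c.initialState, T⟩

theorem Runs.mono {c : StackProgram K Γ} {S T : ∀ k, List (Γ k)} {t t' : ℕ} (h : c.Runs S T t)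
    (ht : t ≤ t') : c.Runs S T t' :=
  let ⟨n, hn, h⟩ := h
  ⟨n, hn.trans ht, h⟩

theorem Runs.congr {c : StackProgram K Γ} {S T S' T' : ∀ k, List (Γ k)} {t t' : ℕ}
    (h : c.Runs S T t) (ht : t ≤ t') (hS : S = S') (hT : T = T') : c.Runs S' T' t' :=
  hS ▸ hT ▸ h.mono ht

/-- The first program as a part of the sequential composition. -/
def seqFst (c d : StackProgram K Γ) :
    SubMachine K K c.Λ (c.Λ ⊕ d.Λ) c.σ d.σ (c.σ × d.σ) where
  stack := .refl K
  label := .inl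
  exit := some (.inr d.main)
  var := .refl _

/-- The second program as a part of the sequential composition. -/
def seqSnd (c d : StackProgram K Γ) :
    SubMachine K K d.Λ (c.Λ ⊕ d.Λ) d.σ c.σ (c.σ × d.σ) where
  stack := .refl K
  label := .inr
  exit := none
  var := .prodComm _ _

/-- Sequential composition. -/
def seq (c d : StackProgram K Γ) : StackProgram K Γ where
  Λ := c.Λ ⊕ d.Λ
  σ := c.σ × d.σ
  main := .inl c.main
  initialState := (c.initialState, d.initialState)
  m := Sum.elim (fun l => (seqFst c d).liftStmt (c.m l)) fun l => (seqSnd c d).liftStmt (d.m l)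

theorem Runs.seq {c d : StackProgram K Γ} {S T U : ∀ k, List (Γ k)} {t t' : ℕ}
    (h : c.Runs S T t) (h' : d.Runs T U t') : (c.seq d).Runs S U (t + t') := by
  obtain ⟨n, hn, h⟩ := h
  obtain ⟨n', hn', h'⟩ := h'
  have start_fst : (seqFst c d).Simulates d.initialState S ⟨some c.main, c.initialState, S⟩
      ⟨some (.inl c.main), (c.initialState, d.initialState), S⟩ := ⟨rfl, rfl, rfl, fun _ _ => rfl⟩
  obtain ⟨⟨_, _, T'⟩, hsteps, rfl, rfl, hT', -⟩ :=
    start_fst.steps (M' := (c.seq d).m) (fun _ => rfl) h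
  obtain rfl : T' = T := hT'
  have start_snd : (seqSnd c d).Simulates c.initialState T' ⟨some d.main, d.initialState, T'⟩
      ⟨some (.inr d.main), (c.initialState, d.initialState), T'⟩ := ⟨rfl, rfl, rfl, fun _ _ => rfl⟩
  obtain ⟨⟨_, _, U'⟩, hsteps', rfl, rfl, hU', -⟩ :=
    start_snd.steps (M' := (c.seq d).m) (fun _ => rfl) h'
  obtain rfl : U' = U := hU'
  exact ⟨n + n', by lia, hsteps.trans hsteps'⟩

/-- A program whose stacks are renamed by `j`, as a part of a program on the stacks `K`. -/
def embedding {K₀ : Type} (j : K₀ ↪ K) (c : StackProgram K₀ fun k => Γ (j k)) :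
    SubMachine K₀ K c.Λ c.Λ c.σ PUnit.{1} c.σ where
  stack := j
  label := id
  exit := none
  var := (Equiv.prodPUnit _).symm

/-- The program `c` on the stacks in the range of `j`. -/
def embed {K₀ : Type} (j : K₀ ↪ K) (c : StackProgram K₀ fun k => Γ (j k)) : StackProgram K Γ where
  Λ := c.Λ
  σ := c.σ
  main := c.main
  initialState := c.initialState
  m l := (embedding j c).liftStmt (c.m l)

theorem Runs.embed {K₀ : Type} [DecidableEq K₀] {j : K₀ ↪ K}
    {c : StackProgram K₀ fun k => Γ (j k)} {S T : ∀ k, List (Γ (j k))} {t : ℕ} (h : c.Runs S T t)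
    {S' T' : ∀ k, List (Γ k)} (hS : ∀ k, S' (j k) = S k) (hT : ∀ k, T' (j k) = T k)
    (hother : ∀ k ∉ Set.range j, T' k = S' k) : (c.embed j).Runs S' T' t := by
  obtain ⟨n, hn, h⟩ := h
  have start : (embedding j c).Simulates ⟨⟩ S' ⟨some c.main, c.initialState, S⟩
      ⟨some c.main, c.initialState, S'⟩ := ⟨rfl, rfl, funext hS, fun _ _ => rfl⟩
  obtain ⟨⟨_, _, U⟩, hsteps, rfl, rfl, hU, hU'⟩ :=
    start.steps (M' := (c.embed j).m) (fun _ => rfl) h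
  obtain rfl : U = T' := by
    funext k
    by_cases hk : k ∈ Set.range j
    · obtain ⟨i, rfl⟩ := hk
      exact (congrFun hU i).trans (hT i).symm
    · exact (hU' k hk).trans (hother k hk).symm
  exact ⟨n, hn, hsteps⟩

end StackProgram

/-! ### Output length -/

section Length

variable {K : Type} {Γ : K → Type} {Λ σ : Type}

/-- The number of push instructions of a statement. -/
def pushCount : TM2.Stmt Γ Λ σ → ℕ
  | .push _ _ q => pushCount q + 1
  | .peek _ _ q => pushCount q
  | .pop _ _ q => pushCount q
  | .load _ q => pushCount q
  | .branch _ q q' => pushCount q + pushCount q'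
  | .goto _ => 0
  | .halt => 0

variable [DecidableEq K]

theorem length_stepAux_le (q : TM2.Stmt Γ Λ σ) (v : σ) (S : ∀ k, List (Γ k)) (k : K) :
    ((TM2.stepAux q v S).stk k).length ≤ (S k).length + pushCount q := by
  induction q generalizing v S with
  | push i f _ ih =>
    refine (ih v _).trans ?_
    rcases eq_or_ne k i with rfl | h
    · simp only [Function.update_self, List.length_cons, pushCount]; lia
    · simp [pushCount, h]
  | peek i f _ ih => exact ih _ _
  | pop i f _ ih =>
    refine (ih _ _).trans ?_
    rcases eq_or_ne k i with rfl | h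
    · simp [pushCount]
    · simp [pushCount, h]
  | load f _ ih => exact ih _ _
  | branch f _ _ ih ih' =>
    simp only [TM2.stepAux, pushCount]
    cases f v
    · exact (ih' v S).trans (by lia)
    · exact (ih v S).trans (by lia)
  | goto f => simp [pushCount]
  | halt => simp [pushCount]

theorem Steps.length_stk_le {M : Λ → TM2.Stmt Γ Λ σ} {B : ℕ} (hB : ∀ l, pushCount (M l) ≤ B)
    {n : ℕ} {a b : TM2.Cfg Γ Λ σ} (h : Steps (TM2.step M) n a b) (k : K) :
    (b.stk k).length ≤ (a.stk k).length + B * n := by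
  induction n generalizing a with
  | zero => cases h; simp
  | succ n ih =>
    obtain ⟨d, hd, h⟩ := h
    obtain ⟨_ | l, v, S⟩ := a
    · simp [TM2.step] at hd
    simp only [TM2.step, Option.some.injEq] at hd
    have first_step := length_stepAux_le (M l) v S k
    rw [hd] at first_step
    have := ih h
    have := hB l
    simp only [Nat.mul_add]
    lia

theorem StackProgram.exists_length_le (c : StackProgram K Γ) : ∃ B : ℕ, ∀ {S T t},
    c.Runs S T t → ∀ k, (T k).length ≤ (S k).length + B * t := by
  obtain ⟨B, hB⟩ := (Set.finite_range fun l => pushCount (c.m l)).bddAbove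
  refine ⟨B, ?_⟩
  rintro S T t ⟨n, hn, h⟩ k
  refine (h.length_stk_le (fun l => hB ⟨l, rfl⟩) k).trans ?_
  gcongr

end Length

/-! ### Automata with stacks -/

/-- An automaton that repeatedly pops a symbol from the stack `source` of its state and pushes
symbols, and halts when `source` is `none`. The symbols read are decoded to the finite alphabet
`A`. -/
structure StackAutomaton (K : Type) (Γ : K → Type) where
  A : Type
  Q : Type
  [finite_A : Finite A]
  [finite_Q : Finite Q]
  start : Q
  source : Q → Option (Σ k, (Γ k → A))
  next : Q → Option A → Q × List (Σ k, Γ k)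

attribute [instance] StackAutomaton.finite_A StackAutomaton.finite_Q

section StackAutomaton

variable {K : Type} [DecidableEq K] {Γ : K → Type}

/-- Push symbols, the first one first. -/
def pushAll (S : ∀ k, List (Γ k)) (L : List (Σ k, Γ k)) : ∀ k, List (Γ k) :=
  L.foldl (fun S p => Function.update S p.1 (p.2 :: S p.1)) S

/-- The symbols in the list that are for the stack `k`. -/
def forStack (k : K) (L : List (Σ k, Γ k)) : List (Γ k) :=
  L.filterMap fun p => if h : p.1 = k then some (h ▸ p.2) else none

@[simp] theorem forStack_nil (k : K) : forStack k ([] : List (Σ k, Γ k)) = [] := rfl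

@[simp] theorem forStack_cons_self (k : K) (a : Γ k) (L : List (Σ k, Γ k)) :
    forStack k (⟨k, a⟩ :: L) = a :: forStack k L := by
  simp [forStack]

theorem forStack_cons_of_ne {k i : K} (h : i ≠ k) (a : Γ i) (L : List (Σ k, Γ k)) :
    forStack k (⟨i, a⟩ :: L) = forStack k L := by
  simp [forStack, h]

@[simp] theorem forStack_append (k : K) (L L' : List (Σ k, Γ k)) :
    forStack k (L ++ L') = forStack k L ++ forStack k L' :=
  List.filterMap_append

theorem pushAll_apply (S : ∀ k, List (Γ k)) (L : List (Σ k, Γ k)) (k : K) :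
    pushAll S L k = (forStack k L).reverse ++ S k := by
  induction L generalizing S with
  | nil => simp [pushAll]
  | cons p L ih =>
    obtain ⟨i, a⟩ := p
    change pushAll (Function.update S i (a :: S i)) L k = _
    rw [ih]
    rcases eq_or_ne i k with rfl | h
    · simp
    · rw [forStack_cons_of_ne h, Function.update_of_ne h.symm]

/-- Push symbols, then continue with `q`. -/
def pushStmt {Λ σ : Type} (q : TM2.Stmt Γ Λ σ) : List (Σ k, Γ k) → TM2.Stmt Γ Λ σ
  | [] => q
  | p :: L => .push p.1 (fun _ => p.2) (pushStmt q L)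

theorem stepAux_pushStmt {Λ σ : Type} (q : TM2.Stmt Γ Λ σ) (L : List (Σ k, Γ k)) (v : σ)
    (S : ∀ k, List (Γ k)) : TM2.stepAux (pushStmt q L) v S = TM2.stepAux q v (pushAll S L) := by
  induction L generalizing S with
  | nil => rfl
  | cons _ _ ih => exact ih _

namespace StackAutomaton

/-- The program of the automaton: a label `inl q` pops a symbol in state `q`, a label `inr (q, o)`
processes the symbol `o`. -/
def toProgram (P : StackAutomaton K Γ) : StackProgram K Γ where
  Λ := P.Q ⊕ (P.Q × Option P.A)
  σ := Option P.A
  main := .inl P.start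
  initialState := none
  m
    | .inl q => match P.source q with
      | none => .halt
      | some p => .pop p.1 (fun _ o => o.map p.2) (.goto fun s => .inr (q, s))
    | .inr (q, o) => pushStmt (.load (fun _ => none) (.goto fun _ => .inl (P.next q o).1))
        (P.next q o).2

/-- The automaton gets from state `q` and stacks `S` to state `q'` and stacks `S'` within `t`
steps of its program. -/
def Reach (P : StackAutomaton K Γ) (t : ℕ) (q : P.Q) (S : ∀ k, List (Γ k)) (q' : P.Q)
    (S' : ∀ k, List (Γ k)) : Prop :=
  ∃ n ≤ t, Steps (TM2.step P.toProgram.m) n ⟨some (.inl q), none, S⟩ ⟨some (.inl q'), none, S'⟩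

variable {P : StackAutomaton K Γ}

theorem Reach.trans {t t' : ℕ} {q q' q'' : P.Q} {S S' S'' : ∀ k, List (Γ k)}
    (h : P.Reach t q S q' S') (h' : P.Reach t' q' S' q'' S'') : P.Reach (t + t') q S q'' S'' := by
  obtain ⟨n, hn, h⟩ := h
  obtain ⟨n', hn', h'⟩ := h'
  exact ⟨n + n', by lia, h.trans h'⟩

theorem Reach.mono {t t' : ℕ} {q q' : P.Q} {S S' : ∀ k, List (Γ k)}
    (h : P.Reach t q S q' S') (ht : t ≤ t') : P.Reach t' q S q' S' :=
  let ⟨n, hn, h⟩ := h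
  ⟨n, hn.trans ht, h⟩

theorem Reach.congr {t t' : ℕ} {q q' : P.Q} {S S' T : ∀ k, List (Γ k)}
    (h : P.Reach t q S q' S') (ht : t ≤ t') (hT : S' = T) : P.Reach t' q S q' T :=
  hT ▸ h.mono ht

theorem reach_read {q q' : P.Q} {p : Σ k, (Γ k → P.A)} {S S' : ∀ k, List (Γ k)}
    {L : List (Σ k, Γ k)} (hsource : P.source q = some p)
    (hnext : P.next q ((S p.1).head?.map p.2) = (q', L))
    (hS' : pushAll (Function.update S p.1 (S p.1).tail) L = S') : P.Reach 2 q S q' S' := by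
  refine ⟨2, le_rfl, ⟨some (.inr (q, (S p.1).head?.map p.2)), (S p.1).head?.map p.2,
    Function.update S p.1 (S p.1).tail⟩, ?_, ⟨some (.inl q'), none, S'⟩, ?_, rfl⟩
  · simp [TM2.step, toProgram, hsource]
  · simp [TM2.step, toProgram, stepAux_pushStmt, hnext, hS']

theorem Reach.runs {t : ℕ} {q : P.Q} {S T : ∀ k, List (Γ k)}
    (h : P.Reach t P.start S q T) (hq : P.source q = none) : P.toProgram.Runs S T (t + 1) := by
  obtain ⟨n, hn, h⟩ := h
  exact ⟨n + 1, by lia, h.trans ⟨_, by simp [TM2.step, toProgram, hq], rfl⟩⟩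

end StackAutomaton

/-! ### Finite-state transducers -/

/-- The output of the finite-state transducer with transitions `δ` and final outputs `fin`, started
in the state `q`. -/
def transduce {Q A B : Type} (δ : Q → A → Q × List B) (fin : Q → List B) : Q → List A → List B
  | q, [] => fin q
  | q, a :: l => (δ q a).2 ++ transduce δ fin (δ q a).1 l

theorem transduce_unit {A B : Type} (g : A → List B) (l : List A) :
    transduce (fun _ a => ((), g a)) (fun _ => []) () l = l.flatMap g := by
  induction l with
  | nil => rfl
  | cons a l ih => simp [transduce, ih]

theorem transduce_map {Q A B C : Type} (g : B → C) (δ : Q → A → Q × List B) (fin : Q → List B)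
    (q : Q) (l : List A) :
    transduce (fun q a => ((δ q a).1, (δ q a).2.map g)) (fun q => (fin q).map g) q l =
      (transduce δ fin q l).map g := by
  induction l generalizing q with
  | nil => rfl
  | cons a l ih => simp only [transduce, ih, List.map_append]

section Transducer

variable {Q A : Type} [Finite Q] [Finite A]

/-- Empty the stack `k` while running a transducer whose output symbols are pushed. -/
def transducer (k : K) (e : Γ k → A) (δ : Q → A → Q × List (Σ k, Γ k))
    (fin : Q → List (Σ k, Γ k)) (q : Q) : StackAutomaton K Γ where
  A := A
  Q := Option Q
  start := some q
  source := Option.map fun _ => ⟨k, e⟩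
  next
    | some q, some a => (some (δ q a).1, (δ q a).2)
    | some q, none => (none, fin q)
    | none, _ => (none, [])

variable {k : K} {e : Γ k → A} {δ : Q → A → Q × List (Σ k, Γ k)} {fin : Q → List (Σ k, Γ k)}
  {T : ∀ k, List (Γ k)}

theorem transducer_reach (hδ : ∀ q a, forStack k (δ q a).2 = [])
    (hfin : ∀ q, forStack k (fin q) = []) (hk : T k = []) (q₀ q : Q) (S : ∀ k, List (Γ k))
    (hT : ∀ i, i ≠ k → T i = (forStack i (transduce δ fin q ((S k).map e))).reverse ++ S i) :
    (transducer k e δ fin q₀).Reach (2 * (S k).length + 2) (some q) S none T := by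
  induction hS : S k generalizing q S with
  | nil =>
    rw [hS] at hT
    refine (StackAutomaton.reach_read (p := ⟨k, e⟩) (L := fin q) rfl (by rw [hS]; rfl) ?_).mono
      (by simp)
    funext i
    rw [pushAll_apply]
    rcases eq_or_ne i k with rfl | hi
    · simp [hfin, hS, hk]
    · rw [hT i hi, Function.update_of_ne hi]
      rfl
  | cons a l ih =>
    rw [hS] at hT
    have after_read := ih (δ q (e a)).1
      (pushAll (Function.update S k (S k).tail) (δ q (e a)).2)
      (fun i hi => by simp [hT i hi, pushAll_apply, hδ, hS, transduce, hi])
      (by simp [pushAll_apply, hδ, hS])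
    refine ((StackAutomaton.reach_read (p := ⟨k, e⟩) (L := (δ q (e a)).2) rfl
      (by rw [hS]; rfl) rfl).trans after_read).mono ?_
    simp only [List.length_cons]
    lia

theorem transducer_runs {q : Q} {S : ∀ k, List (Γ k)} (hδ : ∀ q a, forStack k (δ q a).2 = [])
    (hfin : ∀ q, forStack k (fin q) = []) (hk : T k = [])
    (hT : ∀ i, i ≠ k → T i = (forStack i (transduce δ fin q ((S k).map e))).reverse ++ S i) :
    (transducer k e δ fin q).toProgram.Runs S T (2 * (S k).length + 3) :=
  (transducer_reach hδ hfin hk q q S hT).runs rfl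

/-- Empty the stack `k` and push the symbols `g a` for every symbol `a`. -/
def pour (k : K) (e : Γ k → A) (g : A → List (Σ k, Γ k)) : StackProgram K Γ :=
  (transducer k e (fun _ a => ((), g a)) (fun _ => []) ()).toProgram

theorem pour_runs {g : A → List (Σ k, Γ k)} (hg : ∀ a, forStack k (g a) = [])
    {S : ∀ k, List (Γ k)} (hk : T k = [])
    (hT : ∀ i, i ≠ k → T i = (((S k).map e).flatMap fun a => forStack i (g a)).reverse ++ S i) :
    (pour k e g).Runs S T (2 * (S k).length + 3) := by
  refine transducer_runs (fun _ => hg) (fun _ => rfl) hk fun i hi => ?_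
  rw [hT i hi, transduce_unit, forStack, List.filterMap_flatMap]
  rfl

end Transducer

/-! ### Moving words between stacks -/

/-- The stack `k` contains `l`, the other stacks are empty. -/
def single (k : K) (l : List (Γ k)) : ∀ k, List (Γ k) :=
  Function.update (fun _ => []) k l

@[simp] theorem single_self (k : K) (l : List (Γ k)) : single k l k = l :=
  Function.update_self ..

theorem single_of_ne {k i : K} (h : i ≠ k) (l : List (Γ k)) : single k l i = [] :=
  Function.update_of_ne h ..

/-- The stacks `k` and `k'` contain `l` and `l'`, the other stacks are empty. -/
def double (k : K) (l : List (Γ k)) (k' : K) (l' : List (Γ k')) : ∀ k, List (Γ k) :=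
  Function.update (single k l) k' l'

@[simp] theorem double_right (k : K) (l : List (Γ k)) (k' : K) (l' : List (Γ k')) :
    double k l k' l' k' = l' :=
  Function.update_self ..

theorem double_left {k k' : K} (h : k ≠ k') (l : List (Γ k)) (l' : List (Γ k')) :
    double k l k' l' k = l := by
  rw [double, Function.update_of_ne h, single_self]

theorem double_of_ne {k k' i : K} (h : i ≠ k) (h' : i ≠ k') (l : List (Γ k)) (l' : List (Γ k')) :
    double k l k' l' i = [] := by
  rw [double, Function.update_of_ne h', single_of_ne h]

theorem double_comm {k k' : K} (h : k ≠ k') (l : List (Γ k)) (l' : List (Γ k')) :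
    double k l k' l' = double k' l' k l :=
  Function.update_comm h ..

section Move

variable {A : Type} [Finite A]

/-- Move the content of the stack `k` to the stack `k'`, which reverses it. -/
def move (k k' : K) (e : Γ k ≃ A) (e' : Γ k' ≃ A) : StackProgram K Γ :=
  pour k e fun a => [⟨k', e'.symm a⟩]

variable {i k k' : K} {e : Γ k ≃ A} {e' : Γ k' ≃ A}

theorem move_runs (hk : k' ≠ k) {l : List A} {S T : ∀ k, List (Γ k)} (hS : S k = l.map e.symm)
    (hTk : T k = []) (hTk' : T k' = l.reverse.map e'.symm ++ S k')
    (hT : ∀ i, i ≠ k → i ≠ k' → T i = S i) : (move k k' e e').Runs S T (2 * l.length + 3) := by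
  refine (pour_runs (fun a => forStack_cons_of_ne hk _ _) hTk fun i hi => ?_).mono (by simp [hS])
  rcases eq_or_ne i k' with rfl | hi'
  · rw [hTk', hS]
    congr 1
    simp [Function.comp_def, ← List.map_eq_flatMap]
  · rw [hT i hi hi']
    simp [forStack_cons_of_ne hi'.symm]

theorem move_single (hk : k' ≠ k) (l : List A) :
    (move k k' e e').Runs (single k (l.map e.symm)) (single k' (l.reverse.map e'.symm))
      (2 * l.length + 3) := by
  refine move_runs hk (single_self _ _) (single_of_ne hk.symm _) ?_ fun i hi hi' => ?_
  · rw [single_self, single_of_ne hk, List.append_nil]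
  · rw [single_of_ne hi, single_of_ne hi']

theorem move_double (hk : k' ≠ k) (hi : i ≠ k) (hi' : i ≠ k') (x : List (Γ i)) (l : List A) :
    (move k k' e e').Runs (double i x k (l.map e.symm)) (double i x k' (l.reverse.map e'.symm))
      (2 * l.length + 3) := by
  refine move_runs hk (double_right _ _ _ _) (double_of_ne hi.symm hk.symm _ _) ?_
    fun j hj hj' => ?_
  · rw [double_right, double_of_ne hi'.symm hk, List.append_nil]
  · rcases eq_or_ne j i with rfl | hji
    · rw [double_left hi, double_left hi']
    · rw [double_of_ne hji hj', double_of_ne hji hj]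

theorem move_onto (hk : k' ≠ k) (x l : List A) :
    (move k k' e e').Runs (double k' (x.map e'.symm) k (l.map e.symm))
      (single k' ((l.reverse ++ x).map e'.symm)) (2 * l.length + 3) := by
  refine move_runs hk (double_right _ _ _ _) (single_of_ne hk.symm _) ?_ fun j hj hj' => ?_
  · rw [single_self, double_left hk, List.map_append]
  · rw [double_of_ne hj' hj, single_of_ne hj']

/-- Move the content of the stack `k` to both stacks `k₁` and `k₂`. -/
def fork (k k₁ k₂ : K) (e : Γ k ≃ A) (e₁ : Γ k₁ ≃ A) (e₂ : Γ k₂ ≃ A) : StackProgram K Γ :=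
  pour k e fun a => [⟨k₁, e₁.symm a⟩, ⟨k₂, e₂.symm a⟩]

theorem fork_runs {k₁ k₂ : K} {e₁ : Γ k₁ ≃ A} {e₂ : Γ k₂ ≃ A} (h₁ : k₁ ≠ k) (h₂ : k₂ ≠ k)
    (h : k₁ ≠ k₂) (l : List A) : (fork k k₁ k₂ e e₁ e₂).Runs (single k (l.map e.symm))
      (double k₁ (l.reverse.map e₁.symm) k₂ (l.reverse.map e₂.symm)) (2 * l.length + 3) := by
  refine (pour_runs (fun a => ?_) (double_of_ne h₁.symm h₂.symm _ _) fun i hi => ?_).mono (by simp)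
  · rw [forStack_cons_of_ne h₁, forStack_cons_of_ne h₂, forStack_nil]
  · rw [single_of_ne hi, single_self]
    rcases eq_or_ne i k₁ with rfl | hi₁
    · simp [double_left h, forStack_cons_of_ne h.symm, Function.comp_def, ← List.map_eq_flatMap]
    rcases eq_or_ne i k₂ with rfl | hi₂
    · simp [forStack_cons_of_ne h, Function.comp_def, ← List.map_eq_flatMap]
    · rw [double_of_ne hi₁ hi₂]
      simp [forStack_cons_of_ne hi₁.symm, forStack_cons_of_ne hi₂.symm]

end Move

section TransduceOnto

variable {α β Q : Type} [Finite Q] [Finite α]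

theorem forStack_map_self {k : K} (e : β → Γ k) (l : List β) :
    forStack k (l.map fun b => ⟨k, e b⟩) = l.map e := by
  induction l with
  | nil => rfl
  | cons b l ih => simpa only [List.map_cons, forStack_cons_self] using congrArg _ ih

theorem forStack_map_of_ne {k i : K} (h : i ≠ k) (e : β → Γ i) (l : List β) :
    forStack k (l.map fun b => (⟨i, e b⟩ : Σ k, Γ k)) = [] := by
  induction l with
  | nil => rfl
  | cons b l ih => rwa [List.map_cons, forStack_cons_of_ne h]

/-- Empty the stack `k₀` and push the output of a transducer to the stack `k₁`. -/
def transduceOnto {k₀ k₁ : K} (e₀ : Γ k₀ ≃ α) (e₁ : Γ k₁ ≃ β) (δ : Q → α → Q × List β)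
    (fin : Q → List β) (q : Q) : StackProgram K Γ :=
  (transducer k₀ e₀ (fun q a => ((δ q a).1, (δ q a).2.map fun b => ⟨k₁, e₁.symm b⟩))
    (fun q => (fin q).map fun b => ⟨k₁, e₁.symm b⟩) q).toProgram

theorem transduceOnto_runs {k₀ k₁ : K} (e₀ : Γ k₀ ≃ α) (e₁ : Γ k₁ ≃ β) (δ : Q → α → Q × List β)
    (fin : Q → List β) (q : Q) (h : k₁ ≠ k₀) (l : List α) :
    (transduceOnto e₀ e₁ δ fin q).Runs (single k₀ (l.map e₀.symm))
      (single k₁ ((transduce δ fin q l).reverse.map e₁.symm)) (2 * l.length + 3) := by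
  refine (transducer_runs (fun _ _ => forStack_map_of_ne h _ _) (fun _ => forStack_map_of_ne h _ _)
    (single_of_ne h.symm _) fun k hk => ?_).mono (by simp)
  rw [transduce_map, single_of_ne hk, single_self, List.append_nil]
  rcases eq_or_ne k k₁ with rfl | hk'
  · simp [forStack_map_self, Function.comp_def]
  · rw [forStack_map_of_ne hk'.symm, single_of_ne hk']
    rfl

theorem exists_runs_transduce [Finite β] {k₀ k₁ k₂ : K} (e₀ : Γ k₀ ≃ α) (e₁ : Γ k₁ ≃ β)
    (e₂ : Γ k₂ ≃ β) (δ : Q → α → Q × List β) (fin : Q → List β) (q : Q) (h₀₁ : k₁ ≠ k₀)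
    (h₁₂ : k₂ ≠ k₁) :
    ∃ (c : StackProgram K Γ) (p : Polynomial ℕ), ∀ l, c.Runs (single k₀ (l.map e₀.symm))
      (single k₂ ((transduce δ fin q l).map e₂.symm)) (p.eval l.length) := by
  obtain ⟨B, hB⟩ := (transduceOnto e₀ e₁ δ fin q).exists_length_le
  refine ⟨(transduceOnto e₀ e₁ δ fin q).seq (move k₁ k₂ e₁ e₂),
    2 * Polynomial.X + 3 + (2 * (Polynomial.C B * (2 * Polynomial.X + 3)) + 3), fun l => ?_⟩
  have output_onto := transduceOnto_runs e₀ e₁ δ fin q h₀₁ l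
  have length_output := hB output_onto k₁
  rw [single_self, single_of_ne h₀₁, List.length_nil, zero_add, List.length_map] at length_output
  have run := output_onto.seq (move_single (e' := e₂) h₁₂ (transduce δ fin q l).reverse)
  rw [List.reverse_reverse] at run
  refine run.mono ?_
  simp only [Polynomial.eval_add, Polynomial.eval_mul, Polynomial.eval_X, Polynomial.eval_C,
    Polynomial.eval_ofNat]
  lia

end TransduceOnto

end StackAutomaton

/-! ### Polynomial time between words -/

/-- A machine with input word `u x` outputs the word `v x` in time polynomial in the length of the
input. -/
def PolyTimeFrom {X : Type*} {α β : Type} (u : X → List α) (v : X → List β) : Prop :=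
  ∃ (K : Type) (_ : DecidableEq K) (_ : Finite K) (Γ : K → Type) (c : StackProgram K Γ)
    (k₀ k₁ : K) (e₀ : Γ k₀ ≃ α) (e₁ : Γ k₁ ≃ β) (p : Polynomial ℕ), ∀ x,
    c.Runs (single k₀ ((u x).map e₀.symm)) (single k₁ ((v x).map e₁.symm)) (p.eval (u x).length)

theorem initList_eq_single (tm : FinTM2) (s : List (tm.Γ tm.k₀)) :
    initList tm s = ⟨some tm.main, tm.initialState, single tm.k₀ s⟩ := by
  unfold initList
  congr 1
  funext k
  by_cases h : k = tm.k₀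
  · subst h; simp
  · simp [single_of_ne h, h]

theorem haltList_eq_single (tm : FinTM2) (s : List (tm.Γ tm.k₁)) :
    haltList tm s = ⟨none, tm.initialState, single tm.k₁ s⟩ := by
  unfold haltList
  congr 1
  funext k
  by_cases h : k = tm.k₁
  · subst h; simp
  · simp [single_of_ne h, h]

theorem isPolyTime_iff {g : List Str → Str} : IsPolyTime g ↔ PolyTimeFrom encTuple g := by
  constructor
  · rintro ⟨⟨⟨tm, e₀, e₁⟩, p, h⟩⟩
    have := tm.kFin
    have := tm.ΛFin
    have := tm.σFin
    refine ⟨tm.K, inferInstance, inferInstance, tm.Γ, ⟨tm.Λ, tm.σ, tm.main, tm.initialState, tm.m⟩,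
      tm.k₀, tm.k₁, e₀, e₁, p, fun x => ?_⟩
    obtain ⟨⟨n, hn⟩, hle⟩ := h x
    refine ⟨n, hle, (steps_iff_iterate _ _ _ _).2 ?_⟩
    rw [initList_eq_single] at hn
    exact hn.trans (congrArg some (haltList_eq_single tm _))
  · rintro ⟨K, _, _, Γ, c, k₀, k₁, e₀, e₁, p, h⟩
    have := Fintype.ofFinite K
    have := Fintype.ofFinite c.Λ
    have := Fintype.ofFinite c.σ
    have := Fintype.ofEquiv _ e₀.symm
    let tm : FinTM2 :=
      { K := K, k₀ := k₀, k₁ := k₁, Γ := Γ, Λ := c.Λ, main := c.main, σ := c.σ,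
        initialState := c.initialState, m := c.m }
    refine ⟨⟨⟨tm, e₀, e₁⟩, p, fun x => Classical.choice ?_⟩⟩
    obtain ⟨n, hle, hn⟩ := h x
    refine ⟨⟨⟨n, ?_⟩, hle⟩⟩
    rw [initList_eq_single]
    exact ((steps_iff_iterate _ _ _ _).1 hn).trans
      (congrArg some (haltList_eq_single tm _).symm)

theorem eval_mono (p : Polynomial ℕ) {m n : ℕ} (h : m ≤ n) : p.eval m ≤ p.eval n := by
  rw [Polynomial.eval_eq_sum_range, Polynomial.eval_eq_sum_range]
  gcongr

namespace PolyTimeFrom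

variable {X : Type*} {α β : Type}

theorem reindex {Y : Type*} {u : X → List α} {v : X → List β} (h : PolyTimeFrom u v) (F : Y → X) :
    PolyTimeFrom (fun y => u (F y)) fun y => v (F y) :=
  let ⟨K, i₁, i₂, Γ, c, k₀, k₁, e₀, e₁, p, h⟩ := h
  ⟨K, i₁, i₂, Γ, c, k₀, k₁, e₀, e₁, p, fun y => h (F y)⟩

theorem exists_length_le {u : X → List α} {v : X → List β} (h : PolyTimeFrom u v) :
    ∃ p : Polynomial ℕ, ∀ x, (v x).length ≤ p.eval (u x).length := by
  obtain ⟨K, _, _, Γ, c, k₀, k₁, e₀, e₁, p, h⟩ := h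
  obtain ⟨B, hB⟩ := c.exists_length_le
  refine ⟨Polynomial.X + Polynomial.C B * p, fun x => ?_⟩
  have length_output := hB (h x) k₁
  have length_input : (single (Γ := Γ) k₀ ((u x).map e₀.symm) k₁).length ≤ (u x).length := by
    rcases eq_or_ne k₁ k₀ with rfl | hk
    · simp
    · simp [single_of_ne hk]
  simp only [single_self, List.length_map] at length_output
  simp only [Polynomial.eval_add, Polynomial.eval_X, Polynomial.eval_mul, Polynomial.eval_C]
  lia

theorem transduce_self {Q : Type} [Finite Q] [Finite α] [Finite β] (u : X → List α)
    (δ : Q → α → Q × List β) (fin : Q → List β) (q : Q) :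
    PolyTimeFrom u fun x => transduce δ fin q (u x) := by
  let Γ : Option Bool → Type := fun k => k.elim α fun _ => β
  obtain ⟨c, p, h⟩ := exists_runs_transduce (Γ := Γ) (k₀ := none) (k₁ := some false)
    (k₂ := some true) (Equiv.refl α) (Equiv.refl β) (Equiv.refl β) δ fin q (by simp) (by simp)
  exact ⟨Option Bool, inferInstance, inferInstance, Γ, c, none, some true, Equiv.refl α,
    Equiv.refl β, p, fun x => h (u x)⟩

end PolyTimeFrom

/-! ### Composition and concatenation -/

section Transfer

variable {K : Type} [DecidableEq K] {Γ : K → Type} {A : Type} [Finite A]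

/-- Move the content of the stack `k` to the stack `k'` by way of the stack `t`, which keeps the
order of the symbols. -/
def transfer (k t k' : K) (e : Γ k ≃ A) (eₜ : Γ t ≃ A) (e' : Γ k' ≃ A) : StackProgram K Γ :=
  (move k t e eₜ).seq (move t k' eₜ e')

variable {i k t k' : K} {e : Γ k ≃ A} {eₜ : Γ t ≃ A} {e' : Γ k' ≃ A}

theorem transfer_single (ht : t ≠ k) (hk' : k' ≠ t) (l : List A) :
    (transfer k t k' e eₜ e').Runs (single k (l.map e.symm)) (single k' (l.map e'.symm))
      (4 * l.length + 6) := by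
  refine ((move_single ht l).seq (move_single hk' l.reverse)).congr ?_ rfl ?_
  · simp only [List.length_reverse]; lia
  · rw [List.reverse_reverse]

theorem transfer_double (ht : t ≠ k) (hk' : k' ≠ t) (hi : i ≠ k) (hit : i ≠ t) (hi' : i ≠ k')
    (x : List (Γ i)) (l : List A) :
    (transfer k t k' e eₜ e').Runs (double i x k (l.map e.symm)) (double i x k' (l.map e'.symm))
      (4 * l.length + 6) := by
  refine ((move_double ht hi hit x l).seq (move_double hk' hit hi' x l.reverse)).congr ?_ rfl ?_
  · simp only [List.length_reverse]; lia
  · rw [List.reverse_reverse]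

theorem transfer_onto (ht : t ≠ k) (hk' : k' ≠ t) (h : k' ≠ k) (x l : List A) :
    (transfer k t k' e eₜ e').Runs (double k' (x.map e'.symm) k (l.map e.symm))
      (single k' ((l ++ x).map e'.symm)) (4 * l.length + 6) := by
  refine ((move_double ht h hk' _ l).seq (move_onto hk' x l.reverse)).congr ?_ rfl ?_
  · simp only [List.length_reverse]; lia
  · rw [List.reverse_reverse]

end Transfer

namespace StackProgram

section EmbedRuns

variable {K K₀ : Type} [DecidableEq K] [DecidableEq K₀] {Γ : K → Type} {j : K₀ ↪ K}
  {c : StackProgram K₀ fun k => Γ (j k)} {k k' : K₀} {l : List (Γ (j k))} {l' : List (Γ (j k'))}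
  {n : ℕ}

theorem single_embed (j : K₀ ↪ K) (k i : K₀) (l : List (Γ (j k))) :
    single (Γ := Γ) (j k) l (j i) = single (Γ := fun k => Γ (j k)) k l i := by
  rcases eq_or_ne i k with rfl | h
  · rw [single_self, single_self (Γ := fun k => Γ (j k))]
  · rw [single_of_ne (j.injective.ne h), single_of_ne (Γ := fun k => Γ (j k)) h]

theorem Runs.embed_single (h : c.Runs (single k l) (single k' l') n) :
    (c.embed j).Runs (single (j k) l) (single (j k') l') n := by
  refine h.embed (fun i => single_embed j k i l) (fun i => single_embed j k' i l') fun i hi => ?_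
  rw [single_of_ne fun h => hi ⟨_, h.symm⟩, single_of_ne fun h => hi ⟨_, h.symm⟩]

theorem Runs.embed_double (h : c.Runs (single k l) (single k' l') n) {i : K} (hi : ∀ k, j k ≠ i)
    (x : List (Γ i)) : (c.embed j).Runs (double i x (j k) l) (double i x (j k') l') n := by
  have double_embed (k k₀ : K₀) (l : List (Γ (j k))) :
      double i x (j k) l (j k₀) = single (Γ := fun k => Γ (j k)) k l k₀ := by
    rw [double_comm (hi k).symm, double, Function.update_of_ne (hi k₀), single_embed]
  refine h.embed (fun k₀ => double_embed k k₀ l) (fun k₀ => double_embed k' k₀ l') fun k₀ hk₀ => ?_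
  rw [double, double, Function.update_of_ne fun h => hk₀ ⟨_, h.symm⟩,
    Function.update_of_ne fun h => hk₀ ⟨_, h.symm⟩]

end EmbedRuns

section Combine

variable {K Kf Kg : Type} [DecidableEq K] [DecidableEq Kf] [DecidableEq Kg] {Γ : K → Type}
  {α β : Type} {jf : Kf ↪ K} {jg : Kg ↪ K} {f₀ f₁ : Kf} {g₀ g₁ : Kg}
  {cf : StackProgram Kf fun k => Γ (jf k)} {cg : StackProgram Kg fun k => Γ (jg k)} {tf tg : ℕ}

theorem comp_runs [Finite β] {s : K} (hfs : s ≠ jf f₁) (hgs : jg g₀ ≠ s) {ef₁ : Γ (jf f₁) ≃ β}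
    {es : Γ s ≃ β} {eg₀ : Γ (jg g₀) ≃ β} {w : List (Γ (jf f₀))} {v : List β}
    {z : List (Γ (jg g₁))} (hcf : cf.Runs (single f₀ w) (single f₁ (v.map ef₁.symm)) tf)
    (hcg : cg.Runs (single g₀ (v.map eg₀.symm)) (single g₁ z) tg) :
    (((cf.embed jf).seq (transfer (jf f₁) s (jg g₀) ef₁ es eg₀)).seq (cg.embed jg)).Runs
      (single (jf f₀) w) (single (jg g₁) z) (tf + (4 * v.length + 6) + tg) :=
  (hcf.embed_single.seq (transfer_single hfs hgs v)).seq hcg.embed_single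

/-- With input on the stack `a` and working stacks `t` and `s`, run two programs on the input and
put the concatenation of their outputs on the stack `b`. -/
def appendOutputs (cf : StackProgram Kf fun k => Γ (jf k)) (cg : StackProgram Kg fun k => Γ (jg k))
    [Finite α] [Finite β] {a t s b : K} (ea : Γ a ≃ α) (et : Γ t ≃ α) (ef₀ : Γ (jf f₀) ≃ α)
    (eg₀ : Γ (jg g₀) ≃ α) (ef₁ : Γ (jf f₁) ≃ β) (eg₁ : Γ (jg g₁) ≃ β) (es : Γ s ≃ β)
    (eb : Γ b ≃ β) : StackProgram K Γ :=
  (((((move a t ea et).seq (fork t (jf f₀) (jg g₀) et ef₀ eg₀)).seq (cf.embed jf)).seq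
    (cg.embed jg)).seq (transfer (jg g₁) s b eg₁ es eb)).seq (transfer (jf f₁) s b ef₁ es eb)

theorem appendOutputs_runs [Finite α] [Finite β] {a t s b : K} (hta : t ≠ a) (hbs : b ≠ s)
    (hfg : ∀ i k, jf i ≠ jg k) (hft : ∀ i, jf i ≠ t) (hgt : ∀ i, jg i ≠ t) (hfs : ∀ i, jf i ≠ s)
    (hgs : ∀ i, jg i ≠ s) (hfb : ∀ i, jf i ≠ b) {ea : Γ a ≃ α} {et : Γ t ≃ α}
    {ef₀ : Γ (jf f₀) ≃ α} {eg₀ : Γ (jg g₀) ≃ α} {ef₁ : Γ (jf f₁) ≃ β} {eg₁ : Γ (jg g₁) ≃ β}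
    {es : Γ s ≃ β} {eb : Γ b ≃ β} {w : List α} {v v' : List β}
    (hcf : cf.Runs (single f₀ (w.map ef₀.symm)) (single f₁ (v.map ef₁.symm)) tf)
    (hcg : cg.Runs (single g₀ (w.map eg₀.symm)) (single g₁ (v'.map eg₁.symm)) tg) :
    (appendOutputs cf cg ea et ef₀ eg₀ ef₁ eg₁ es eb).Runs (single a (w.map ea.symm))
      (single b ((v ++ v').map eb.symm))
      (4 * w.length + 4 * v.length + 4 * v'.length + 18 + tf + tg) := by
  have fork_run := fork_runs (e := et) (e₁ := ef₀) (e₂ := eg₀) (hft f₀) (hgt g₀) (hfg f₀ g₀)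
    w.reverse
  rw [List.reverse_reverse, double_comm (hfg f₀ g₀)] at fork_run
  have fst_run := hcf.embed_double (fun i => hfg i g₀) (w.map eg₀.symm)
  rw [double_comm (hfg f₁ g₀).symm] at fst_run
  have snd_run := hcg.embed_double (fun i => (hfg f₁ i).symm) (v.map ef₁.symm)
  have snd_transfer := transfer_double (e := eg₁) (eₜ := es) (e' := eb) (hgs g₁).symm hbs
    (hfg f₁ g₁) (hfs f₁) (hfb f₁) (v.map ef₁.symm) v'
  rw [double_comm (hfb f₁)] at snd_transfer
  have fst_transfer := transfer_onto (e := ef₁) (eₜ := es) (e' := eb) (hfs f₁).symm hbs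
    (hfb f₁).symm v' v
  refine ((((((move_single hta w).seq fork_run).seq fst_run).seq snd_run).seq snd_transfer).seq
    fst_transfer).mono ?_
  simp only [List.length_reverse]
  lia

end Combine

end StackProgram

namespace PolyTimeFrom

section Combine

variable {X : Type*} {α β γ : Type} {u : X → List α}

theorem comp [Finite β] {v : X → List β} {w : X → List γ} (hv : PolyTimeFrom u v)
    (hw : PolyTimeFrom v w) : PolyTimeFrom u w := by
  obtain ⟨lv, hlv⟩ := hv.exists_length_le
  obtain ⟨Kf, _, _, Γf, cf, f₀, f₁, ef₀, ef₁, pf, hf⟩ := hv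
  obtain ⟨Kg, _, _, Γg, cg, g₀, g₁, eg₀, eg₁, pg, hg⟩ := hw
  let Γ : Kf ⊕ Kg ⊕ Unit → Type := Sum.elim Γf (Sum.elim Γg fun _ => β)
  have run := fun x => StackProgram.comp_runs (Γ := Γ) (jf := .inl)
    (jg := Function.Embedding.inl.trans .inr) (s := .inr (.inr ())) nofun nofun
    (es := Equiv.refl β) (hf x) (hg x)
  refine ⟨_, inferInstance, inferInstance, Γ, _, .inl f₀, .inr (.inl g₁), ef₀, eg₁,
    pf + (4 * lv + 6) + pg.comp lv, fun x => (run x).mono ?_⟩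
  have snd_time := eval_mono pg (hlv x)
  have length_v := hlv x
  simp only [Polynomial.eval_add, Polynomial.eval_mul, Polynomial.eval_ofNat, Polynomial.eval_comp]
  lia

theorem append [Finite α] [Finite β] {v v' : X → List β} (hv : PolyTimeFrom u v)
    (hv' : PolyTimeFrom u v') : PolyTimeFrom u fun x => v x ++ v' x := by
  obtain ⟨lv, hlv⟩ := hv.exists_length_le
  obtain ⟨lv', hlv'⟩ := hv'.exists_length_le
  obtain ⟨Kf, _, _, Γf, cf, f₀, f₁, ef₀, ef₁, pf, hf⟩ := hv
  obtain ⟨Kg, _, _, Γg, cg, g₀, g₁, eg₀, eg₁, pg, hg⟩ := hv'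
  let Γ : (Kf ⊕ Kg) ⊕ (Bool ⊕ Bool) → Type :=
    Sum.elim (Sum.elim Γf Γg) (Sum.elim (fun _ => α) fun _ => β)
  have run := fun x => StackProgram.appendOutputs_runs (Γ := Γ)
    (jf := Function.Embedding.inl.trans .inl) (jg := Function.Embedding.inr.trans .inl)
    (a := .inr (.inl false)) (t := .inr (.inl true)) (s := .inr (.inr false))
    (b := .inr (.inr true)) nofun nofun (fun _ _ => nofun) (fun _ => nofun) (fun _ => nofun)
    (fun _ => nofun) (fun _ => nofun) (fun _ => nofun) (ea := Equiv.refl α) (et := Equiv.refl α)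
    (es := Equiv.refl β) (eb := Equiv.refl β) (hf x) (hg x)
  refine ⟨_, inferInstance, inferInstance, Γ, _, .inr (.inl false), .inr (.inr true), Equiv.refl α,
    Equiv.refl β, 4 * Polynomial.X + 4 * lv + 4 * lv' + 18 + pf + pg, fun x => (run x).mono ?_⟩
  have length_v := hlv x
  have length_v' := hlv' x
  simp only [Polynomial.eval_add, Polynomial.eval_mul, Polynomial.eval_X, Polynomial.eval_ofNat]
  lia

end Combine

/-! ### Basic polynomial-time functions -/

section Basic

variable {X : Type*} {α β γ : Type} {u : X → List α}

theorem reverse_self [Finite α] (u : X → List α) : PolyTimeFrom u fun x => (u x).reverse :=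
  ⟨Bool, inferInstance, inferInstance, fun _ => α, move false true (Equiv.refl α) (Equiv.refl α),
    false, true, Equiv.refl α, Equiv.refl α, 2 * Polynomial.X + 3,
    fun x => (move_single (by simp) (u x)).mono (by simp)⟩

theorem refl [Finite α] (u : X → List α) : PolyTimeFrom u u := by
  simpa only [List.reverse_reverse] using (reverse_self u).comp (reverse_self _)

variable [Finite β] {v : X → List β}

theorem reverse (h : PolyTimeFrom u v) : PolyTimeFrom u fun x => (v x).reverse :=
  h.comp (reverse_self v)

variable [Finite γ]

theorem comp_transduce {Q : Type} [Finite Q] (h : PolyTimeFrom u v) (δ : Q → β → Q × List γ)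
    (fin : Q → List γ) (q : Q) : PolyTimeFrom u fun x => transduce δ fin q (v x) :=
  h.comp (transduce_self v δ fin q)

theorem flatMap (h : PolyTimeFrom u v) (g : β → List γ) :
    PolyTimeFrom u fun x => (v x).flatMap g := by
  simpa only [transduce_unit] using
    h.comp_transduce (fun (_ : Unit) a => ((), g a)) (fun _ => []) ()

theorem map (h : PolyTimeFrom u v) (g : β → γ) : PolyTimeFrom u fun x => (v x).map g := by
  simpa only [List.map_eq_flatMap] using h.flatMap fun b => [g b]

theorem unary_length (h : PolyTimeFrom u v) : PolyTimeFrom u fun x => unary (v x).length := by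
  simpa [unary] using h.map fun _ => true

theorem takeWhile (h : PolyTimeFrom u v) (p : β → Bool) :
    PolyTimeFrom u fun x => (v x).takeWhile p := by
  let δ : Bool → β → Bool × List β := fun q b => if q && p b then (true, [b]) else (false, [])
  have after_end (l : List β) : transduce δ (fun _ => []) false l = [] := by
    induction l with
    | nil => rfl
    | cons _ _ ih => exact ih
  have transduce_eq (l : List β) : transduce δ (fun _ => []) true l = l.takeWhile p := by
    induction l with
    | nil => rfl
    | cons b l ih =>
      have first_step : δ true b = if p b then (true, [b]) else (false, []) := rfl
      rw [transduce, first_step]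
      split <;> simp [*]
  simpa only [transduce_eq] using h.comp_transduce δ (fun _ => []) true

theorem dropWhile (h : PolyTimeFrom u v) (p : β → Bool) :
    PolyTimeFrom u fun x => (v x).dropWhile p := by
  let δ : Bool → β → Bool × List β := fun q b => if q && p b then (true, []) else (false, [b])
  have after_end (l : List β) : transduce δ (fun _ => []) false l = l := by
    induction l with
    | nil => rfl
    | cons b _ ih => exact congrArg (b :: ·) ih
  have transduce_eq (l : List β) : transduce δ (fun _ => []) true l = l.dropWhile p := by
    induction l with
    | nil => rfl
    | cons b l ih =>
      have first_step : δ true b = if p b then (true, []) else (false, [b]) := rfl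
      rw [transduce, first_step]
      split <;> simp [*]
  simpa only [transduce_eq] using h.comp_transduce δ (fun _ => []) true

theorem tail (h : PolyTimeFrom u v) : PolyTimeFrom u fun x => (v x).tail := by
  let δ : Bool → β → Bool × List β := fun q b => (true, if q then [b] else [])
  have after_first (l : List β) : transduce δ (fun _ => []) true l = l := by
    induction l with
    | nil => rfl
    | cons b _ ih => exact congrArg (b :: ·) ih
  have transduce_eq (l : List β) : transduce δ (fun _ => []) false l = l.tail := by
    cases l with
    | nil => rfl
    | cons _ l => exact after_first l
  simpa only [transduce_eq] using h.comp_transduce δ (fun _ => []) false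

theorem of_take (h : PolyTimeFrom u v) (k : ℕ) (F : List β → List γ) :
    PolyTimeFrom u fun x => F ((v x).take k) := by
  have : Finite {l : List β // l.length ≤ k} := List.finite_length_le β k
  let δ : {l : List β // l.length ≤ k} → β → {l : List β // l.length ≤ k} × List γ := fun q b =>
    (if h : (q.1 ++ [b]).length ≤ k then ⟨q.1 ++ [b], h⟩ else q, [])
  have transduce_eq (l : List β) (q : {l : List β // l.length ≤ k}) :
      transduce δ (fun q => F q.1) q l = F ((q.1 ++ l).take k) := by
    induction l generalizing q with
    | nil => simp [transduce, List.take_of_length_le q.2]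
    | cons b l ih =>
      simp only [transduce, List.nil_append, ih, δ]
      split_ifs with h
      · simp
      · have hq : q.1.length = k := by
          have := q.2
          simp only [List.length_append, List.length_singleton] at h
          lia
        rw [List.take_append_of_le_length hq.ge, List.take_append_of_le_length hq.ge]
  simpa only [transduce_eq, List.nil_append] using
    h.comp_transduce δ (fun q => F q.1) ⟨[], Nat.zero_le k⟩

theorem decide_eq_const [DecidableEq β] (h : PolyTimeFrom u v) (w : List β) :
    PolyTimeFrom u fun x => [decide (v x = w)] := by
  convert h.of_take (w.length + 1) fun l => [decide (l = w)] using 4 with x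
  constructor
  · rintro h
    simp [h]
  · intro h
    have length_take := congrArg List.length h
    rw [List.length_take] at length_take
    rwa [List.take_of_length_le (by lia)] at h

variable {c d : X → Bool} {f g : X → List γ}

theorem of_bool (h : PolyTimeFrom u fun x => [c x]) (F : Bool → List γ) :
    PolyTimeFrom u fun x => F (c x) := by
  simpa only [List.flatMap_singleton] using h.flatMap F

variable [Finite α]

theorem const (u : X → List α) (l : List β) : PolyTimeFrom u fun _ => l := by
  have transduce_silent (w : List α) :
      transduce (fun (_ : Unit) _ => ((), [])) (fun _ => l) () w = l := by
    induction w with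
    | nil => rfl
    | cons _ _ ih => exact ih
  simpa only [transduce_silent] using
    transduce_self u (fun (_ : Unit) _ => ((), [])) (fun _ => l) ()

theorem guard (hc : PolyTimeFrom u fun x => [c x]) (hf : PolyTimeFrom u f) :
    PolyTimeFrom u fun x => if c x then f x else [] := by
  let δ : Bool → Bool ⊕ γ → Bool × List γ := fun q s => match s with
    | .inl b => (b, [])
    | .inr a => (q, if q then [a] else [])
  have transduce_eq (b : Bool) (l : List γ) :
      transduce δ (fun _ => []) b (l.map .inr) = if b then l else [] := by
    induction l with
    | nil => cases b <;> rfl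
    | cons a l ih => cases b <;> simp_all [transduce, δ]
  have guarded := ((hc.map (γ := Bool ⊕ γ) .inl).append (hf.map .inr)).comp_transduce δ
    (fun _ => []) false
  convert guarded using 2 with x
  exact (transduce_eq (c x) (f x)).symm

theorem ite (hc : PolyTimeFrom u fun x => [c x]) (hf : PolyTimeFrom u f) (hg : PolyTimeFrom u g) :
    PolyTimeFrom u fun x => if c x then f x else g x := by
  convert (hc.guard hf).append ((hc.of_bool fun b => [!b]).guard hg) using 2 with x
  cases c x <;> simp

theorem and (hc : PolyTimeFrom u fun x => [c x]) (hd : PolyTimeFrom u fun x => [d x]) :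
    PolyTimeFrom u fun x => [c x && d x] := by
  convert hc.ite hd (const u [false]) using 2 with x
  cases c x <;> simp

theorem or (hc : PolyTimeFrom u fun x => [c x]) (hd : PolyTimeFrom u fun x => [d x]) :
    PolyTimeFrom u fun x => [c x || d x] := by
  convert hc.ite (const u [true]) hd using 2 with x
  cases c x <;> simp

end Basic

end PolyTimeFrom

/-! ### Tuples -/

theorem encTuple_cons (w : Str) (x : List Str) :
    encTuple (w :: x) = w.map some ++ none :: encTuple x := by
  simp [encTuple]

theorem length_encTuple_cons (w : Str) (x : List Str) :
    (encTuple (w :: x)).length = w.length + 1 + (encTuple x).length := by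
  simp only [encTuple_cons, List.length_append, List.length_map, List.length_cons]
  lia

theorem isSome_of_mem_map_some {w : Str} {o : Option Bool} (ho : o ∈ w.map some) : o.isSome := by
  obtain ⟨_, -, rfl⟩ := List.mem_map.1 ho
  rfl

namespace PolyTimeFrom

variable {X : Type*} {α : Type} {u : X → List α} {T : X → List Str}

theorem encTuple_cons [Finite α] {f : X → Str} (hf : PolyTimeFrom u f)
    (hT : PolyTimeFrom u fun x => encTuple (T x)) :
    PolyTimeFrom u fun x => encTuple (f x :: T x) := by
  simpa [CompGame.encTuple_cons] using ((hf.map some).append (const u [none])).append hT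

theorem encTuple_nil [Finite α] : PolyTimeFrom u fun _ => encTuple [] := const u _

theorem comp_isPolyTime {g : List Str → Str} (hg : IsPolyTime g)
    (hT : PolyTimeFrom u fun x => encTuple (T x)) : PolyTimeFrom u fun x => g (T x) :=
  hT.comp ((isPolyTime_iff.1 hg).reindex T)

theorem tuple_headD (hT : PolyTimeFrom u fun x => encTuple (T x)) :
    PolyTimeFrom u fun x => (T x).headD [] := by
  convert (hT.takeWhile Option.isSome).flatMap Option.toList using 2 with x
  cases T x with
  | nil => rfl
  | cons w l =>
    rw [CompGame.encTuple_cons, List.takeWhile_append_of_pos fun _ => isSome_of_mem_map_some]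
    simp [List.flatMap_map]

theorem tuple_tail (hT : PolyTimeFrom u fun x => encTuple (T x)) :
    PolyTimeFrom u fun x => encTuple (T x).tail := by
  convert (hT.dropWhile Option.isSome).tail using 2 with x
  cases T x with
  | nil => rfl
  | cons w l =>
    rw [CompGame.encTuple_cons, List.dropWhile_append_of_pos fun _ => isSome_of_mem_map_some]
    simp

theorem tuple_length (hT : PolyTimeFrom u fun x => encTuple (T x)) :
    PolyTimeFrom u fun x => unary (T x).length := by
  convert hT.flatMap fun s => if s = none then [true] else [] using 2 with x
  induction T x with
  | nil => rfl
  | cons w l ih => simp [CompGame.encTuple_cons, ← ih, unary, List.replicate_succ, List.flatMap_map]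

end PolyTimeFrom

/-! ### Two words read in parallel -/

section Zip

variable {α : Type}

theorem length_zipWithAll_mk_le (a b : List α) :
    (List.zipWithAll Prod.mk a b).length ≤ a.length + b.length := by
  induction a generalizing b with
  | nil => simp
  | cons x a ih => cases b with
    | nil => simp
    | cons y b =>
      have := ih b
      simp only [List.zipWithAll_cons_cons, List.length_cons]
      lia

/-- The automaton that computes `List.zipWithAll Prod.mk a b` from the words `a.reverse` and `b` on
the stack `0`, with a separator `(none, none)` between them. Its states are: moving the first word
to the stack `1`; popping its next symbol; popping the next symbol of the second word. -/
def zipAutomaton (α : Type) [Finite α] : StackAutomaton (Fin 3) fun _ => Option α × Option α where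
  A := Option α
  Q := Option (Bool ⊕ Option α)
  start := some (.inl false)
  source
    | none => none
    | some (.inl false) => some ⟨0, Prod.fst⟩
    | some (.inl true) => some ⟨1, Prod.fst⟩
    | some (.inr _) => some ⟨0, Prod.fst⟩
  next
    | some (.inl false), some (some x) => (some (.inl false), [⟨1, (some x, none)⟩])
    | some (.inl false), _ => (some (.inl true), [])
    | some (.inl true), o => (some (.inr o.join), [])
    | some (.inr none), o => match o.join with
      | none => (none, [])
      | some y => (some (.inl true), [⟨2, (none, some y)⟩])
    | some (.inr (some x)), o => (some (.inl true), [⟨2, (some x, o.join)⟩])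
    | none, _ => (none, [])

/-- A word on a stack of `zipAutomaton`. -/
def padded (a : List α) : List (Option α × Option α) := a.map fun x => (some x, none)

variable [Finite α]

theorem zipAutomaton_load (a : List α) (l l' : List (Option α × Option α)) :
    (zipAutomaton α).Reach (2 * a.length + 2) (some (.inl false))
      ![padded a ++ (none, none) :: l, l', []] (some (.inl true))
      ![l, (padded a).reverse ++ l', []] := by
  induction a generalizing l' with
  | nil =>
    refine StackAutomaton.reach_read (p := ⟨0, Prod.fst⟩) (L := []) rfl rfl ?_
    funext i
    fin_cases i <;> rfl
  | cons x a ih =>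
    have load_symbol : (zipAutomaton α).Reach 2 (some (.inl false))
        ![padded (x :: a) ++ (none, none) :: l, l', []] (some (.inl false))
        ![padded a ++ (none, none) :: l, (some x, none) :: l', []] := by
      refine StackAutomaton.reach_read (p := ⟨0, Prod.fst⟩) (L := [⟨1, (some x, none)⟩]) rfl rfl ?_
      funext i
      fin_cases i <;> rfl
    refine (load_symbol.trans (ih ((some x, none) :: l'))).congr ?_ ?_
    · simp only [List.length_cons]
      lia
    · simp [padded]

theorem zipAutomaton_pop_left (a : List α) (l l' : List (Option α × Option α)) :
    (zipAutomaton α).Reach 2 (some (.inl true)) ![l, padded a, l'] (some (.inr a.head?))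
      ![l, padded a.tail, l'] := by
  refine StackAutomaton.reach_read (p := ⟨1, Prod.fst⟩) (L := []) rfl ?_ ?_
  · cases a <;> rfl
  · funext i
    cases a <;> fin_cases i <;> rfl

theorem zipAutomaton_pop_right {o : Option α} {b : List α} (h : o ≠ none ∨ b ≠ [])
    (l l' : List (Option α × Option α)) :
    (zipAutomaton α).Reach 2 (some (.inr o)) ![padded b, l, l'] (some (.inl true))
      ![padded b.tail, l, (o, b.head?) :: l'] := by
  refine StackAutomaton.reach_read (p := ⟨0, Prod.fst⟩) (L := [⟨2, (o, b.head?)⟩]) rfl ?_ ?_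
  · cases o <;> cases b <;> first | rfl | simp at h
  · funext i
    cases b <;> fin_cases i <;> rfl

theorem zipAutomaton_finish (l : List (Option α × Option α)) :
    (zipAutomaton α).Reach 2 (some (.inr none)) ![[], [], l] none ![[], [], l] := by
  refine StackAutomaton.reach_read (p := ⟨0, Prod.fst⟩) (L := []) rfl rfl ?_
  funext i
  fin_cases i <;> rfl

theorem zipAutomaton_zip (a b : List α) (l : List (Option α × Option α)) :
    (zipAutomaton α).Reach (4 * (List.zipWithAll Prod.mk a b).length + 4) (some (.inl true))
      ![padded b, padded a, l] none ![[], [], (List.zipWithAll Prod.mk a b).reverse ++ l] := by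
  induction hz : List.zipWithAll Prod.mk a b generalizing a b l with
  | nil =>
    obtain ⟨rfl, rfl⟩ : a = [] ∧ b = [] := by cases a <;> cases b <;> simp_all
    exact (zipAutomaton_pop_left [] [] l).trans (zipAutomaton_finish l)
  | cons p z ih =>
    have nonempty : a.head? ≠ none ∨ b ≠ [] := by cases a <;> cases b <;> simp_all
    have head_eq : p = (a.head?, b.head?) := by cases a <;> cases b <;> simp_all
    have tail_eq : List.zipWithAll Prod.mk a.tail b.tail = z := by
      rw [← List.tail_zipWithAll, hz, List.tail_cons]
    have pop := (zipAutomaton_pop_left a (padded b) l).trans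
      (zipAutomaton_pop_right nonempty (padded a.tail) l)
    refine (pop.trans (ih _ _ _ tail_eq)).congr ?_ (by simp [head_eq])
    simp only [List.length_cons]
    lia

namespace PolyTimeFrom

variable {X : Type*} {β : Type} [Finite β] {u : X → List β} {a b : X → List α}

theorem zipWithAll (ha : PolyTimeFrom u a) (hb : PolyTimeFrom u b) :
    PolyTimeFrom u fun x => List.zipWithAll Prod.mk (a x) (b x) := by
  have input : PolyTimeFrom u fun x => padded (a x).reverse ++ (none, none) :: padded (b x) :=
    (ha.reverse.map (fun s => (some s, (none : Option α)))).append
      ((const u [(none, none)]).append (hb.map fun s => (some s, none)))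
  have zip : PolyTimeFrom (fun x => padded (a x).reverse ++ (none, none) :: padded (b x))
      fun x => (List.zipWithAll Prod.mk (a x) (b x)).reverse := by
    refine ⟨Fin 3, inferInstance, inferInstance, fun _ => Option α × Option α,
      (zipAutomaton α).toProgram, 0, 2, Equiv.refl _, Equiv.refl _, 6 * Polynomial.X + 10,
      fun x => ?_⟩
    have load := zipAutomaton_load (a x).reverse (padded (b x)) []
    have unload : (padded (a x).reverse).reverse ++ [] = padded (a x) := by simp [padded]
    rw [unload] at load
    refine ((load.trans (zipAutomaton_zip (a x) (b x) [])).runs rfl).congr ?_ ?_ ?_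
    · have := length_zipWithAll_mk_le (a x) (b x)
      simp [padded]
      lia
    · funext i
      fin_cases i <;> simp [single]
    · funext i
      fin_cases i <;> simp [single]
  simpa only [List.reverse_reverse] using (input.comp zip).reverse

theorem take (ha : PolyTimeFrom u a) (hb : PolyTimeFrom u b) :
    PolyTimeFrom u fun x => (a x).take (b x).length := by
  have flatMap_eq (a b : List α) : ((List.zipWithAll Prod.mk a b).flatMap fun p =>
      if p.2.isSome then p.1.toList else []) = a.take b.length := by
    induction a generalizing b with
    | nil => simp [List.flatMap_map]
    | cons y l ih => cases b with
      | nil => simp [List.flatMap_map]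
      | cons z b => simp [ih]
  simpa only [flatMap_eq] using
    (ha.zipWithAll hb).flatMap fun p => if p.2.isSome then p.1.toList else []

theorem length_le (ha : PolyTimeFrom u a) (hb : PolyTimeFrom u b) :
    PolyTimeFrom u fun x => [decide ((a x).length ≤ (b x).length)] := by
  have flatMap_eq (a b : List α) : ((List.zipWithAll Prod.mk a b).flatMap fun p =>
      if p.2.isSome then [] else [true]) = [] ↔ a.length ≤ b.length := by
    induction a generalizing b with
    | nil => simp [List.flatMap_map]
    | cons y l ih => cases b with
      | nil => simp [List.flatMap_map]
      | cons z b => simpa using ih b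
  simpa only [flatMap_eq] using
    ((ha.zipWithAll hb).flatMap fun p => if p.2.isSome then [] else [true]).decide_eq_const []

end PolyTimeFrom

/-- Comparison of the binary fractions given by two words, up to the length of the shorter. -/
def ltDigits : Str → Str → Bool
  | x :: a, y :: b => if x = y then ltDigits a b else y
  | _, _ => false

theorem PolyTimeFrom.ltDigits {X : Type*} {β : Type} [Finite β] {u : X → List β} {a b : X → Str}
    (ha : PolyTimeFrom u a) (hb : PolyTimeFrom u b) :
    PolyTimeFrom u fun x => [ltDigits (a x) (b x)] := by
  let δ : Option Bool → Option Bool × Option Bool → Option Bool × Str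
    | none, (some x, some y) => (if x = y then none else some y, [])
    | verdict, _ => (verdict, [])
  let fin : Option Bool → Str := fun verdict => [verdict.getD false]
  have after_verdict (y : Bool) (l) : transduce δ fin (some y) l = [y] := by
    induction l with
    | nil => rfl
    | cons _ _ ih => exact ih
  have no_verdict (l : List (Option Bool × Option Bool)) (hl : ∀ p ∈ l, p.1 = none ∨ p.2 = none) :
      transduce δ fin none l = [false] := by
    induction l with
    | nil => rfl
    | cons p l ih =>
      obtain ⟨x, y⟩ := p
      have := ih fun p hp => hl p (.tail _ hp)
      cases x <;> cases y <;> simp_all [transduce, δ]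
  have transduce_eq (a b : Str) :
      transduce δ fin none (List.zipWithAll Prod.mk a b) = [CompGame.ltDigits a b] := by
    fun_induction CompGame.ltDigits a b with
    | case1 x a b ih => simpa [transduce, δ] using ih
    | case2 x a y b hxy => simp [transduce, δ, hxy, after_verdict]
    | case3 a b h =>
      refine no_verdict _ fun p hp => ?_
      rcases a with _ | ⟨x, a⟩
      · obtain ⟨_, -, rfl⟩ := List.mem_map.1 (List.nil_zipWithAll ▸ hp)
        exact .inl rfl
      rcases b with _ | ⟨y, b⟩
      · obtain ⟨_, -, rfl⟩ := List.mem_map.1 (List.zipWithAll_nil ▸ hp)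
        exact .inr rfl
      exact absurd rfl (h x a y b rfl)
  simpa only [transduce_eq] using (ha.zipWithAll hb).comp_transduce δ fin none

end Zip

/-! ### Multiplication in unary -/

/-- The automaton that multiplies in unary. The states are: reading the first factor, popping a
symbol of it, copying the second factor, restoring it, cleaning up. -/
def mulAutomaton : StackAutomaton (Fin 4) fun _ => Bool where
  A := Bool
  Q := Option (Fin 5)
  start := some 0
  source := Option.map ![⟨0, id⟩, ⟨1, id⟩, ⟨0, id⟩, ⟨2, id⟩, ⟨0, id⟩]
  next
    | some 0, some true => (some 0, [⟨1, true⟩])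
    | some 0, _ => (some 1, [])
    | some 1, some _ => (some 2, [])
    | some 1, none => (some 4, [])
    | some 2, some _ => (some 2, [⟨2, true⟩, ⟨3, true⟩])
    | some 2, none => (some 3, [])
    | some 3, some _ => (some 3, [⟨0, true⟩])
    | some 3, none => (some 1, [])
    | some 4, some _ => (some 4, [])
    | some 4, none => (none, [])
    | none, _ => (none, [])

/-- The stacks of `mulAutomaton`: the rest of the input or the second factor, what is left of the
first factor, the copy from which the second factor is restored, and the product so far. -/
def mulStacks (w : Str) (a b c : ℕ) : Fin 4 → Str := ![w, unary a, unary b, unary c]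

theorem mulAutomaton_load (m a : ℕ) (w : Str) :
    mulAutomaton.Reach (2 * m + 2) (some 0) (mulStacks (unary m ++ false :: w) a 0 0) (some 1)
      (mulStacks w (m + a) 0 0) := by
  induction m generalizing a with
  | zero =>
    refine StackAutomaton.reach_read (p := ⟨0, id⟩) (L := []) rfl rfl ?_
    funext i
    fin_cases i <;> simp [mulStacks, pushAll, unary]
  | succ m ih =>
    have load_symbol : mulAutomaton.Reach 2 (some 0)
        (mulStacks (unary (m + 1) ++ false :: w) a 0 0) (some 0)
        (mulStacks (unary m ++ false :: w) (a + 1) 0 0) := by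
      refine StackAutomaton.reach_read (p := ⟨0, id⟩) (L := [⟨1, true⟩]) rfl rfl ?_
      funext i
      fin_cases i <;> rfl
    exact (load_symbol.trans (ih (a + 1))).congr (by lia)
      (by rw [Nat.add_right_comm, Nat.add_assoc])

theorem mulAutomaton_copy (n a b c : ℕ) :
    mulAutomaton.Reach (2 * n + 2) (some 2) (mulStacks (unary n) a b c) (some 3)
      (mulStacks [] a (n + b) (n + c)) := by
  induction n generalizing b c with
  | zero =>
    refine StackAutomaton.reach_read (p := ⟨0, id⟩) (L := []) rfl rfl ?_
    funext i
    fin_cases i <;> simp [mulStacks, pushAll, unary]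
  | succ n ih =>
    have copy_symbol : mulAutomaton.Reach 2 (some 2) (mulStacks (unary (n + 1)) a b c)
        (some 2) (mulStacks (unary n) a (b + 1) (c + 1)) := by
      refine StackAutomaton.reach_read (p := ⟨0, id⟩) (L := [⟨2, true⟩, ⟨3, true⟩]) rfl rfl ?_
      funext i
      fin_cases i <;> rfl
    refine (copy_symbol.trans (ih (b + 1) (c + 1))).congr (by lia) ?_
    rw [Nat.add_right_comm n 1 b, Nat.add_assoc n b, Nat.add_right_comm n 1 c, Nat.add_assoc n c]

theorem mulAutomaton_restore (m n a c : ℕ) :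
    mulAutomaton.Reach (2 * n + 2) (some 3) (mulStacks (unary m) a n c) (some 1)
      (mulStacks (unary (n + m)) a 0 c) := by
  induction n generalizing m with
  | zero =>
    refine StackAutomaton.reach_read (p := ⟨2, id⟩) (L := []) rfl rfl ?_
    funext i
    fin_cases i <;> simp [mulStacks, pushAll, unary]
  | succ n ih =>
    have restore_symbol : mulAutomaton.Reach 2 (some 3) (mulStacks (unary m) a (n + 1) c)
        (some 3) (mulStacks (unary (m + 1)) a n c) := by
      refine StackAutomaton.reach_read (p := ⟨2, id⟩) (L := [⟨0, true⟩]) rfl rfl ?_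
      funext i
      fin_cases i <;> rfl
    exact (restore_symbol.trans (ih (m + 1))).congr (by lia)
      (by rw [Nat.add_right_comm, Nat.add_assoc])

theorem mulAutomaton_clean (n c : ℕ) :
    mulAutomaton.Reach (2 * n + 2) (some 4) (mulStacks (unary n) 0 0 c) none
      (mulStacks [] 0 0 c) := by
  induction n with
  | zero =>
    refine StackAutomaton.reach_read (p := ⟨0, id⟩) (L := []) rfl rfl ?_
    funext i
    fin_cases i <;> simp [mulStacks, pushAll, unary]
  | succ n ih =>
    have clean_symbol : mulAutomaton.Reach 2 (some 4) (mulStacks (unary (n + 1)) 0 0 c)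
        (some 4) (mulStacks (unary n) 0 0 c) := by
      refine StackAutomaton.reach_read (p := ⟨0, id⟩) (L := []) rfl rfl ?_
      funext i
      fin_cases i <;> rfl
    exact (clean_symbol.trans ih).mono (by lia)

theorem mulAutomaton_mul (n a c : ℕ) :
    mulAutomaton.Reach (a * (4 * n + 6) + 2 * n + 4) (some 1) (mulStacks (unary n) a 0 c) none
      (mulStacks [] 0 0 (a * n + c)) := by
  induction a generalizing c with
  | zero =>
    have pop : mulAutomaton.Reach 2 (some 1) (mulStacks (unary n) 0 0 c) (some 4)
        (mulStacks (unary n) 0 0 c) := by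
      refine StackAutomaton.reach_read (p := ⟨1, id⟩) (L := []) rfl rfl ?_
      funext i
      fin_cases i <;> rfl
    exact (pop.trans (mulAutomaton_clean n c)).congr (by lia) (by simp)
  | succ a ih =>
    have pop : mulAutomaton.Reach 2 (some 1) (mulStacks (unary n) (a + 1) 0 c) (some 2)
        (mulStacks (unary n) a 0 c) := by
      refine StackAutomaton.reach_read (p := ⟨1, id⟩) (L := []) rfl rfl ?_
      funext i
      fin_cases i <;> rfl
    have round := (pop.trans (mulAutomaton_copy n a 0 c)).trans (mulAutomaton_restore 0 n a (n + c))
    refine (round.trans (ih (n + c))).congr (by lia) ?_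
    rw [add_one_mul, add_assoc]

namespace PolyTimeFrom

variable {X : Type*} {α : Type} [Finite α] {u : X → List α} {a b : X → ℕ}

theorem mul (ha : PolyTimeFrom u fun x => unary (a x)) (hb : PolyTimeFrom u fun x => unary (b x)) :
    PolyTimeFrom u fun x => unary (a x * b x) := by
  let input := fun x => unary (a x) ++ (false :: unary (b x))
  have mul_input : PolyTimeFrom input fun x => unary (a x * b x) := by
    refine ⟨Fin 4, inferInstance, inferInstance, fun _ => Bool, mulAutomaton.toProgram, 0, 3,
      Equiv.refl _, Equiv.refl _, Polynomial.X * (4 * Polynomial.X + 6) + 4 * Polynomial.X + 10,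
      fun x => ?_⟩
    refine (((mulAutomaton_load (a x) 0 (unary (b x))).trans
      (mulAutomaton_mul (b x) (a x) 0)).runs rfl).congr ?_ ?_ ?_
    · have length_input : (input x).length = a x + b x + 1 := by
        simp [input, unary]
        lia
      simp only [Polynomial.eval_add, Polynomial.eval_mul, Polynomial.eval_X,
        Polynomial.eval_ofNat, length_input]
      nlinarith
    · funext i
      fin_cases i <;> simp [single, mulStacks, unary, input]
    · funext i
      fin_cases i <;> simp [single, mulStacks, unary]
  exact (ha.append ((const u [false]).append hb)).comp mul_input

theorem polynomial_eval (ha : PolyTimeFrom u fun x => unary (a x)) (p : Polynomial ℕ) :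
    PolyTimeFrom u fun x => unary (p.eval (a x)) := by
  induction p using Polynomial.induction_on' with
  | add p q hp hq =>
    simpa only [unary, Polynomial.eval_add, List.replicate_add] using hp.append hq
  | monomial k c =>
    simp only [Polynomial.eval_monomial]
    refine (const u (unary c)).mul ?_
    induction k with
    | zero => simpa using const u (unary 1)
    | succ k ih => simpa only [pow_succ] using ih.mul ha

end PolyTimeFrom

/-! ### Determinism -/

theorem Steps.halt_unique {K : Type} [DecidableEq K] {Γ : K → Type} {Λ σ : Type}
    {M : Λ → TM2.Stmt Γ Λ σ} {m n : ℕ} {a : TM2.Cfg Γ Λ σ} {v w : σ} {S T : ∀ k, List (Γ k)}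
    (h : Steps (TM2.step M) m a ⟨none, v, S⟩) (h' : Steps (TM2.step M) n a ⟨none, w, T⟩) :
    S = T := by
  induction m generalizing a n with
  | zero =>
    cases h
    cases n with
    | zero => cases h'; rfl
    | succ n => obtain ⟨c, hc, -⟩ := h'; simp [TM2.step] at hc
  | succ m ih =>
    obtain ⟨c, hc, h⟩ := h
    cases n with
    | zero => cases h'; simp [TM2.step] at hc
    | succ n =>
      obtain ⟨d, hd, h'⟩ := h'
      rw [hc] at hd
      cases hd
      exact ih h h'

theorem PolyTimeFrom.eq_of_eq {X : Type*} {α β : Type} {u : X → List α} {v : X → List β}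
    (h : PolyTimeFrom u v) {x y : X} (hxy : u x = u y) : v x = v y := by
  obtain ⟨K, _, _, Γ, c, k₀, k₁, e₀, e₁, p, h⟩ := h
  obtain ⟨m, -, hm⟩ := h x
  obtain ⟨n, -, hn⟩ := h y
  rw [hxy] at hm
  have outputs_eq := congrFun (hm.halt_unique hn) k₁
  rw [single_self, single_self] at outputs_eq
  exact List.map_injective_iff.2 e₁.symm.injective outputs_eq

/-! ### Random tapes -/

@[simp] theorem length_tapePrefix (r : Tape) (m : ℕ) : (tapePrefix r m).length = m := by
  simp [tapePrefix]

theorem tapePrefix_succ (r : Tape) (m : ℕ) :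
    tapePrefix r (m + 1) = r 0 :: tapePrefix (fun n => r (n + 1)) m := by
  simp [tapePrefix, List.ofFn_succ]

theorem take_tapePrefix (r : Tape) {m n : ℕ} (h : m ≤ n) :
    (tapePrefix r n).take m = tapePrefix r m := by
  refine List.ext_getElem (by simpa using h) fun i _ _ => ?_
  simp [tapePrefix]

theorem tapePrefix_getD (w : Str) : tapePrefix (fun n => w.getD n false) w.length = w := by
  refine List.ext_getElem (by simp) fun i _ _ => ?_
  simp [tapePrefix]

/-- The input of a probabilistic machine that uses `q(|x|)` random bits on the input `x`. -/
def tapeWord (q : Polynomial ℕ) (p : List Str × Tape) : List (Option Bool) :=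
  encTuple (tapePrefix p.2 (q.eval (encTuple p.1).length) :: p.1)

/-- The function can be computed in polynomial time from the input and any sufficiently large
polynomial number of random bits. Allowing more bits than necessary makes it possible to combine
machines that use different numbers of bits. -/
def RandPolyTime {β : Type} (v : List Str × Tape → List β) : Prop :=
  ∃ q, ∀ q', PolyTimeFrom (tapeWord (q + q')) v

section TapeWord

variable {q : Polynomial ℕ} {β : Type} {v : List Str × Tape → List β}

theorem polyTimeFrom_tapeWord_input (q : Polynomial ℕ) :
    PolyTimeFrom (tapeWord q) fun p => encTuple p.1 :=
  (PolyTimeFrom.refl (tapeWord q)).tuple_tail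

theorem polyTimeFrom_tapeWord_tapePrefix {n : List Str × Tape → ℕ}
    (hn : PolyTimeFrom (tapeWord q) fun p => unary (n p))
    (h : ∀ p, n p ≤ q.eval (encTuple p.1).length) :
    PolyTimeFrom (tapeWord q) fun p => tapePrefix p.2 (n p) := by
  convert (PolyTimeFrom.refl (tapeWord q)).tuple_headD.take hn using 2 with p
  rw [List.headD_cons, unary, List.length_replicate, take_tapePrefix _ (h p)]

theorem polyTimeFrom_tapeWord_add (q q' : Polynomial ℕ) :
    PolyTimeFrom (tapeWord (q + q')) (tapeWord q) :=
  have input := polyTimeFrom_tapeWord_input (q + q')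
  .encTuple_cons (polyTimeFrom_tapeWord_tapePrefix (input.unary_length.polynomial_eval q)
    fun p => by simp) input

theorem PolyTimeFrom.randPolyTime (h : PolyTimeFrom (tapeWord q) v) : RandPolyTime v :=
  ⟨q, fun q' => (polyTimeFrom_tapeWord_add q q').comp h⟩

end TapeWord

theorem RandPolyTime.isPPT {A : List Str → Tape → Str} (h : RandPolyTime fun p => A p.1 p.2) :
    IsPPT A := by
  obtain ⟨q, h⟩ := h
  have h := add_zero q ▸ h 0
  -- `padTape y` pads or cuts the supposed random bits in the first component of `y`, so that
  -- every tuple `y` encodes the same word as an input with some tape.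
  let m : List Str → ℕ := fun y => q.eval (encTuple y.tail).length
  let padTape : List Str → Str := fun y => (y.headD [] ++ List.replicate (m y) false).take (m y)
  have length_padTape (y) : (padTape y).length = m y := by simp [padTape]
  let F : List Str → List Str × Tape := fun y => (y.tail, fun n => (padTape y).getD n false)
  have tapeWord_F (y) : tapeWord q (F y) = encTuple (padTape y :: y.tail) := by
    have prefix_eq := tapePrefix_getD (padTape y)
    rw [length_padTape] at prefix_eq
    exact congrArg (fun w => encTuple (w :: y.tail)) prefix_eq
  refine ⟨q, fun y => A (F y).1 (F y).2, ?_, fun x r => ?_⟩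
  · have tail : PolyTimeFrom encTuple fun y => encTuple y.tail :=
      (PolyTimeFrom.refl encTuple).tuple_tail (T := id)
    have bound : PolyTimeFrom encTuple fun y => unary (m y) := tail.unary_length.polynomial_eval q
    have head : PolyTimeFrom encTuple fun y => y.headD [] :=
      (PolyTimeFrom.refl encTuple).tuple_headD (T := id)
    have pad : PolyTimeFrom encTuple padTape := by
      simpa [unary, padTape] using (head.append (bound.map fun _ => false)).take bound
    rw [isPolyTime_iff]
    exact (pad.encTuple_cons tail).comp (by simpa only [tapeWord_F] using h.reindex F)
  · refine h.eq_of_eq (x := (x, r)) (y := F (tapePrefix r (q.eval (encTuple x).length) :: x)) ?_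
    rw [tapeWord_F]
    simp [tapeWord, padTape, m, List.take_append, List.take_of_length_le]

namespace RandPolyTime

variable {β γ δ : Type} {v : List Str × Tape → List β} {w : List Str × Tape → List γ}
  {z : List Str × Tape → List δ}

theorem imp (hv : RandPolyTime v)
    (h : ∀ q, PolyTimeFrom (tapeWord q) v → PolyTimeFrom (tapeWord q) w) : RandPolyTime w := by
  obtain ⟨q, hv⟩ := hv
  exact ⟨q, fun q' => h _ (hv q')⟩

theorem imp₂ (hv : RandPolyTime v) (hw : RandPolyTime w)
    (h : ∀ q, PolyTimeFrom (tapeWord q) v → PolyTimeFrom (tapeWord q) w →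
      PolyTimeFrom (tapeWord q) z) : RandPolyTime z := by
  obtain ⟨q, hv⟩ := hv
  obtain ⟨q', hw⟩ := hw
  refine ⟨q + q', fun q'' => h _ ?_ ?_⟩
  · rw [add_assoc]
    exact hv _
  · rw [add_comm q, add_assoc]
    exact hw _

theorem input : RandPolyTime fun p => encTuple p.1 := (polyTimeFrom_tapeWord_input 0).randPolyTime

theorem const [Finite β] (l : List β) : RandPolyTime fun _ => l :=
  (PolyTimeFrom.const (tapeWord 0) l).randPolyTime

variable {T : List Str × Tape → List Str}

theorem encTuple_cons {f : List Str × Tape → Str} (hf : RandPolyTime f)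
    (hT : RandPolyTime fun p => encTuple (T p)) : RandPolyTime fun p => encTuple (f p :: T p) :=
  hf.imp₂ hT fun _ => PolyTimeFrom.encTuple_cons

theorem tuple_headD (hT : RandPolyTime fun p => encTuple (T p)) :
    RandPolyTime fun p => (T p).headD [] :=
  hT.imp fun _ => PolyTimeFrom.tuple_headD

theorem comp_isPolyTime {g : List Str → Str} (hg : IsPolyTime g)
    (hT : RandPolyTime fun p => encTuple (T p)) : RandPolyTime fun p => g (T p) :=
  hT.imp fun _ => PolyTimeFrom.comp_isPolyTime hg

theorem ite [Finite γ] {c : List Str × Tape → Bool} {f g : List Str × Tape → List γ}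
    (hc : RandPolyTime fun p => [c p]) (hf : RandPolyTime f) (hg : RandPolyTime g) :
    RandPolyTime fun p => if c p then f p else g p := by
  have then_part := hc.imp₂ hf fun _ => PolyTimeFrom.guard
  have else_part := hc.imp₂ hg fun _ hc hg => (hc.of_bool fun b => [!b]).guard hg
  convert then_part.imp₂ else_part fun _ => PolyTimeFrom.append using 2 with p
  cases c p <;> simp

theorem tapePrefix {n : List Str × Tape → ℕ} (hn : RandPolyTime fun p => unary (n p)) :
    RandPolyTime fun p => tapePrefix p.2 (n p) := by
  obtain ⟨q, hn⟩ := hn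
  obtain ⟨b, hb⟩ := (hn 0).exists_length_le
  let enough := b.comp (q + 1 + Polynomial.X)
  have le_enough (p) : n p ≤ enough.eval (encTuple p.1).length := by
    simpa [enough, unary, tapeWord, length_encTuple_cons] using hb p
  exact (polyTimeFrom_tapeWord_tapePrefix (hn enough) fun p => (le_enough p).trans
    (by simp)).randPolyTime

end RandPolyTime

/-- The bits of the tape at even positions. Together with `oddTape`, it provides two independent
random tapes. -/
def evenTape (r : Tape) : Tape := fun n => r (2 * n)

/-- The bits of the tape at odd positions. -/
def oddTape (r : Tape) : Tape := fun n => r (2 * n + 1)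

/-- The bits at every other position, starting with the position `0` if `c = false` and with the
position `1` if `c = true`. -/
def everyOther (c : Bool) : Str → Str :=
  transduce (fun q b => (!q, if q = c then [b] else [])) (fun _ => []) false

theorem everyOther_tapePrefix (r : Tape) (n : ℕ) :
    everyOther false (tapePrefix r (2 * n)) = tapePrefix (evenTape r) n ∧
      everyOther true (tapePrefix r (2 * n)) = tapePrefix (oddTape r) n := by
  induction n generalizing r with
  | zero => exact ⟨rfl, rfl⟩
  | succ n ih =>
    obtain ⟨even_eq, odd_eq⟩ := ih fun n => r (n + 1 + 1)
    rw [Nat.mul_succ, tapePrefix_succ, tapePrefix_succ, tapePrefix_succ, tapePrefix_succ]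
    simp only [everyOther, transduce, Bool.not_false, Bool.not_true, if_true] at even_eq odd_eq ⊢
    exact ⟨by rw [even_eq]; rfl, by rw [odd_eq]; rfl⟩

/-- The transformation of the random tape can be carried out by probabilistic machines. -/
def PolyTimeTape (φ : Tape → Tape) : Prop :=
  ∀ n : List Str × Tape → ℕ, RandPolyTime (fun p => unary (n p)) →
    RandPolyTime fun p => tapePrefix (φ p.2) (n p)

theorem polyTimeTape_id : PolyTimeTape id := fun _ => RandPolyTime.tapePrefix

theorem RandPolyTime.everyOther_tapePrefix {n : List Str × Tape → ℕ}
    (hn : RandPolyTime fun p => unary (n p)) (c : Bool) :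
    RandPolyTime fun p => everyOther c (CompGame.tapePrefix p.2 (2 * n p)) :=
  (tapePrefix (hn.imp fun _ h => (PolyTimeFrom.const _ (unary 2)).mul h)).imp fun _ h =>
    h.comp_transduce _ _ _

theorem polyTimeTape_evenTape : PolyTimeTape evenTape := fun n hn => by
  simpa only [(everyOther_tapePrefix _ _).1] using hn.everyOther_tapePrefix false

theorem polyTimeTape_oddTape : PolyTimeTape oddTape := fun n hn => by
  simpa only [(everyOther_tapePrefix _ _).2] using hn.everyOther_tapePrefix true

theorem RandPolyTime.call {A : List Str → Tape → Str} (hA : IsPPT A) {φ : Tape → Tape}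
    (hφ : PolyTimeTape φ) {T : List Str × Tape → List Str}
    (hT : RandPolyTime fun p => encTuple (T p)) : RandPolyTime fun p => A (T p) (φ p.2) := by
  obtain ⟨q, g, hg, A_eq⟩ := hA
  simp only [A_eq]
  have coins := hφ _ (hT.imp fun _ h => h.unary_length.polynomial_eval q)
  exact comp_isPolyTime hg (coins.encTuple_cons hT)

theorem RandPolyTime.ltDigits {a b : List Str × Tape → Str} (ha : RandPolyTime a)
    (hb : RandPolyTime b) : RandPolyTime fun p => [CompGame.ltDigits (a p) (b p)] :=
  ha.imp₂ hb fun _ => PolyTimeFrom.ltDigits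

theorem IsPolyTime.isPPT {g : List Str → Str} (hg : IsPolyTime g) : IsPPT fun x _ => g x :=
  RandPolyTime.isPPT (RandPolyTime.comp_isPolyTime hg RandPolyTime.input)

theorem RandPolyTime.findIdx {ι γ : Type} [Finite γ] (l : List ι)
    {c : ι → List Str × Tape → Bool} (hc : ∀ i, RandPolyTime fun p => [c i p]) (F : ℕ → List γ) :
    RandPolyTime fun p => F (l.findIdx fun i => c i p) := by
  induction l generalizing F with
  | nil => exact const (F 0)
  | cons i l ih =>
    convert (hc i).ite (const (F 0)) (ih fun k => F (k + 1)) using 2 with p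
    rw [List.findIdx_cons]
    cases c i p <;> rfl

/-! ### Negligible functions -/

namespace Negligible

variable {ε δ : ℕ → ℝ}

theorem zero : Negligible 0 :=
  ⟨fun _ => le_rfl, fun c => (Filter.eventually_gt_atTop 0).mono fun k hk => by
    simp only [Pi.zero_apply]; positivity⟩

theorem mono (h : Negligible ε) (nonneg : ∀ k, 0 ≤ δ k) (le : ∀ k, δ k ≤ ε k) : Negligible δ :=
  ⟨nonneg, fun c => (h.2 c).mono fun k hk => (le k).trans_lt hk⟩

theorem const_mul (h : Negligible ε) {a : ℝ} (ha : 0 ≤ a) : Negligible fun k => a * ε k := by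
  refine ⟨fun k => mul_nonneg ha (h.1 k), fun c => ?_⟩
  obtain ⟨N, hN⟩ := exists_nat_gt a
  filter_upwards [h.2 (c + 1), Filter.eventually_ge_atTop (N + 1)] with k hk hkN
  have k_pos : (0 : ℝ) < k := mod_cast (by lia : 0 < k)
  have a_lt : a < k := hN.trans_le (mod_cast (by lia : N ≤ k))
  calc a * ε k ≤ k * ε k := by have := h.1 k; gcongr
    _ < k * (1 / (k : ℝ) ^ (c + 1)) := by gcongr
    _ = 1 / (k : ℝ) ^ c := by rw [pow_succ]; field_simp

theorem add (hε : Negligible ε) (hδ : Negligible δ) : Negligible fun k => ε k + δ k := by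
  refine ⟨fun k => add_nonneg (hε.1 k) (hδ.1 k), fun c => ?_⟩
  filter_upwards [(hε.const_mul zero_le_two).2 c, (hδ.const_mul zero_le_two).2 c] with k hk hk'
  linarith

theorem sum {ι : Type*} (s : Finset ι) {ε : ι → ℕ → ℝ} (h : ∀ i, Negligible (ε i)) :
    Negligible fun k => ∑ i ∈ s, ε i k := by
  classical
  induction s using Finset.induction_on with
  | empty => exact zero.mono (by simp) (by simp)
  | insert i s hi ih => simpa only [Finset.sum_insert hi] using (h i).add ih

end Negligible

/-! ### Coin tosses -/

instance : IsProbabilityMeasure coin := by unfold coin; infer_instance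

theorem measurableSet_tapePrefix (m : ℕ) (P : Str → Prop) :
    MeasurableSet {r : Tape | P (tapePrefix r m)} := by
  have : Measurable fun (r : Tape) (j : Fin m) => r j := by fun_prop
  exact this (Set.toFinite {f : Fin m → Bool | P (List.ofFn f)}).measurableSet

theorem IsPPT.measurableSet {A : List Str → Tape → Str} (hA : IsPPT A) (x : List Str)
    (P : Str → Prop) : MeasurableSet {r | P (A x r)} := by
  obtain ⟨q, g, -, h⟩ := hA
  simp only [h]
  exact measurableSet_tapePrefix _ fun w => P (g (w :: x))

section Subtape

open ProbabilityTheory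

variable {ι κ : Type*} {f : ι → ℕ} {g : κ → ℕ}

theorem map_coin_subtape (hf : f.Injective) :
    coin.map (fun r i => r (f i)) =
      Measure.infinitePi fun _ : ι => (PMF.uniformOfFintype Bool).toMeasure :=
  Measure.map_infinitePi_infinitePi_of_inj hf

theorem comap_subtape_le (f : ι → ℕ) :
    MeasurableSpace.comap (fun (r : Tape) i => r (f i)) MeasurableSpace.pi ≤
      ⨆ n ∈ Set.range f, MeasurableSpace.comap (fun r : Tape => r n) ⊤ := by
  simp only [MeasurableSpace.pi, MeasurableSpace.comap_iSup, MeasurableSpace.comap_comp]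
  exact iSup_le fun i => le_iSup₂_of_le (f i) ⟨i, rfl⟩ le_rfl

theorem indepFun_subtape (h : Disjoint (Set.range f) (Set.range g)) :
    IndepFun (fun (r : Tape) i => r (f i)) (fun r j => r (g j)) coin := by
  have indep_bits : iIndepFun (fun n (r : Tape) => r n) coin :=
    iIndepFun_infinitePi (X := fun _ b => b) fun _ => measurable_id
  exact indep_of_indep_of_le_left (indep_of_indep_of_le_right
    (indep_iSup_of_disjoint (fun n => (measurable_pi_apply n).comap_le) indep_bits h)
    (comap_subtape_le g)) (comap_subtape_le f)

theorem coin_real_subtapes (hf : f.Injective) (hg : g.Injective)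
    (h : Disjoint (Set.range f) (Set.range g)) {A : Set (ι → Bool)} {B : Set (κ → Bool)}
    (hA : MeasurableSet A) (hB : MeasurableSet B) :
    coin.real {r | (fun i => r (f i)) ∈ A ∧ (fun j => r (g j)) ∈ B} =
      (Measure.infinitePi fun _ : ι => (PMF.uniformOfFintype Bool).toMeasure).real A *
      (Measure.infinitePi fun _ : κ => (PMF.uniformOfFintype Bool).toMeasure).real B := by
  rw [← map_coin_subtape hf, ← map_coin_subtape hg, map_measureReal_apply (by fun_prop) hA,
    map_measureReal_apply (by fun_prop) hB, measureReal_def, measureReal_def, measureReal_def,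
    ← ENNReal.toReal_mul]
  exact congrArg _ ((indepFun_subtape h).measure_inter_preimage_eq_mul _ _ hA hB)

end Subtape

theorem coin_even_odd {A B : Set Tape} (hA : MeasurableSet A) (hB : MeasurableSet B) :
    coin.real {r | evenTape r ∈ A ∧ oddTape r ∈ B} = coin.real A * coin.real B := by
  refine coin_real_subtapes (fun m n h => ?_) (fun m n h => ?_) ?_ hA hB
  · simpa using h
  · simpa using h
  · rw [Set.disjoint_left]
    rintro _ ⟨m, rfl⟩ ⟨n, h⟩
    lia

theorem coin_cons (b : Bool) {A : Set Tape} (hA : MeasurableSet A) :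
    coin.real {r | r 0 = b ∧ (fun n => r (n + 1)) ∈ A} = coin.real A / 2 := by
  have split := coin_real_subtapes (f := fun _ : Unit => 0) (g := fun n => n + 1)
    (Function.injective_of_subsingleton _) (add_left_injective 1) (by simp)
    (A := (fun a => a ()) ⁻¹' {b}) (measurable_pi_apply () (measurableSet_singleton b)) hA
  have head : (Measure.infinitePi fun _ : Unit => (PMF.uniformOfFintype Bool).toMeasure).real
      ((fun a => a ()) ⁻¹' {b}) = 2⁻¹ := by
    rw [← map_measureReal_apply (measurable_pi_apply ()) (measurableSet_singleton b),
      Measure.infinitePi_map_eval, measureReal_def,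
      PMF.toMeasure_apply_singleton _ _ (measurableSet_singleton b)]
    simp
  rw [head] at split
  rw [div_eq_inv_mul]
  exact split

/-! ### Sampling -/

/-- Whether the binary fraction given by the tape is less than the one given by the word. -/
def ltTape (r : Tape) (w : Str) : Bool := ltDigits (tapePrefix r w.length) w

theorem ltTape_nil (r : Tape) : ltTape r [] = false := rfl

theorem ltTape_cons (r : Tape) (b : Bool) (w : Str) :
    ltTape r (b :: w) = if r 0 = b then ltTape (fun n => r (n + 1)) w else b := by
  simp [ltTape, tapePrefix_succ, ltDigits]

theorem measurableSet_ltTape (w : Str) : MeasurableSet {r | ltTape r w = true} :=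
  measurableSet_tapePrefix w.length fun v => ltDigits v w = true

theorem coin_ltTape (w : Str) : coin.real {r | ltTape r w = true} = binFrac w := by
  induction w with
  | nil => simp [ltTape_nil, binFrac]
  | cons b w ih =>
    have same_head := coin_cons b (measurableSet_ltTape w)
    rw [ih] at same_head
    cases b with
    | false =>
      convert same_head using 1
      · congr 1
        ext r
        simp [ltTape_cons]
      · simp [binFrac]
    | true =>
      have less_head := coin_cons false MeasurableSet.univ
      have split : {r | ltTape r (true :: w) = true} =
          {r | r 0 = true ∧ (fun n => r (n + 1)) ∈ {r | ltTape r w = true}} ∪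
          {r | r 0 = false ∧ (fun n => r (n + 1)) ∈ (Set.univ : Set Tape)} := by
        ext r
        cases h : r 0 <;> simp [ltTape_cons, h]
      rw [split, measureReal_union, same_head, less_head]
      · simp only [binFrac, if_true, probReal_univ]
        ring
      · exact Set.disjoint_left.2 fun r h h' => by simp [h.1] at h'
      · exact (measurableSet_eq_fun (f := fun r : Tape => r 0) (by fun_prop) (by fun_prop)).inter
          .univ

theorem binFrac_mem_Ico (w : Str) : binFrac w ∈ Set.Ico 0 1 := by
  induction w with
  | nil => simp [binFrac]
  | cons b w ih =>
    obtain ⟨nonneg, lt_one⟩ := ih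
    cases b <;> simp only [binFrac] <;> constructor <;> norm_num <;> linarith

theorem ltTape_iff {r : Tape} {w : Str} {m : ℕ} (h : w.length ≤ m) :
    ltTape r w = true ↔ binFrac (tapePrefix r m) < binFrac w := by
  induction w generalizing r m with
  | nil => simpa [ltTape_nil, binFrac] using (binFrac_mem_Ico (tapePrefix r m)).1
  | cons b w ih =>
    obtain ⟨m, rfl⟩ := Nat.exists_eq_add_one.2 (Nat.zero_lt_of_lt h)
    have ih_tail := ih (r := fun n => r (n + 1)) (Nat.le_of_succ_le_succ h)
    have tape_mem := binFrac_mem_Ico (tapePrefix (fun n => r (n + 1)) m)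
    have word_mem := binFrac_mem_Ico w
    rw [Set.mem_Ico] at tape_mem word_mem
    rw [ltTape_cons, tapePrefix_succ]
    cases b <;> cases r 0 <;> simp [binFrac, ih_tail] <;> grind

theorem ltTape_mono {r : Tape} {w w' : Str} (h : binFrac w ≤ binFrac w')
    (hw : ltTape r w = true) : ltTape r w' = true := by
  rw [ltTape_iff (Nat.le_add_right w.length w'.length)] at hw
  exact (ltTape_iff (Nat.le_add_left w'.length w.length)).2 (hw.trans_le h)

/-- The index of the first threshold that exceeds the binary fraction given by the tape, or `m` if
none of the `m` thresholds does. -/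
def sample (m : ℕ) (w : ℕ → Str) (r : Tape) : ℕ := (List.range m).findIdx fun i => ltTape r (w i)

theorem sample_le (m : ℕ) (w : ℕ → Str) (r : Tape) : sample m w r ≤ m := by
  simpa [sample] using List.findIdx_le_length (xs := List.range m) (p := fun i => ltTape r (w i))

theorem sample_le_iff {m j : ℕ} (h : j < m) (w : ℕ → Str) (r : Tape) :
    sample m w r ≤ j ↔ ∃ i ≤ j, ltTape r (w i) = true := by
  rw [sample, ← not_iff_not, not_le, List.lt_findIdx_iff]
  simp [h]

theorem measurable_sample (m : ℕ) (w : ℕ → Str) : Measurable (sample m w) := by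
  unfold sample
  induction List.range m with
  | nil => exact measurable_const
  | cons i l ih =>
    simp only [List.findIdx_cons, Bool.cond_eq_ite]
    exact Measurable.ite (measurableSet_ltTape (w i)) measurable_const (ih.add_const 1)

theorem abs_coin_sample_le_sub_le {m j : ℕ} (h : j < m) {w : ℕ → Str} {p : ℕ → ℝ}
    (hp : Monotone p) {ε : ℝ} (hw : ∀ i < m, |p i - binFrac (w i)| ≤ ε) :
    |coin.real {r | sample m w r ≤ j} - p j| ≤ ε := by
  -- The thresholds need not be monotone, as they only approximate `p`, but the largest one up to
  -- `j` lies between approximations of `p j`.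
  obtain ⟨i, hi, is_max⟩ := Finset.exists_max_image (Finset.Iic j) (fun i => binFrac (w i))
    ⟨j, Finset.mem_Iic.2 le_rfl⟩
  simp only [Finset.mem_Iic] at hi is_max
  have event_eq : {r | sample m w r ≤ j} = {r | ltTape r (w i) = true} := by
    ext r
    simp only [Set.mem_ofPred_eq, sample_le_iff h]
    exact ⟨fun ⟨k, hk, hr⟩ => ltTape_mono (is_max k hk) hr, fun hr => ⟨i, hi, hr⟩⟩
  rw [event_eq, coin_ltTape, abs_le]
  have approx_i := abs_le.1 (hw i (by lia))
  have approx_j := abs_le.1 (hw j h)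
  constructor <;> linarith [is_max j le_rfl, hp hi]

section Distribution

variable {μ ν : Measure ℕ} {m : ℕ} {η : ℝ}

theorem measureReal_eq_sum_of_Iic [IsProbabilityMeasure μ] (hμ : μ.real (Set.Iic m) = 1)
    (E : Set ℕ) [DecidablePred (· ∈ E)] :
    μ.real E = ∑ j ∈ Finset.Iic m with j ∈ E, μ.real {j} := by
  have null : μ.real (E \ Set.Iic m) = 0 := by
    refine measureReal_mono_null (s₂ := (Set.Iic m)ᶜ) (Set.sdiff_subset_compl _ _) ?_
    rw [probReal_compl_eq_one_sub .of_discrete, hμ, sub_self]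
  rw [← measureReal_inter_add_sdiff (s := E) (t := Set.Iic m) .of_discrete, null, add_zero,
    sum_measureReal_singleton]
  congr 1
  ext j
  simp [and_comm]

theorem abs_measureReal_singleton_sub_le [IsFiniteMeasure μ] [IsFiniteMeasure ν]
    (h : ∀ j, |μ.real (Set.Iic j) - ν.real (Set.Iic j)| ≤ η) (j : ℕ) :
    |μ.real {j} - ν.real {j}| ≤ 2 * η := by
  cases j with
  | zero =>
    have := h 0
    rw [show Set.Iic 0 = {0} from Set.Iic_bot] at this
    linarith [abs_nonneg (μ.real {0} - ν.real {0})]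
  | succ j =>
    have diff : ({j + 1} : Set ℕ) = Set.Iic (j + 1) \ Set.Iic j := by
      ext k
      simp only [Set.mem_singleton_iff, Set.mem_sdiff, Set.mem_Iic]
      lia
    have subset : Set.Iic j ⊆ Set.Iic (j + 1) := Set.Iic_subset_Iic.2 (Nat.le_succ j)
    rw [diff, measureReal_sdiff subset .of_discrete, measureReal_sdiff subset .of_discrete]
    grind [abs_le, h j, h (j + 1)]

theorem abs_measureReal_sub_le_of_Iic [IsProbabilityMeasure μ] [IsProbabilityMeasure ν]
    (hμ : μ.real (Set.Iic m) = 1) (hν : ν.real (Set.Iic m) = 1)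
    (h : ∀ j < m, |μ.real (Set.Iic j) - ν.real (Set.Iic j)| ≤ η) (hη : 0 ≤ η) (E : Set ℕ) :
    |μ.real E - ν.real E| ≤ (m + 1) * (2 * η) := by
  classical
  have cdf_close (j) : |μ.real (Set.Iic j) - ν.real (Set.Iic j)| ≤ η := by
    rcases lt_or_ge j m with hj | hj
    · exact h j hj
    · have eq_one (κ : Measure ℕ) [IsProbabilityMeasure κ] (hκ : κ.real (Set.Iic m) = 1) :
          κ.real (Set.Iic j) = 1 :=
        measureReal_le_one.antisymm (hκ ▸ measureReal_mono (Set.Iic_subset_Iic.2 hj))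
      rwa [eq_one μ hμ, eq_one ν hν, sub_self, abs_zero]
  rw [measureReal_eq_sum_of_Iic hμ, measureReal_eq_sum_of_Iic hν, ← Finset.sum_sub_distrib]
  calc |∑ j ∈ Finset.Iic m with j ∈ E, (μ.real {j} - ν.real {j})|
      ≤ ∑ j ∈ Finset.Iic m with j ∈ E, |μ.real {j} - ν.real {j}| :=
        Finset.abs_sum_le_sum_abs _ _
    _ ≤ ∑ j ∈ Finset.Iic m, |μ.real {j} - ν.real {j}| :=
        Finset.sum_le_sum_of_subset_of_nonneg (Finset.filter_subset _ _) fun _ _ _ => abs_nonneg _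
    _ ≤ (Finset.Iic m).card • (2 * η) :=
        Finset.sum_le_card_nsmul _ _ _ fun j _ => abs_measureReal_singleton_sub_le cdf_close j
    _ = (m + 1) * (2 * η) := by simp

end Distribution

theorem exists_sampler {Ω : Type*} [MeasurableSpace Ω] [DiscreteMeasurableSpace Ω] (μ : Measure Ω)
    [IsProbabilityMeasure μ] {m : ℕ} {J : Ω → ℕ} (hJ : ∀ s, J s ≤ m)
    (heff : ∀ S : Set Ω, EffReal (μ.real S)) :
    ∃ g : ℕ → List Str → Str, (∀ i, IsPolyTime (g i)) ∧ ∃ ε, Negligible ε ∧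
      ∀ (n : ℕ+) (E : Set ℕ),
        |coin.real {r | sample m (fun i => g i [unary n]) r ∈ E} - μ.real {s | J s ∈ E}| ≤ ε n := by
  choose g hg ε hε approx using fun i => heff {s | J s ≤ i}
  refine ⟨g, hg, fun k => (m + 1) * (2 * ∑ i ∈ Finset.range m, ε i k),
    ((Negligible.sum _ hε).const_mul zero_le_two).const_mul (by positivity), fun n E => ?_⟩
  have J_measurable : Measurable J := .of_discrete
  have sample_measurable := measurable_sample m fun i => g i [unary n]
  have := Measure.isProbabilityMeasure_map (μ := μ) J_measurable.aemeasurable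
  have := Measure.isProbabilityMeasure_map (μ := coin) sample_measurable.aemeasurable
  have map_sample (E : Set ℕ) : (coin.map (sample m fun i => g i [unary n])).real E =
      coin.real {r | sample m (fun i => g i [unary n]) r ∈ E} :=
    map_measureReal_apply sample_measurable .of_discrete
  have map_J (E : Set ℕ) : (μ.map J).real E = μ.real {s | J s ∈ E} :=
    map_measureReal_apply J_measurable .of_discrete
  rw [← map_sample, ← map_J]
  refine abs_measureReal_sub_le_of_Iic ?_ ?_ (fun j hj => ?_)
    (Finset.sum_nonneg fun i _ => (hε i).1 n) E
  · simp [map_sample, sample_le]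
  · simp [map_J, hJ]
  · rw [map_sample, map_J]
    refine abs_coin_sample_le_sub_le hj (p := fun j => μ.real {s | J s ≤ j})
      (fun i k hik => measureReal_mono fun s (hs : J s ≤ i) => hs.trans hik) fun i hi => ?_
    exact (approx i n).trans (Finset.single_le_sum (f := fun i => ε i n)
      (fun i _ => (hε i).1 n) (Finset.mem_range.2 hi))

/-! ### Games with three stages -/

theorem mem_bitStrings_iff {w : Str} : w ∈ bitStrings ↔ ∃ b : Bool, w = [b] := by
  simp [bitStrings]

theorem bit_mem_bitStrings (b : Bool) : [b] ∈ bitStrings := mem_bitStrings_iff.2 ⟨b, rfl⟩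

section StageGame

variable {A B D : Set Str} {h : Hist}

theorem mem_stageHist_and_length_eq_three_iff :
    h ∈ stageHist A B D ∧ h.length = 3 ↔ ∃ a ∈ A, ∃ b ∈ B, ∃ d ∈ D, h = [a, b, d] := by
  rcases h with _ | ⟨x, _ | ⟨y, _ | ⟨z, _ | ⟨w, l⟩⟩⟩⟩ <;> simp [stageHist, IsStageHist]

theorem length_le_three_of_mem_stageHist (hh : h ∈ stageHist A B D) : h.length ≤ 3 := by
  rcases h with _ | ⟨x, _ | ⟨y, _ | ⟨z, _ | ⟨w, l⟩⟩⟩⟩ <;> simp_all [stageHist, IsStageHist]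

variable {c : ℕ} {K : Game c}

theorem mem_nonterminal_iff_of_stageHist (hK : K.H = stageHist A B D) (hA : A.Nonempty)
    (hB : B.Nonempty) (hD : D.Nonempty) : h ∈ K.nonterminal ↔ h ∈ K.H ∧ h.length < 3 := by
  simp only [Game.nonterminal, hK, Set.mem_ofPred_eq, append_mem_stageHist, exists_and_left]
  refine and_congr_right fun _ => ?_
  change (stageSet A B D h.length).Nonempty ↔ _
  rcases h.length with _ | _ | _ | k <;> simp [stageSet, hA, hB, hD]

theorem mem_terminal_iff_of_stageHist (hK : K.H = stageHist A B D) (hA : A.Nonempty)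
    (hB : B.Nonempty) (hD : D.Nonempty) : h ∈ K.terminal ↔ h ∈ K.H ∧ h.length = 3 := by
  have not_nonterminal : h ∈ K.terminal ↔ h ∈ K.H ∧ h ∉ K.nonterminal := by
    simp [Game.terminal, Game.nonterminal]
  rw [not_nonterminal, mem_nonterminal_iff_of_stageHist hK hA hB hD]
  refine and_congr_right fun hh => ?_
  have := length_le_three_of_mem_stageHist (hK ▸ hh)
  simp only [hh, true_and]
  lia

end StageGame

theorem envelopeGame_mem_nonterminal_iff {h : Hist} :
    h ∈ envelopeGame.nonterminal ↔ h ∈ envelopeGame.H ∧ h.length < 3 :=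
  have bits := bitStrings_nontrivial.nonempty
  mem_nonterminal_iff_of_stageHist rfl bits bits bits

theorem envelopeGame_mem_terminal_iff {h : Hist} :
    h ∈ envelopeGame.terminal ↔ h ∈ envelopeGame.H ∧ h.length = 3 :=
  have bits := bitStrings_nontrivial.nonempty
  mem_terminal_iff_of_stageHist rfl bits bits bits

/-- The terminal history of the envelope game in which the bit in the envelope is `t.1`, the guess
is `t.2.1`, and the envelope is opened if `t.2.2` is `true`. -/
def envHist (t : Bool × Bool × Bool) : Hist := [[t.1], [t.2.1], [t.2.2]]

theorem envHist_injective : Function.Injective envHist := by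
  rintro ⟨x, y, d⟩ ⟨x', y', d'⟩ h
  simpa [envHist] using h

theorem envelopeGame_terminal : envelopeGame.terminal = Set.range envHist := by
  ext h
  rw [envelopeGame_mem_terminal_iff]
  refine mem_stageHist_and_length_eq_three_iff.trans ?_
  simp only [mem_bitStrings_iff, ↓existsAndEq, true_and, Set.mem_range, Prod.exists, envHist,
    eq_comm (a := h)]

section CommitmentGame

variable {S : CommitmentScheme} {n : ℕ+} {h : Hist}

theorem commitmentGame_append_mem_iff {a : Str} :
    h ++ [a] ∈ (commitmentGame S n).H ↔ h ∈ (commitmentGame S n).H ∧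
      a ∈ stageSet (S.commitments n) bitStrings {s | s.length ≤ n} h.length :=
  append_mem_stageHist _ _ _ h a

theorem commitmentGame_mem_nonterminal_iff :
    h ∈ (commitmentGame S n).nonterminal ↔ h ∈ (commitmentGame S n).H ∧ h.length < 3 :=
  mem_nonterminal_iff_of_stageHist rfl (S.commitments_nontrivial n).nonempty
    bitStrings_nontrivial.nonempty (keys_nontrivial n).nonempty

theorem commitmentGame_mem_terminal_iff :
    h ∈ (commitmentGame S n).terminal ↔ h ∈ (commitmentGame S n).H ∧ h.length = 3 :=
  mem_terminal_iff_of_stageHist rfl (S.commitments_nontrivial n).nonempty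
    bitStrings_nontrivial.nonempty (keys_nontrivial n).nonempty

theorem commitmentGame_mem_terminal_iff_exists :
    h ∈ (commitmentGame S n).terminal ↔
      ∃ c ∈ S.commitments n, ∃ y : Bool, ∃ s : Str, s.length ≤ n ∧ h = [c, [y], s] := by
  rw [commitmentGame_mem_terminal_iff]
  refine mem_stageHist_and_length_eq_three_iff.trans ?_
  simp only [mem_bitStrings_iff, ↓existsAndEq, true_and, Set.mem_ofPred_eq]

theorem CommitmentScheme.length_of_mem {c : Str} (hc : c ∈ S.commitments n) : c.length = n := by
  obtain ⟨b, r, rfl⟩ := hc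
  exact S.length_C₁ n b r

end CommitmentGame

/-! ### The sequence of commitment games is computable -/

theorem PolyTimeFrom.tuple_isEmpty {X : Type*} {α : Type} {u : X → List α} {T : X → List Str}
    (hT : PolyTimeFrom u fun x => encTuple (T x)) : PolyTimeFrom u fun x => [(T x).isEmpty] := by
  convert hT.decide_eq_const [] using 3 with x
  cases T x <;> simp [encTuple]

theorem two_thirds_le_coin_of_forall {P : Tape → Prop} (h : ∀ r, P r) :
    2 / 3 ≤ coin.real {r | P r} := by
  simp only [h, Set.ofPred_true, probReal_univ]
  norm_num

namespace PPTDecides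

variable {dom dom' : Set Hist} {T T' : ℕ+ → Set Hist}

theorem of_polyTimeFrom {test : List Str → Bool} (htest : PolyTimeFrom encTuple fun y => [test y])
    (h : ∀ n : ℕ+, ∀ x ∈ dom, test (unary n :: x) = true ↔ x ∈ T n) : PPTDecides dom T :=
  ⟨_, (isPolyTime_iff.2 htest).isPPT, fun n x hx =>
    two_thirds_le_coin_of_forall fun _ => by simpa using h n x hx⟩

theorem of_reduction (hT' : PPTDecides dom' T') {easy answer : List Str → Bool}
    {reduce : List Str → List Str} (heasy : PolyTimeFrom encTuple fun y => [easy y])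
    (hanswer : PolyTimeFrom encTuple fun y => [answer y])
    (hreduce : PolyTimeFrom encTuple fun y => encTuple (reduce y))
    (answer_iff : ∀ n : ℕ+, ∀ x ∈ dom, easy (unary n :: x) = true →
      (answer (unary n :: x) = true ↔ x ∈ T n))
    (reduce_iff : ∀ n : ℕ+, ∀ x ∈ dom, easy (unary n :: x) = false →
      ∃ x' ∈ dom', reduce (unary n :: x) = unary n :: x' ∧ (x' ∈ T' n ↔ x ∈ T n)) :
    PPTDecides dom T := by
  obtain ⟨D, hD, hT'⟩ := hT'
  refine ⟨fun y r => if easy y then [answer y] else D (reduce y) r, RandPolyTime.isPPT ?_, ?_⟩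
  · have of_input {β : Type} {v : List Str → List β} (hv : PolyTimeFrom encTuple v) :
        RandPolyTime fun p => v p.1 :=
      RandPolyTime.input.imp fun _ h => h.comp (hv.reindex Prod.fst)
    exact (of_input heasy).ite (of_input hanswer)
      (RandPolyTime.call hD polyTimeTape_id (of_input hreduce))
  · intro n x hx
    cases hc : easy (unary n :: x)
    · obtain ⟨x', hx', reduce_eq, mem_iff⟩ := reduce_iff n x hx hc
      simpa [hc, reduce_eq, mem_iff] using hT' n x' hx'
    · exact two_thirds_le_coin_of_forall fun _ => by
        simpa [hc] using answer_iff n x hx hc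

end PPTDecides

section Computable

variable (S : CommitmentScheme)

theorem polyTimeFrom_encTuple_tail : PolyTimeFrom encTuple fun y => encTuple y.tail :=
  (PolyTimeFrom.refl encTuple).tuple_tail (T := id)

theorem polyTimeFrom_encTuple_headD : PolyTimeFrom encTuple fun y => y.headD [] :=
  (PolyTimeFrom.refl encTuple).tuple_headD (T := id)

theorem cons_mem_commitmentGame_iff_of_mem {S : CommitmentScheme} {m : ℕ+} {c : Str} {l : Hist}
    (hm : c :: l ∈ (commitmentGame S m).H) (n : ℕ+) :
    c :: l ∈ (commitmentGame S n).H ↔ c.length = n := by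
  have length_eq {k : ℕ+} (hk : c :: l ∈ (commitmentGame S k).H) : c.length = k := by
    refine S.length_of_mem ?_
    rcases l with _ | ⟨y, _ | ⟨z, _ | ⟨w, l⟩⟩⟩
    exacts [hk, hk.1, hk.1, hk.elim]
  refine ⟨length_eq, fun hn => ?_⟩
  rwa [← PNat.eq ((length_eq hm).symm.trans hn)]

theorem commitmentGame_histories :
    PPTDecides (⋃ n, (commitmentGame S n).H) fun n => (commitmentGame S n).H := by
  have param := polyTimeFrom_encTuple_headD
  have commitment := polyTimeFrom_encTuple_tail.tuple_headD
  refine .of_polyTimeFrom (polyTimeFrom_encTuple_tail.tuple_isEmpty.or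
    ((commitment.length_le param).and (param.length_le commitment))) fun n h hh => ?_
  obtain ⟨m, hm⟩ := Set.mem_iUnion.1 hh
  rcases h with _ | ⟨c, l⟩
  · simpa using (commitmentGame S n).nil_mem
  · rw [cons_mem_commitmentGame_iff_of_mem hm n]
    simp [unary, le_antisymm_iff (α := ℕ)]

/-- The test whether, in the tuple `(1^n, c, l)`, the moves `l` can follow a commitment string `c`
in the `n`th commitment game. -/
def replyTest (y : List Str) : Bool :=
  y.tail.tail.isEmpty || (decide ((y.tail.tail.headD []).length = 1) &&
    (y.tail.tail.tail.tail.isEmpty &&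
      decide ((y.tail.tail.tail.headD []).length ≤ (y.headD []).length)))

theorem polyTimeFrom_replyTest : PolyTimeFrom encTuple fun y => [replyTest y] := by
  have reply := polyTimeFrom_encTuple_tail.tuple_tail
  have is_bit : PolyTimeFrom encTuple fun y => [decide ((y.tail.tail.headD []).length = 1)] := by
    convert reply.tuple_headD.of_take 2 fun w => [decide (w.length = 1)] using 3 with y
    simp only [List.length_take, decide_eq_decide]
    lia
  exact reply.tuple_isEmpty.or (is_bit.and (reply.tuple_tail.tuple_tail.tuple_isEmpty.and
    (reply.tuple_tail.tuple_headD.length_le polyTimeFrom_encTuple_headD)))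

theorem cons_mem_commitmentGame_iff {n : ℕ+} {c : Str} {l : Hist} :
    c :: l ∈ (commitmentGame S n).H ↔
      c ∈ S.commitments n ∧ replyTest (unary n :: c :: l) = true := by
  have mem_iff (h : Hist) : h ∈ (commitmentGame S n).H ↔
      IsStageHist (S.commitments n) bitStrings {s | s.length ≤ n} h := Iff.rfl
  rw [mem_iff]
  rcases l with _ | ⟨y, _ | ⟨z, _ | ⟨w, l⟩⟩⟩ <;>
    simp [IsStageHist, replyTest, unary, mem_bitStrings_iff, List.length_eq_one_iff]

theorem commitmentGame_pptDecides
    (h : PPTDecides {h | h.length = 1} fun n => {h | ∃ c ∈ S.commitments n, h = [c]}) :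
    PPTDecides Set.univ fun n => (commitmentGame S n).H := by
  have is_nil := polyTimeFrom_encTuple_tail.tuple_isEmpty
  have reduce := polyTimeFrom_encTuple_headD.encTuple_cons
    (polyTimeFrom_encTuple_tail.tuple_headD.encTuple_cons .encTuple_nil)
  refine h.of_reduction (is_nil.or (polyTimeFrom_replyTest.of_bool fun b => [!b])) is_nil reduce
    (fun n x _ easy => ?_) fun n x _ hard => ?_ <;> rcases x with _ | ⟨c, l⟩
  · simpa using (commitmentGame S n).nil_mem
  · simp_all [cons_mem_commitmentGame_iff]
  · simp at hard
  · exact ⟨[c], rfl, rfl, by simp_all [cons_mem_commitmentGame_iff]⟩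

theorem dyadic_one (k : ℕ) (b : Bool) :
    dyadic k (b :: (List.replicate k false ++ [true])) = if b then -1 else 1 := by
  have digits : Nat.ofDigits 2 ((List.replicate k false ++ [true]).map Bool.toNat) = 2 ^ k := by
    simp [Nat.ofDigits_append, Nat.ofDigits_replicate_zero]
  rw [dyadic, digits]
  push_cast
  field_simp

theorem exists_winTest : ∃ win : List Str → Bool, (PolyTimeFrom encTuple fun h => [win h]) ∧
    ∀ c (y : Bool) s, commitmentWin S [c, [y], s] = if win [c, [y], s] then 1 else -1 := by
  obtain ⟨g, hg, hR⟩ := S.polyTime_R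
  have guess := polyTimeFrom_encTuple_tail.tuple_headD
  have opened : PolyTimeFrom encTuple fun h => g [h.headD [], h.tail.tail.headD []] :=
    .comp_isPolyTime hg (polyTimeFrom_encTuple_headD.encTuple_cons
      (polyTimeFrom_encTuple_tail.tuple_tail.tuple_headD.encTuple_cons .encTuple_nil))
  refine ⟨_, ((opened.decide_eq_const [true]).and (guess.decide_eq_const [false])).or
    ((opened.decide_eq_const [false]).and (guess.decide_eq_const [true])), fun c y s => ?_⟩
  simp only [commitmentWin, List.headD_cons, List.tail_cons, hR]
  rcases S.R c s with _ | _ | _ <;> cases y <;> simp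

theorem commitmentGame_utility (i : Fin 2) :
    ∃ v : Hist → ℝ, PolyTimeRealOn (⋃ n, (commitmentGame S n).terminal) v ∧
      ∀ n, ∀ h ∈ (commitmentGame S n).terminal, (commitmentGame S n).u i h = v h := by
  obtain ⟨win, hwin, commitmentWin_eq⟩ := exists_winTest S
  refine ⟨fun h => if i = 0 then commitmentWin S h else -commitmentWin S h, ?_, fun _ _ _ => rfl⟩
  refine ⟨fun y => (win y.tail != decide (i = 0)) ::
    ((y.headD []).map (fun _ => false) ++ [true]), isPolyTime_iff.2 ?_, fun h hh k => ?_⟩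
  · have sign := (polyTimeFrom_encTuple_tail.comp (hwin.reindex List.tail)).of_bool
      fun b => [b != decide (i = 0)]
    exact sign.append ((polyTimeFrom_encTuple_headD.map fun _ => false).append (.const _ [true]))
  · obtain ⟨n, hn⟩ := Set.mem_iUnion.1 hh
    obtain ⟨c, -, y, s, -, rfl⟩ := commitmentGame_mem_terminal_iff_exists.1 hn
    simp only [List.headD_cons, List.tail_cons, unary, List.map_replicate, dyadic_one,
      commitmentWin_eq]
    fin_cases i <;> cases win [c, [y], s] <;> simp

theorem commitmentGame_player :
    ∃ g, IsPolyTime g ∧ ∀ n, ∀ h ∈ (commitmentGame S n).nonterminal,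
      g h = unary ((commitmentGame S n).P h) := by
  have length : PolyTimeFrom encTuple fun h => unary h.length :=
    (PolyTimeFrom.refl encTuple).tuple_length (T := id)
  refine ⟨fun h => if (unary h.length).take 2 = [true] then [true] else [],
    isPolyTime_iff.2 (length.of_take 2 fun w => if w = [true] then [true] else []),
    fun n h _ => ?_⟩
  change _ = unary ((if h.length = 1 then 1 else 0 : Fin 2) : ℕ)
  rcases h with _ | ⟨x, _ | ⟨y, l⟩⟩ <;> simp [unary, List.replicate_succ]

theorem commitmentGame_action_length :
    ∃ p : Polynomial ℕ, ∀ (n : ℕ+) h a, h ++ [a] ∈ (commitmentGame S n).H →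
      a.length ≤ p.eval (n : ℕ) := by
  refine ⟨Polynomial.X, fun n h a ha => ?_⟩
  obtain ⟨-, ha⟩ := commitmentGame_append_mem_iff.1 ha
  rw [Polynomial.eval_X]
  rcases hk : h.length with _ | _ | _ | k <;> rw [hk] at ha
  · exact (S.length_of_mem ha).le
  · obtain ⟨b, rfl⟩ := mem_bitStrings_iff.1 ha
    exact n.pos
  · exact ha
  · exact ha.elim

theorem commitmentGame_isComputableUniform : IsComputableUniform (commitmentGame S) where
  action_length := commitmentGame_action_length S
  histories := commitmentGame_histories S
  player := commitmentGame_player S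
  utility := commitmentGame_utility S

end Computable

/-! ### From commitment games to the envelope game -/

section HistoryMap

variable {S : CommitmentScheme} {n : ℕ+} {h : Hist}

theorem CommitmentScheme.C₁_mem_commitments (S : CommitmentScheme) (n : ℕ+) (b : Bool) (r : Tape) :
    S.C₁ n b r ∈ S.commitments n :=
  ⟨b, r, rfl⟩

theorem CommitmentScheme.eq_of_R_C₁_eq_some {b b' : Bool} {r : Tape} {s : Str}
    (h : S.R (S.C₁ n b r) s = some b') : b = b' := by
  by_cases hs : s = S.C₂ n b r
  · rw [hs, S.opens] at h
    exact Option.some_injective _ h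
  · rw [S.binding n b r s hs] at h
    cases h

open Classical in
/-- The bit to which the string `c` commits; by convention `false` if no key opens `c`. -/
def CommitmentScheme.bit (S : CommitmentScheme) (c : Str) : Bool :=
  decide (∃ s, S.R c s = some true)

theorem CommitmentScheme.bit_eq_of_R_eq_some {c s : Str} {b : Bool} (hc : c ∈ S.commitments n)
    (hs : S.R c s = some b) : S.bit c = b := by
  classical
  obtain ⟨b', r, rfl⟩ := hc
  obtain rfl := eq_of_R_C₁_eq_some hs
  cases b'
  · exact decide_eq_false fun ⟨t, ht⟩ => Bool.false_ne_true (eq_of_R_C₁_eq_some ht)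
  · exact decide_eq_true ⟨s, hs⟩

theorem CommitmentScheme.bit_C₁ (b : Bool) (r : Tape) : S.bit (S.C₁ n b r) = b :=
  bit_eq_of_R_eq_some (S.C₁_mem_commitments n b r) (S.opens n b r)

theorem CommitmentScheme.R_C₁_unary (b : Bool) (r : Tape) :
    S.R (S.C₁ n b r) (unary n) = none := by
  refine S.binding n b r _ fun h => ?_
  have length_eq := congrArg List.length h
  rw [S.length_C₂, unary, List.length_replicate] at length_eq
  have := n.pos
  lia

/-- The map from the histories of the commitment games to those of the envelope game: a commitment
string stands for the bit to which it commits, and a string sent in the third move stands for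
opening the envelope if and only if it opens the commitment. -/
def toEnvelope (S : CommitmentScheme) : Hist → Hist
  | [] => []
  | [c] => [[S.bit c]]
  | [c, y] => [[S.bit c], y]
  | [c, y, s] => [[S.bit c], y, [(S.R c s).isSome]]
  | _ => []

theorem toEnvelope_mapsTo : Set.MapsTo (toEnvelope S) (commitmentGame S n).H envelopeGame.H := by
  intro h hh
  rcases h with _ | ⟨c, _ | ⟨y, _ | ⟨s, _ | ⟨w, l⟩⟩⟩⟩
  · trivial
  · exact bit_mem_bitStrings _
  · exact ⟨bit_mem_bitStrings _, hh.2⟩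
  · exact ⟨bit_mem_bitStrings _, hh.2.1, bit_mem_bitStrings _⟩
  · exact hh.elim

theorem length_toEnvelope (hh : h ∈ (commitmentGame S n).H) :
    (toEnvelope S h).length = h.length := by
  rcases h with _ | ⟨c, _ | ⟨y, _ | ⟨s, _ | ⟨w, l⟩⟩⟩⟩
  iterate 4 rfl
  exact hh.elim

theorem exists_isSome_R_C₁_eq (S : CommitmentScheme) (n : ℕ+) (b d : Bool) (r : Tape) :
    ∃ s : Str, s.length ≤ n ∧ (S.R (S.C₁ n b r) s).isSome = d := by
  cases d
  · exact ⟨unary n, by simp [unary], by rw [CommitmentScheme.R_C₁_unary]; rfl⟩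
  · exact ⟨S.C₂ n b r, by simp [S.length_C₂], by rw [S.opens]; rfl⟩

theorem toEnvelope_surjOn : Set.SurjOn (toEnvelope S) (commitmentGame S n).H envelopeGame.H := by
  have exists_commitment {x : Str} (hx : x ∈ bitStrings) :
      ∃ b : Bool, x = [S.bit (S.C₁ n b fun _ => false)] := by
    obtain ⟨b, rfl⟩ := mem_bitStrings_iff.1 hx
    exact ⟨b, by rw [CommitmentScheme.bit_C₁]⟩
  have mem := (S.C₁_mem_commitments n · fun _ => false)
  intro h hh
  rcases h with _ | ⟨x, _ | ⟨y, _ | ⟨z, _ | ⟨w, l⟩⟩⟩⟩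
  · exact ⟨[], trivial, rfl⟩
  · obtain ⟨b, rfl⟩ := exists_commitment hh
    exact ⟨[_], mem b, rfl⟩
  · obtain ⟨hx, hy⟩ : x ∈ bitStrings ∧ y ∈ bitStrings := hh
    obtain ⟨b, rfl⟩ := exists_commitment hx
    exact ⟨[_, y], ⟨mem b, hy⟩, rfl⟩
  · obtain ⟨hx, hy, hz⟩ : x ∈ bitStrings ∧ y ∈ bitStrings ∧ z ∈ bitStrings := hh
    obtain ⟨b, rfl⟩ := exists_commitment hx
    obtain ⟨d, rfl⟩ := mem_bitStrings_iff.1 hz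
    obtain ⟨s, hs, rfl⟩ := exists_isSome_R_C₁_eq S n b d fun _ => false
    exact ⟨[_, y, s], ⟨mem b, hy, hs⟩, rfl⟩
  · exact hh.elim

theorem toEnvelope_mem_nonterminal (hh : h ∈ (commitmentGame S n).nonterminal) :
    toEnvelope S h ∈ envelopeGame.nonterminal := by
  rw [commitmentGame_mem_nonterminal_iff] at hh
  rw [envelopeGame_mem_nonterminal_iff, length_toEnvelope hh.1]
  exact ⟨toEnvelope_mapsTo hh.1, hh.2⟩

theorem toEnvelope_mem_terminal_iff (hh : h ∈ (commitmentGame S n).H) :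
    toEnvelope S h ∈ envelopeGame.terminal ↔ h ∈ (commitmentGame S n).terminal := by
  rw [envelopeGame_mem_terminal_iff, commitmentGame_mem_terminal_iff, length_toEnvelope hh]
  simp only [hh, toEnvelope_mapsTo hh, true_and]

theorem toEnvelope_prefix (hh : h ∈ (commitmentGame S n).H) {h' : Hist} (hp : h' <+: h) :
    toEnvelope S h' <+: toEnvelope S h := by
  rcases h with _ | ⟨c, _ | ⟨y, _ | ⟨s, _ | ⟨w, l⟩⟩⟩⟩
  · rw [List.prefix_nil.1 hp]
  case cons.cons.cons.cons => exact hh.elim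
  all_goals
    obtain ⟨t, ht⟩ := hp
    rcases h' with _ | ⟨c', _ | ⟨y', _ | ⟨s', _ | ⟨w', l'⟩⟩⟩⟩ <;> simp_all [toEnvelope]

theorem toEnvelope_historyMap (S : CommitmentScheme) (n : ℕ+) :
    HistoryMap (commitmentGame S n) envelopeGame (toEnvelope S) where
  mapsTo := toEnvelope_mapsTo
  surjOn := toEnvelope_surjOn
  length_eq _ := length_toEnvelope
  terminal_iff _ := toEnvelope_mem_terminal_iff
  player_eq h hh := by
    change (if (toEnvelope S h).length = 1 then (1 : Fin 2) else 0) = if h.length = 1 then 1 else 0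
    rw [length_toEnvelope (commitmentGame_mem_nonterminal_iff.1 hh).1]
  prefix_of _ hh _ := toEnvelope_prefix hh
  sameInfo := by
    rintro h _ ⟨hh, -, rfl : h = _⟩
    exact ⟨toEnvelope_mem_nonterminal hh, toEnvelope_mem_nonterminal hh, rfl⟩
  lastAction := by
    rintro h _ ⟨-, -, rfl : h = _⟩ a -
    rfl

theorem commitmentWin_eq_envelopeWin {c : Str} (hc : c ∈ S.commitments n) (y s : Str) :
    commitmentWin S [c, y, s] = envelopeWin (toEnvelope S [c, y, s]) := by
  simp only [commitmentWin, toEnvelope, envelopeWin]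
  congr 1
  rw [eq_iff_iff]
  cases hR : S.R c s with
  | none => simp
  | some b => simp [CommitmentScheme.bit_eq_of_R_eq_some hc hR, eq_comm]

theorem commitmentGame_u_eq (hh : h ∈ (commitmentGame S n).terminal) (i : Fin 2) :
    (commitmentGame S n).u i h = envelopeGame.u i (toEnvelope S h) := by
  obtain ⟨c, hc, y, s, -, rfl⟩ := commitmentGame_mem_terminal_iff_exists.1 hh
  simp only [commitmentGame, envelopeGame, stageGame, commitmentWin_eq_envelopeWin hc]

end HistoryMap

/-! ### Outcomes of the commitment games -/

section Outcomes

variable {S : CommitmentScheme} {n : ℕ+} {h : Hist}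

theorem commitmentGame_mem_turn_iff {i : Fin 2} :
    h ∈ (commitmentGame S n).turn i ↔
      (h ∈ (commitmentGame S n).H ∧ h.length < 3) ∧ (if h.length = 1 then 1 else 0) = i :=
  and_congr_left' commitmentGame_mem_nonterminal_iff

theorem commitmentGame_mem_turn_zero_iff :
    h ∈ (commitmentGame S n).turn 0 ↔
      h = [] ∨ ∃ c ∈ S.commitments n, ∃ y : Bool, h = [c, [y]] := by
  rw [commitmentGame_mem_turn_iff]
  change (IsStageHist _ _ _ h ∧ _) ∧ _ ↔ _
  rcases h with _ | ⟨c, _ | ⟨y, _ | ⟨s, l⟩⟩⟩ <;> simp [IsStageHist, mem_bitStrings_iff]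

theorem commitmentGame_mem_turn_one_iff :
    h ∈ (commitmentGame S n).turn 1 ↔ ∃ c ∈ S.commitments n, h = [c] := by
  rw [commitmentGame_mem_turn_iff]
  change (IsStageHist _ _ _ h ∧ _) ∧ _ ↔ _
  rcases h with _ | ⟨c, _ | ⟨y, _ | ⟨s, l⟩⟩⟩ <;> simp [IsStageHist]

theorem append_singleton_prefix_triple_iff {α : Type*} {l : List α} {a x y z : α} :
    l ++ [a] <+: [x, y, z] ↔ (l = [] ∧ a = x) ∨ (l = [x] ∧ a = y) ∨ (l = [x, y] ∧ a = z) := by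
  rcases l with _ | ⟨x', _ | ⟨y', _ | ⟨z', _ | ⟨w', l'⟩⟩⟩⟩ <;>
    simp [List.cons_prefix_cons, and_assoc]

variable {c : Str}

theorem Strategy.follows_zero_iff (M : Strategy (commitmentGame S) 0) (hc : c ∈ S.commitments n)
    (y : Bool) (s : Str) (r : Tape) :
    M.Follows n r [c, [y], s] ↔ M.M [unary n] r = c ∧ M.M [unary n, c, [y]] r = s := by
  simp only [Strategy.Follows, append_singleton_prefix_triple_iff, commitmentGame_mem_turn_zero_iff]
  constructor
  · intro h
    exact ⟨h [] c (by simp) (by simp), h [c, [y]] s (by simp) (by simp [hc])⟩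
  · rintro ⟨commit, reveal⟩ h a (⟨rfl, rfl⟩ | ⟨rfl, rfl⟩ | ⟨rfl, rfl⟩) ht
    · exact commit
    · simp at ht
    · exact reveal

theorem Strategy.follows_one_iff (M : Strategy (commitmentGame S) 1) (hc : c ∈ S.commitments n)
    (y : Bool) (s : Str) (r : Tape) :
    M.Follows n r [c, [y], s] ↔ M.M [unary n, c] r = [y] := by
  simp only [Strategy.Follows, append_singleton_prefix_triple_iff, commitmentGame_mem_turn_one_iff]
  constructor
  · intro h
    exact h [c] [y] (by simp) (by simp [hc])
  · rintro guess h a (⟨rfl, rfl⟩ | ⟨rfl, rfl⟩ | ⟨rfl, rfl⟩) ht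
    · simp at ht
    · exact guess
    · simp at ht

theorem Strategy.commit_mem (M : Strategy (commitmentGame S) 0) (r : Tape) :
    M.M [unary n] r ∈ S.commitments n :=
  (commitmentGame_append_mem_iff.1
    (M.legal n [] (commitmentGame_mem_turn_zero_iff.2 (.inl rfl)) r)).2

theorem Strategy.length_reveal_le (M : Strategy (commitmentGame S) 0) (hc : c ∈ S.commitments n)
    (y : Bool) (r : Tape) : (M.M [unary n, c, [y]] r).length ≤ n :=
  (commitmentGame_append_mem_iff.1
    (M.legal n _ (commitmentGame_mem_turn_zero_iff.2 (.inr ⟨c, hc, y, rfl⟩)) r)).2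

theorem Strategy.guess_mem (M : Strategy (commitmentGame S) 1) (hc : c ∈ S.commitments n)
    (r : Tape) : M.M [unary n, c] r ∈ bitStrings :=
  (commitmentGame_append_mem_iff.1
    (M.legal n _ (commitmentGame_mem_turn_one_iff.2 ⟨c, hc, rfl⟩) r)).2

theorem pi_fin_two_measureReal {Ω : Fin 2 → Type*} [∀ i, MeasurableSpace (Ω i)]
    (μ : ∀ i, Measure (Ω i)) [∀ i, SigmaFinite (μ i)] (U : Set (Ω 0)) (V : Set (Ω 1)) :
    (Measure.pi μ).real {r | r 0 ∈ U ∧ r 1 ∈ V} = (μ 0).real U * (μ 1).real V := by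
  have eq_pi : {r : ∀ i, Ω i | r 0 ∈ U ∧ r 1 ∈ V} =
      Set.pi Set.univ (Fin.cons U (Fin.cons V finZeroElim) : ∀ i, Set (Ω i)) := by
    ext r
    simp [Fin.forall_fin_two]
  rw [eq_pi, measureReal_def, Measure.pi_pi, Fin.prod_univ_two, ENNReal.toReal_mul]
  rfl

/-- The event that the strategy `M` of player `0` sends the commitment string `c`, that `c` commits
to `x`, and that after `y` the commitment is opened (if `d` holds) or not. -/
def commitEvent (M : Strategy (commitmentGame S) 0) (n : ℕ+) (x y d : Bool) (c : Str) : Set Tape :=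
  {r | M.M [unary n] r = c ∧ S.bit c = x ∧ (S.R c (M.M [unary n, c, [y]] r)).isSome = d}

theorem measurableSet_commitEvent (M : Strategy (commitmentGame S) 0) (x y d : Bool) (c : Str) :
    MeasurableSet (commitEvent M n x y d c) :=
  (M.ppt.measurableSet [unary n] (· = c)).inter ((MeasurableSet.const _).inter
    (M.ppt.measurableSet [unary n, c, [y]] fun s => (S.R c s).isSome = d))

theorem exists_follows_iff (M : ∀ i, Strategy (commitmentGame S) i) (r : Fin 2 → Tape)
    (x y d : Bool) :
    (∃ h ∈ (commitmentGame S n).terminal, toEnvelope S h = envHist (x, y, d) ∧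
      ∀ i, (M i).Follows n (r i) h) ↔
    ∃ c ∈ S.commitments n,
      r 0 ∈ commitEvent (M 0) n x y d c ∧ (M 1).M [unary n, c] (r 1) = [y] := by
  constructor
  · rintro ⟨h, ht, heq, follows⟩
    obtain ⟨c, hc, y', s, -, rfl⟩ := commitmentGame_mem_terminal_iff_exists.1 ht
    simp only [toEnvelope, envHist, List.cons.injEq, and_true] at heq
    obtain ⟨bit_eq, rfl, isSome_eq⟩ := heq
    obtain ⟨commit, rfl⟩ := ((M 0).follows_zero_iff hc y' s (r 0)).1 (follows 0)
    exact ⟨c, hc, ⟨commit, bit_eq, isSome_eq⟩, ((M 1).follows_one_iff hc y' _ (r 1)).1 (follows 1)⟩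
  · rintro ⟨c, hc, ⟨commit, bit_eq, isSome_eq⟩, guess⟩
    refine ⟨[c, [y], (M 0).M [unary n, c, [y]] (r 0)], commitmentGame_mem_terminal_iff_exists.2
      ⟨c, hc, y, _, (M 0).length_reveal_le hc y _, rfl⟩, ?_, Fin.forall_fin_two.2 ⟨?_, ?_⟩⟩
    · simp only [toEnvelope, envHist, bit_eq, isSome_eq]
    · exact ((M 0).follows_zero_iff hc y _ _).2 ⟨commit, rfl⟩
    · exact ((M 1).follows_one_iff hc y _ _).2 guess

/-- The commitment strings with security parameter `n`, as a finite set. -/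
def commitmentFinset (S : CommitmentScheme) (n : ℕ+) : Finset Str :=
  (S.commitments_finite n).toFinset

theorem mem_commitmentFinset : c ∈ commitmentFinset S n ↔ c ∈ S.commitments n :=
  Set.Finite.mem_toFinset _

theorem imageDist_envHist (M : ∀ i, Strategy (commitmentGame S) i) (x y d : Bool) :
    imageDist (commitmentGame S) (toEnvelope S) M n (envHist (x, y, d)) =
      ∑ c ∈ commitmentFinset S n,
        coin.real (commitEvent (M 0) n x y d c) * coin.real {r | (M 1).M [unary n, c] r = [y]} := by
  have event_eq : {r : Fin 2 → Tape | ∃ h ∈ (commitmentGame S n).terminal,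
      toEnvelope S h = envHist (x, y, d) ∧ ∀ i, (M i).Follows n (r i) h} =
      ⋃ c ∈ commitmentFinset S n, {r | r 0 ∈ commitEvent (M 0) n x y d c ∧
        r 1 ∈ {r | (M 1).M [unary n, c] r = [y]}} := by
    ext r
    simp only [exists_follows_iff, Set.mem_ofPred_eq, Set.mem_iUnion, exists_prop,
      mem_commitmentFinset]
  rw [imageDist, event_eq, measureReal_biUnion_finset]
  · exact Finset.sum_congr rfl fun c _ => pi_fin_two_measureReal (fun _ : Fin 2 => coin) _ _
  · intro c _ c' _ hne
    exact Set.disjoint_left.2 fun r hr hr' => hne (hr.1.1.symm.trans hr'.1.1)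
  · intro c _
    have commit_measurable := measurableSet_commitEvent (n := n) (M 0) x y d c
    have guess_measurable := (M 1).ppt.measurableSet [unary n, c] (· = [y])
    have apply_measurable (i : Fin 2) : Measurable fun r : Fin 2 → Tape => r i :=
      measurable_pi_apply i
    exact (apply_measurable 0 commit_measurable).inter (apply_measurable 1 guess_measurable)

theorem imageDist_eq_zero {c : ℕ} {𝒢 : ℕ+ → Game c} {G : Game c} {f : Hist → Hist} {n : ℕ+}
    (hf : HistoryMap (𝒢 n) G f) (M : ∀ i, Strategy 𝒢 i) {h : Hist} (hh : h ∉ G.terminal) :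
    imageDist 𝒢 f M n h = 0 := by
  have event_eq : {r : Fin c → Tape | ∃ h' ∈ (𝒢 n).terminal,
      f h' = h ∧ ∀ i, (M i).Follows n (r i) h'} = ∅ := by
    refine Set.eq_empty_iff_forall_notMem.2 fun r => ?_
    rintro ⟨h', ht, rfl, -⟩
    exact hh ((hf.terminal_iff h' ht.1).2 ht)
  rw [imageDist, event_eq, measureReal_empty]

end Outcomes

/-! ### Statistical closeness and computational indistinguishability -/

section StatClose

variable {c : ℕ} {G : Game c}

theorem Game.terminal_finite (G : Game c) : G.terminal.Finite :=
  G.finite.subset fun _ hh => hh.1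

theorem Game.outcomeDist_eq_zero {σ : ∀ i, G.Mixed i} {h : Hist} (hh : h ∉ G.terminal) :
    G.outcomeDist σ h = 0 := by
  simp [Game.outcomeDist, hh]

theorem acceptProb_eq_sum (D : List Str → Tape → Str) (n : ℕ) {X : List Str → ℝ}
    {s : Finset (List Str)} (hX : ∀ x ∉ s, X x = 0) :
    acceptProb D n X = ∑ x ∈ s, X x * coin.real {r | D (unary n :: x) r = [true]} :=
  tsum_eq_sum fun x hx => by rw [hX x hx, zero_mul]

theorem StatClose.compIndist {X Y : ℕ+ → Hist → ℝ} (h : StatClose G X Y)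
    (hX : ∀ n, ∀ h ∉ G.terminal, X n h = 0) (hY : ∀ n, ∀ h ∉ G.terminal, Y n h = 0) :
    CompIndist X Y := by
  intro D _
  obtain ⟨ε, hε, close⟩ := h
  refine ⟨ε, hε, fun n => ?_⟩
  have mem_terminal {x} : x ∈ G.terminal_finite.toFinset ↔ x ∈ G.terminal := by simp
  rw [acceptProb_eq_sum D n fun x hx => hX n x (mem_terminal.not.1 hx),
    acceptProb_eq_sum D n fun x hx => hY n x (mem_terminal.not.1 hx), ← Finset.sum_sub_distrib]
  calc |∑ h ∈ G.terminal_finite.toFinset, (X n h * _ - Y n h * _)|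
      ≤ ∑ h ∈ G.terminal_finite.toFinset, |X n h * _ - Y n h * _| :=
        Finset.abs_sum_le_sum_abs _ _
    _ ≤ ∑ h ∈ G.terminal_finite.toFinset, |X n h - Y n h| := Finset.sum_le_sum fun h _ => by
        rw [← sub_mul, abs_mul, abs_of_nonneg measureReal_nonneg]
        exact mul_le_of_le_one_right (abs_nonneg _) measureReal_le_one
    _ = ∑ᶠ h ∈ G.terminal, |X n h - Y n h| := (finsum_mem_eq_finite_toFinset_sum _ _).symm
    _ ≤ ε n := close n

end StatClose

theorem envelopeGame_statClose {X Y : ℕ+ → Hist → ℝ} {ε : ℕ → ℝ} (hε : Negligible ε)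
    (h : ∀ (n : ℕ+) x y d, |X n (envHist (x, y, d)) - Y n (envHist (x, y, d))| ≤ ε n) :
    StatClose envelopeGame X Y := by
  refine ⟨_, hε.const_mul (a := 8) (by norm_num), fun n => ?_⟩
  rw [envelopeGame_terminal, finsum_mem_range envHist_injective, finsum_eq_sum_of_fintype]
  refine (Finset.sum_le_card_nsmul Finset.univ _ (ε n) fun t _ => h n _ _ _).trans_eq ?_
  simp

/-! ### Strategies of the envelope game -/

section EnvelopeStrategies

variable {h : Hist} {i : Fin 2}

theorem envelopeGame_mem_turn_iff :
    h ∈ envelopeGame.turn i ↔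
      (h ∈ envelopeGame.H ∧ h.length < 3) ∧ (if h.length = 1 then 1 else 0) = i :=
  and_congr_left' envelopeGame_mem_nonterminal_iff

theorem nil_mem_envelopeGame_turn : [] ∈ envelopeGame.turn 0 :=
  envelopeGame_mem_turn_iff.2 ⟨⟨trivial, by simp⟩, rfl⟩

theorem singleton_mem_envelopeGame_turn (x : Bool) : [[x]] ∈ envelopeGame.turn 1 :=
  envelopeGame_mem_turn_iff.2 ⟨⟨bit_mem_bitStrings x, by simp⟩, rfl⟩

theorem pair_mem_envelopeGame_turn (x y : Bool) : [[x], [y]] ∈ envelopeGame.turn 0 :=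
  envelopeGame_mem_turn_iff.2 ⟨⟨⟨bit_mem_bitStrings x, bit_mem_bitStrings y⟩, by simp⟩, rfl⟩

/-- The information set of a history at which player `i` moves. -/
def Game.infoSet {c : ℕ} (G : Game c) {i : Fin c} (hh : h ∈ G.turn i) : G.InfoSet i :=
  ⟨G.obs h, h, hh, rfl⟩

instance {c : ℕ} (G : Game c) (i : Fin c) : DiscreteMeasurableSpace (G.PureStrategy i) :=
  ⟨fun _ => trivial⟩

theorem append_mem_envelopeGame_iff (hh : h ∈ envelopeGame.turn i) {a : Str} :
    h ++ [a] ∈ envelopeGame.H ↔ a ∈ bitStrings := by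
  obtain ⟨⟨mem, length_lt⟩, -⟩ := envelopeGame_mem_turn_iff.1 hh
  have stage_eq : stageSet bitStrings bitStrings bitStrings h.length = bitStrings := by
    interval_cases h.length <;> rfl
  refine (append_mem_stageHist _ _ _ h a).trans ?_
  rw [stage_eq]
  exact and_iff_right mem

theorem envelopeGame_actions (I : envelopeGame.InfoSet i) :
    envelopeGame.actions I = bitStrings := by
  ext a
  obtain ⟨-, h, hh, rfl⟩ := I
  exact ⟨fun ha => (append_mem_envelopeGame_iff hh).1 (ha h hh rfl),
    fun ha h' hh' _ => (append_mem_envelopeGame_iff hh').2 ha⟩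

/-- The bit that a deterministic strategy plays at an information set. -/
def bitAt (s : envelopeGame.PureStrategy i) (I : envelopeGame.InfoSet i) : Bool :=
  (s I : Str).headD false

theorem apply_eq_iff_bitAt_eq {s : envelopeGame.PureStrategy i} {I : envelopeGame.InfoSet i}
    {b : Bool} : (s I : Str) = [b] ↔ bitAt s I = b := by
  obtain ⟨b', hb'⟩ := mem_bitStrings_iff.1 ((envelopeGame_actions I).le (s I).2)
  simp [bitAt, hb']

/-- The bit that a deterministic strategy of player `0` puts in the envelope. -/
def putBit (s : envelopeGame.PureStrategy 0) : Bool :=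
  bitAt s (envelopeGame.infoSet nil_mem_envelopeGame_turn)

/-- Whether a deterministic strategy of player `0` opens the envelope after the moves `x`, `y`. -/
def openBit (s : envelopeGame.PureStrategy 0) (x y : Bool) : Bool :=
  bitAt s (envelopeGame.infoSet (pair_mem_envelopeGame_turn x y))

/-- The bit that a deterministic strategy of player `1` chooses. Her information set does not depend
on the bit in the envelope, which is taken to be `false`. -/
def guessBit (s : envelopeGame.PureStrategy 1) : Bool :=
  bitAt s (envelopeGame.infoSet (singleton_mem_envelopeGame_turn false))

/-- The deterministic strategy of player `0` that puts `x` in the envelope and opens it after `y` if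
and only if `o y` holds. -/
def putStrategy (x : Bool) (o : Bool → Bool) : envelopeGame.PureStrategy 0 := fun I =>
  ⟨[if I.1 = [] then x else o (I.1.getLastD [] == [true])],
    (envelopeGame_actions I).ge (bit_mem_bitStrings _)⟩

/-- The deterministic strategy of player `1` that chooses `y`. -/
def guessStrategy (y : Bool) : envelopeGame.PureStrategy 1 := fun I =>
  ⟨[y], (envelopeGame_actions I).ge (bit_mem_bitStrings y)⟩

theorem putBit_putStrategy (x : Bool) (o : Bool → Bool) : putBit (putStrategy x o) = x := rfl

theorem openBit_putStrategy (x : Bool) (o : Bool → Bool) (x' y : Bool) :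
    openBit (putStrategy x o) x' y = o y := by
  cases y <;> rfl

theorem guessBit_guessStrategy (y : Bool) : guessBit (guessStrategy y) = y := rfl

theorem envelopeGame_outcomeDist (σ : ∀ i, envelopeGame.Mixed i) (x y d : Bool) :
    envelopeGame.outcomeDist σ (envHist (x, y, d)) =
      (σ 0).toMeasure.real {s | putBit s = x ∧ openBit s x y = d} *
        (σ 1).toMeasure.real {s | guessBit s = y} := by
  rw [Game.outcomeDist, ← pi_fin_two_measureReal fun i => (σ i).toMeasure]
  congr 1
  ext s
  simp only [Set.mem_ofPred_eq]
  constructor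
  · rintro ⟨-, plays⟩
    refine ⟨⟨apply_eq_iff_bitAt_eq.1 ?_, apply_eq_iff_bitAt_eq.1 ?_⟩, apply_eq_iff_bitAt_eq.1 ?_⟩
    · exact plays [] [x] (append_singleton_prefix_triple_iff.2 (by simp)) 0
        nil_mem_envelopeGame_turn
    · exact plays [[x], [y]] [d] (append_singleton_prefix_triple_iff.2 (by simp)) 0
        (pair_mem_envelopeGame_turn x y)
    · exact plays [[x]] [y] (append_singleton_prefix_triple_iff.2 (by simp)) 1
        (singleton_mem_envelopeGame_turn x)
  · rintro ⟨⟨put, opens⟩, guess⟩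
    refine ⟨envelopeGame_terminal ▸ Set.mem_range_self _, fun h a hp i hi => ?_⟩
    obtain ⟨rfl, rfl⟩ | ⟨rfl, rfl⟩ | ⟨rfl, rfl⟩ := append_singleton_prefix_triple_iff.1 hp
    all_goals obtain rfl := hi.2
    · exact apply_eq_iff_bitAt_eq.2 put
    · exact apply_eq_iff_bitAt_eq.2 guess
    · exact apply_eq_iff_bitAt_eq.2 opens

end EnvelopeStrategies

/-! ### Drawing the strategies of the envelope game -/

section Draw

/-- The `j`th binary digit of a number sampled with the thresholds `g 0 w`, …, `g (m - 1) w`. It is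
`false` for `j` so large that the number has no such digit. -/
def drawnBit (m : ℕ) (g : ℕ → List Str → Str) (j : ℕ) (w : Str) (r : Tape) : Bool :=
  (sample m (fun i => g i [w]) r).testBit j

variable {m : ℕ} {g : ℕ → List Str → Str}

theorem measurable_drawnBit (j : ℕ) (w : Str) : Measurable (drawnBit m g j w) :=
  (measurable_of_countable fun k : ℕ => k.testBit j).comp (measurable_sample m _)

theorem RandPolyTime.ltTape {φ : Tape → Tape} (hφ : PolyTimeTape φ) {w : List Str × Tape → Str}
    (hw : RandPolyTime w) : RandPolyTime fun p => [CompGame.ltTape (φ p.2) (w p)] :=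
  (hφ _ (hw.imp fun _ h => h.unary_length)).ltDigits hw

theorem RandPolyTime.drawnBit {φ : Tape → Tape} (hφ : PolyTimeTape φ) (hg : ∀ i, IsPolyTime (g i))
    (j : ℕ) : RandPolyTime fun p => [CompGame.drawnBit m g j (p.1.headD []) (φ p.2)] := by
  have threshold (i) : RandPolyTime fun p => g i [p.1.headD []] :=
    comp_isPolyTime (hg i) (T := fun p => [p.1.headD []])
      ((tuple_headD input).encTuple_cons (const (encTuple [])))
  exact findIdx (List.range m) (fun i => (threshold i).ltTape hφ) fun k => [k.testBit j]

theorem exists_putCode (x : Bool) (o : Bool → Bool) :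
    ∃ k ≤ 7, k.testBit 0 = x ∧ ∀ y : Bool, k.testBit (y.toNat + 1) = o y := by
  refine ⟨Nat.ofBits ![x, o false, o true], Nat.le_of_lt_succ (Nat.ofBits_lt_two_pow _),
    Nat.testBit_ofBits_lt _ 0 (by decide : 0 < 3), fun y => ?_⟩
  cases y
  · exact Nat.testBit_ofBits_lt _ 1 (by decide : 1 < 3)
  · exact Nat.testBit_ofBits_lt _ 2 (by decide : 2 < 3)

theorem exists_put_drawnBit (σ : envelopeGame.EffMixed 0) :
    ∃ g : ℕ → List Str → Str, (∀ i, IsPolyTime (g i)) ∧ ∃ ε, Negligible ε ∧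
      ∀ (n : ℕ+) (x y d : Bool),
        |coin.real {r | drawnBit 7 g 0 (unary n) r = x ∧
            drawnBit 7 g (y.toNat + 1) (unary n) r = d} -
          σ.1.toMeasure.real {s | putBit s = x ∧ openBit s x y = d}| ≤ ε n := by
  choose code code_le testBit_put testBit_open using fun s : envelopeGame.PureStrategy 0 =>
    exists_putCode (putBit s) (openBit s (putBit s))
  obtain ⟨g, hg, ε, hε, close⟩ := exists_sampler σ.1.toMeasure code_le σ.2
  refine ⟨g, hg, ε, hε, fun n x y d => ?_⟩
  have event_eq : {s | putBit s = x ∧ openBit s x y = d} =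
      {s | code s ∈ {k : ℕ | k.testBit 0 = x ∧ k.testBit (y.toNat + 1) = d}} := by
    ext s
    simp only [Set.mem_ofPred_eq, testBit_put, testBit_open]
    exact and_congr_right fun put_eq => by rw [put_eq]
  rw [event_eq]
  exact close n {k | k.testBit 0 = x ∧ k.testBit (y.toNat + 1) = d}

theorem exists_guess_drawnBit (σ : envelopeGame.EffMixed 1) :
    ∃ g : ℕ → List Str → Str, (∀ i, IsPolyTime (g i)) ∧ ∃ ε, Negligible ε ∧
      ∀ (n : ℕ+) (y : Bool), |coin.real {r | drawnBit 1 g 0 (unary n) r = y} -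
        σ.1.toMeasure.real {s | guessBit s = y}| ≤ ε n := by
  obtain ⟨g, hg, ε, hε, close⟩ := exists_sampler σ.1.toMeasure
    (fun s => (guessBit s).toNat_le) σ.2
  refine ⟨g, hg, ε, hε, fun n y => ?_⟩
  have event_eq : {s | guessBit s = y} = {s | (guessBit s).toNat ∈ {k : ℕ | k.testBit 0 = y}} := by
    ext s
    simp only [Set.mem_ofPred_eq]
    cases guessBit s <;> simp
  rw [event_eq]
  exact close n {k | k.testBit 0 = y}

end Draw

/-! ### The strategies of the committing player -/

section Commits

/-- On input `1ⁿ`, the machine draws a bit and runs `A₁`. After the bit `y` of the other player, the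
third component of the input, it draws whether to open, and accordingly runs `A₂` or `A₃`. These are
given `1ⁿ` and the drawn bit. All draws use the same half of the tape, so that the drawn bit is the
same in both moves, and `A₁`, `A₂`, `A₃` use the other half. -/
def drawMachine (g : ℕ → List Str → Str) (A₁ A₂ A₃ : List Str → Tape → Str) (x : List Str)
    (r : Tape) : Str :=
  let z := [x.headD [], [drawnBit 7 g 0 (x.headD []) (evenTape r)]]
  if decide (unary x.tail.length = []) then A₁ z (oddTape r)
  else if (if decide (x.tail.tail.headD [] = [true]) then
      drawnBit 7 g 2 (x.headD []) (evenTape r)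
    else drawnBit 7 g 1 (x.headD []) (evenTape r)) then A₂ z (oddTape r)
  else A₃ z (oddTape r)

variable {g : ℕ → List Str → Str} {A₁ A₂ A₃ : List Str → Tape → Str}

theorem isPPT_drawMachine (hg : ∀ i, IsPolyTime (g i)) (h₁ : IsPPT A₁) (h₂ : IsPPT A₂)
    (h₃ : IsPPT A₃) : IsPPT (drawMachine g A₁ A₂ A₃) := by
  have of_input {c : List Str → Bool} (hc : PolyTimeFrom encTuple fun x => [c x]) :
      RandPolyTime fun p => [c p.1] :=
    RandPolyTime.comp_isPolyTime (isPolyTime_iff.2 hc) RandPolyTime.input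
  have is_first := of_input (polyTimeFrom_encTuple_tail.tuple_length.decide_eq_const [])
  have guess := of_input (polyTimeFrom_encTuple_tail.tuple_tail.tuple_headD.decide_eq_const [true])
  have drawn (j) := RandPolyTime.drawnBit (m := 7) polyTimeTape_evenTape hg j
  have opens : RandPolyTime fun p => [if decide (p.1.tail.tail.headD [] = [true]) then
      drawnBit 7 g 2 (p.1.headD []) (evenTape p.2)
      else drawnBit 7 g 1 (p.1.headD []) (evenTape p.2)] := by
    convert guess.ite (drawn 2) (drawn 1) using 2 with p
    exact apply_ite (fun b => [b]) _ _ _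
  have run {A} (hA : IsPPT A) : RandPolyTime fun p =>
      A [p.1.headD [], [drawnBit 7 g 0 (p.1.headD []) (evenTape p.2)]] (oddTape p.2) :=
    RandPolyTime.call hA polyTimeTape_oddTape
      (T := fun p => [p.1.headD [], [drawnBit 7 g 0 (p.1.headD []) (evenTape p.2)]])
      (RandPolyTime.input.tuple_headD.encTuple_cons
        ((drawn 0).encTuple_cons (RandPolyTime.const (encTuple []))))
  exact (is_first.ite (run h₁) (opens.ite (run h₂) (run h₃))).isPPT

theorem drawMachine_singleton (w : Str) (r : Tape) :
    drawMachine g A₁ A₂ A₃ [w] r = A₁ [w, [drawnBit 7 g 0 w (evenTape r)]] (oddTape r) :=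
  rfl

theorem drawMachine_triple (w c : Str) (y : Bool) (r : Tape) :
    drawMachine g A₁ A₂ A₃ [w, c, [y]] r =
      if drawnBit 7 g (y.toNat + 1) w (evenTape r) then
        A₂ [w, [drawnBit 7 g 0 w (evenTape r)]] (oddTape r)
      else A₃ [w, [drawnBit 7 g 0 w (evenTape r)]] (oddTape r) := by
  cases y <;> simp [drawMachine, unary]

/-- The strategy `F` of player `0` in the commitment games imitates her strategy `σ` in the envelope
game: it draws a bit and a decision to open for either choice of player `1`, commits to the bit, and
then sends the key or, instead of destroying the envelope, `1ⁿ`, which is too long to be a key. The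
draws use half of the tape, and the commitment scheme uses the other half. -/
structure CommitsTo (S : CommitmentScheme) (σ : envelopeGame.EffMixed 0)
    (F : Strategy (commitmentGame S) 0) where
  /-- the bit to commit to -/
  put : ℕ+ → Tape → Bool
  /-- the decision to open after a bit of player `1` -/
  opens : ℕ+ → Bool → Tape → Bool
  measurable_put : ∀ n, Measurable (put n)
  measurable_opens : ∀ n y, Measurable (opens n y)
  commit : ∀ (n : ℕ+) r, F.M [unary n] r = S.C₁ n (put n (evenTape r)) (oddTape r)
  reveal : ∀ (n : ℕ+) c y r, F.M [unary n, c, [y]] r =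
    if opens n y (evenTape r) then S.C₂ n (put n (evenTape r)) (oddTape r) else unary n
  close : ∃ ε, Negligible ε ∧ ∀ (n : ℕ+) (x y d : Bool),
    |coin.real {r | put n r = x ∧ opens n y r = d} -
      σ.1.toMeasure.real {s | putBit s = x ∧ openBit s x y = d}| ≤ ε n
  knows : ∃ N, IsPPT N ∧ ∀ (n : ℕ+) r, N [unary n] r = [put n (evenTape r)] ∧
    ∀ c y, N [unary n, c, [y]] r = [opens n y (evenTape r)]

theorem isPPT_headD : IsPPT fun z _ => z.headD [] :=
  (isPolyTime_iff.2 polyTimeFrom_encTuple_headD).isPPT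

theorem isPPT_tail_headD : IsPPT fun z _ => z.tail.headD [] :=
  (isPolyTime_iff.2 polyTimeFrom_encTuple_tail.tuple_headD).isPPT

theorem isPPT_const (w : Str) : IsPPT fun _ _ => w :=
  (isPolyTime_iff.2 (PolyTimeFrom.const encTuple w)).isPPT

theorem exists_commitsTo (S : CommitmentScheme) (σ : envelopeGame.EffMixed 0) :
    ∃ F : Strategy (commitmentGame S) 0, Nonempty (CommitsTo S σ F) := by
  obtain ⟨g, hg, close⟩ := exists_put_drawnBit σ
  obtain ⟨A₁, hA₁, A₁_eq⟩ := S.ppt_C₁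
  obtain ⟨A₂, hA₂, A₂_eq⟩ := S.ppt_C₂
  let put (n : ℕ+) := drawnBit 7 g 0 (unary n)
  let opens (n : ℕ+) (y : Bool) := drawnBit 7 g (y.toNat + 1) (unary n)
  let M := drawMachine g A₁ A₂ fun z _ => z.headD []
  have commit (n : ℕ+) (r) : M [unary n] r = S.C₁ n (put n (evenTape r)) (oddTape r) :=
    A₁_eq n _ _
  have reveal (n : ℕ+) (c) (y : Bool) (r) : M [unary n, c, [y]] r =
      if opens n y (evenTape r) then S.C₂ n (put n (evenTape r)) (oddTape r) else unary n := by
    simp only [M, drawMachine_triple, A₂_eq, List.headD_cons, put, opens]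
  refine ⟨⟨M, isPPT_drawMachine hg hA₁ hA₂ isPPT_headD, fun n h hh r => ?_⟩,
    ⟨put, opens, fun n => measurable_drawnBit _ _, fun n y => measurable_drawnBit _ _, commit,
      reveal, close, drawMachine g (fun z _ => z.tail.headD []) (fun _ _ => [true])
        (fun _ _ => [false]), isPPT_drawMachine hg isPPT_tail_headD (isPPT_const _) (isPPT_const _),
      fun n r => ⟨drawMachine_singleton _ _, fun c y => ?_⟩⟩⟩
  · obtain rfl | ⟨c, hc, y, rfl⟩ := commitmentGame_mem_turn_zero_iff.1 hh
    · exact ⟨_, _, commit n r⟩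
    · refine commitmentGame_append_mem_iff.2 ⟨⟨hc, bit_mem_bitStrings y⟩, ?_⟩
      change (M [unary n, c, [y]] r).length ≤ n
      rw [reveal]
      split_ifs
      · exact (S.length_C₂ _ _ _).trans_le (Nat.sub_le _ _)
      · simp [unary]
  · rw [drawMachine_triple]
    simp only [opens]
    cases drawnBit 7 g (y.toNat + 1) (unary n) (evenTape r) <;> rfl

end Commits

/-! ### The strategies of the guessing player -/

section Guesses

/-- The strategy `F` of player `1` in the commitment games imitates her strategy `σ` in the envelope
game: it draws a bit and plays it, whatever the commitment string is. -/
structure Guesses (S : CommitmentScheme) (σ : envelopeGame.EffMixed 1)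
    (F : Strategy (commitmentGame S) 1) where
  /-- the drawn bit -/
  bit : ℕ+ → Tape → Bool
  guess : ∀ (n : ℕ+) c r, F.M [unary n, c] r = [bit n r]
  close : ∃ ε, Negligible ε ∧ ∀ (n : ℕ+) (y : Bool),
    |coin.real {r | bit n r = y} - σ.1.toMeasure.real {s | guessBit s = y}| ≤ ε n

theorem exists_guesses (S : CommitmentScheme) (σ : envelopeGame.EffMixed 1) :
    ∃ F : Strategy (commitmentGame S) 1, Nonempty (Guesses S σ F) := by
  obtain ⟨g, hg, close⟩ := exists_guess_drawnBit σ
  refine ⟨⟨fun x r => [drawnBit 1 g 0 (x.headD []) r],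
    (RandPolyTime.drawnBit polyTimeTape_id hg 0).isPPT, fun n h hh r => ?_⟩,
    ⟨fun n => drawnBit 1 g 0 (unary n), fun _ _ _ => rfl, close⟩⟩
  obtain ⟨c, hc, rfl⟩ := commitmentGame_mem_turn_one_iff.1 hh
  exact commitmentGame_append_mem_iff.2 ⟨hc, bit_mem_bitStrings _⟩

end Guesses

/-! ### Replies to a commitment -/

section Replies

variable {S : CommitmentScheme} {n : ℕ+}

theorem measurableSet_C₁_eq (b : Bool) (c : Str) : MeasurableSet {r | S.C₁ n b r = c} := by
  obtain ⟨A, hA, A_eq⟩ := S.ppt_C₁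
  simp only [← A_eq]
  exact hA.measurableSet [unary n, [b]] (· = c)

theorem sum_coin_C₁_eq_one (b : Bool) :
    ∑ c ∈ commitmentFinset S n, coin.real {r | S.C₁ n b r = c} = 1 := by
  have preimage_eq : S.C₁ n b ⁻¹' commitmentFinset S n = Set.univ :=
    Set.eq_univ_of_forall fun r => mem_commitmentFinset.2 (S.C₁_mem_commitments n b r)
  refine (sum_measureReal_preimage_singleton _ fun c _ => measurableSet_C₁_eq b c).trans ?_
  rw [preimage_eq, probReal_univ]

/-- The probability that the strategy `M` of player `1` answers `y` to a commitment to `x`. -/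
def replyProb (M : Strategy (commitmentGame S) 1) (n : ℕ+) (x y : Bool) : ℝ :=
  ∑ c ∈ commitmentFinset S n, coin.real {r | S.C₁ n x r = c} *
    coin.real {r | M.M [unary n, c] r = [y]}

variable (M : Strategy (commitmentGame S) 1) (x : Bool)

theorem replyProb_nonneg (y : Bool) : 0 ≤ replyProb M n x y :=
  Finset.sum_nonneg fun _ _ => mul_nonneg measureReal_nonneg measureReal_nonneg

theorem replyProb_true_add_false : replyProb M n x true + replyProb M n x false = 1 := by
  rw [replyProb, replyProb, ← Finset.sum_add_distrib, ← sum_coin_C₁_eq_one x (S := S) (n := n)]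
  refine Finset.sum_congr rfl fun c hc => ?_
  have compl_eq : {r | M.M [unary n, c] r = [false]} = {r | M.M [unary n, c] r = [true]}ᶜ := by
    ext r
    obtain ⟨b, hb⟩ := mem_bitStrings_iff.1 (M.guess_mem (mem_commitmentFinset.1 hc) r)
    simp [hb]
  rw [← mul_add, compl_eq, probReal_add_probReal_compl
    (M.ppt.measurableSet [unary n, c] (· = [true])), mul_one]

theorem abs_replyProb_le_one (y : Bool) : |replyProb M n x y| ≤ 1 := by
  rw [abs_of_nonneg (replyProb_nonneg M x y), ← replyProb_true_add_false M x]
  cases y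
  · exact le_add_of_nonneg_left (replyProb_nonneg M x true)
  · exact le_add_of_nonneg_right (replyProb_nonneg M x false)

theorem acceptProb_outputDist_C₁ :
    acceptProb M.M n (outputDist (S.C₁ n x)) = replyProb M n x true := by
  classical
  rw [acceptProb_eq_sum (s := (commitmentFinset S n).image fun c => [c]), Finset.sum_image]
  · simp only [replyProb, outputDist, List.cons.injEq, and_true]
  · exact fun c _ c' _ h => List.singleton_injective h
  · intro l hl
    have event_eq : {r | [S.C₁ n x r] = l} = ∅ := Set.eq_empty_iff_forall_notMem.2 fun r hr =>
      hl (hr ▸ Finset.mem_image_of_mem _ (mem_commitmentFinset.2 (S.C₁_mem_commitments n x r)))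
    rw [outputDist, event_eq, measureReal_empty]

/-- By the hiding property: otherwise the replies would tell commitments to `0` from commitments
to `1`. -/
theorem exists_replyProb_close : ∃ ε, Negligible ε ∧ ∀ (n : ℕ+) (x y : Bool),
    |replyProb M n x y - replyProb M n false y| ≤ ε n := by
  obtain ⟨ε, hε, close⟩ := S.is_hiding M.M M.ppt
  simp only [acceptProb_outputDist_C₁] at close
  refine ⟨ε, hε, fun n x y => ?_⟩
  cases x
  · simpa using hε.1 n
  cases y
  · have false_eq (x) := eq_sub_of_add_eq' (replyProb_true_add_false (n := n) M x)
    rw [false_eq, false_eq, sub_sub_sub_cancel_left]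
    exact close n
  · rw [abs_sub_comm]
    exact close n

end Replies

/-! ### Correspondence of strategies -/

theorem abs_mul_sub_mul_le {a a' b b' : ℝ} (ha : |a| ≤ 1) (hb : |b'| ≤ 1) :
    |a' * b' - a * b| ≤ |a' - a| + |b' - b| :=
  calc |a' * b' - a * b| = |(a' - a) * b' + a * (b' - b)| := by ring_nf
    _ ≤ |a' - a| * |b'| + |a| * |b' - b| := by
      rw [← abs_mul, ← abs_mul]
      exact abs_add_le _ _
    _ ≤ |a' - a| + |b' - b| :=
      add_le_add (mul_le_of_le_one_right (abs_nonneg _) hb)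
        (mul_le_of_le_one_left (abs_nonneg _) ha)

theorem abs_measureReal_le_one {Ω : Type*} [MeasurableSpace Ω] (μ : Measure Ω)
    [IsProbabilityMeasure μ] (E : Set Ω) : |μ.real E| ≤ 1 :=
  (abs_of_nonneg measureReal_nonneg).trans_le measureReal_le_one

section Correspondence

variable {S : CommitmentScheme} {n : ℕ+}

theorem CommitsTo.commitEvent_eq {σ : envelopeGame.EffMixed 0} {F : Strategy (commitmentGame S) 0}
    (h : CommitsTo S σ F) (x y d : Bool) (c : Str) :
    commitEvent F n x y d c =
      {r | evenTape r ∈ {r | h.put n r = x ∧ h.opens n y r = d} ∧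
        oddTape r ∈ {r | S.C₁ n x r = c}} := by
  ext r
  simp only [commitEvent, Set.mem_ofPred_eq, h.commit, h.reveal]
  have opens_iff : (S.R (S.C₁ n (h.put n (evenTape r)) (oddTape r))
      (if h.opens n y (evenTape r) then S.C₂ n (h.put n (evenTape r)) (oddTape r)
        else unary n)).isSome = h.opens n y (evenTape r) := by
    cases h.opens n y (evenTape r) <;> simp [S.opens, CommitmentScheme.R_C₁_unary]
  constructor
  · rintro ⟨rfl, rfl, rfl⟩
    rw [CommitmentScheme.bit_C₁, opens_iff]
    exact ⟨⟨rfl, rfl⟩, rfl⟩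
  · rintro ⟨⟨rfl, rfl⟩, rfl⟩
    exact ⟨rfl, CommitmentScheme.bit_C₁ _ _, opens_iff⟩

theorem CommitsTo.imageDist_envHist {σ : envelopeGame.EffMixed 0}
    {F : Strategy (commitmentGame S) 0} (h : CommitsTo S σ F)
    {M : ∀ i, Strategy (commitmentGame S) i} (hM : M 0 = F) (x y d : Bool) :
    imageDist (commitmentGame S) (toEnvelope S) M n (envHist (x, y, d)) =
      coin.real {r | h.put n r = x ∧ h.opens n y r = d} * replyProb (M 1) n x y := by
  rw [CompGame.imageDist_envHist, hM, replyProb, Finset.mul_sum]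
  refine Finset.sum_congr rfl fun c _ => ?_
  have measurable_draw : MeasurableSet {r | h.put n r = x ∧ h.opens n y r = d} :=
    (h.measurable_put n (.singleton x)).inter (h.measurable_opens n y (.singleton d))
  rw [h.commitEvent_eq, coin_even_odd measurable_draw (measurableSet_C₁_eq x c), mul_assoc]

theorem Guesses.setOf_guess_eq {σ : envelopeGame.EffMixed 1} {F : Strategy (commitmentGame S) 1}
    (h : Guesses S σ F) (c : Str) (y : Bool) :
    {r | F.M [unary n, c] r = [y]} = {r | h.bit n r = y} := by
  simp only [h.guess, List.cons.injEq, and_true]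

theorem Guesses.replyProb_eq {σ : envelopeGame.EffMixed 1} {F : Strategy (commitmentGame S) 1}
    (h : Guesses S σ F) (x y : Bool) : replyProb F n x y = coin.real {r | h.bit n r = y} := by
  simp only [replyProb, h.setOf_guess_eq]
  rw [← Finset.sum_mul, sum_coin_C₁_eq_one, one_mul]

theorem CommitsTo.statClose {σ : ∀ i, envelopeGame.EffMixed i}
    {M : ∀ i, Strategy (commitmentGame S) i} (h₀ : CommitsTo S (σ 0) (M 0))
    (h₁ : Guesses S (σ 1) (M 1)) :
    StatClose envelopeGame (imageDist (commitmentGame S) (toEnvelope S) M)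
      fun _ => envelopeGame.outcomeDist fun i => (σ i).1 := by
  obtain ⟨ε, hε, put_close⟩ := h₀.close
  obtain ⟨δ, hδ, guess_close⟩ := h₁.close
  refine envelopeGame_statClose (hε.add hδ) fun n x y d => ?_
  rw [h₀.imageDist_envHist rfl, envelopeGame_outcomeDist, h₁.replyProb_eq]
  exact (abs_mul_sub_mul_le (abs_measureReal_le_one _ _) (abs_measureReal_le_one _ _)).trans
    (add_le_add (put_close n x y d) (guess_close n y))

theorem CommitsTo.exists_isPPT_getLast? {σ : envelopeGame.EffMixed 0}
    {F : Strategy (commitmentGame S) 0} (h : CommitsTo S σ F) :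
    ∃ N, IsPPT N ∧ ∀ n : ℕ+, ∀ l ∈ (commitmentGame S n).turn 0, ∀ r, F.Follows n r l →
      (toEnvelope S (l ++ [F.M (unary n :: (commitmentGame S n).obs l) r])).getLast? =
        some (N (unary n :: (commitmentGame S n).obs l) r) := by
  obtain ⟨N, hN, knows⟩ := h.knows
  refine ⟨N, hN, fun n l hl r follows => ?_⟩
  obtain rfl | ⟨c, -, y, rfl⟩ := commitmentGame_mem_turn_zero_iff.1 hl
  · change some [S.bit (F.M [unary n] r)] = some (N [unary n] r)
    rw [h.commit, CommitmentScheme.bit_C₁, (knows n r).1]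
  · have commit_eq : F.M [unary n] r = c :=
      follows [] c (by simp) (commitmentGame_mem_turn_zero_iff.2 (.inl rfl))
    have opens_eq : (S.R c (F.M [unary n, c, [y]] r)).isSome = h.opens n y (evenTape r) := by
      rw [← commit_eq, h.commit, h.reveal]
      cases h.opens n y (evenTape r) <;> simp [S.opens, CommitmentScheme.R_C₁_unary]
    change some [(S.R c (F.M [unary n, c, [y]] r)).isSome] = some (N [unary n, c, [y]] r)
    rw [opens_eq, (knows n r).2]

theorem Strategy.exists_isPPT_getLast?_one (F : Strategy (commitmentGame S) 1) :
    ∃ N, IsPPT N ∧ ∀ n : ℕ+, ∀ l ∈ (commitmentGame S n).turn 1, ∀ r,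
      (toEnvelope S (l ++ [F.M (unary n :: (commitmentGame S n).obs l) r])).getLast? =
        some (N (unary n :: (commitmentGame S n).obs l) r) := by
  refine ⟨F.M, F.ppt, fun n l hl r => ?_⟩
  obtain ⟨c, -, rfl⟩ := commitmentGame_mem_turn_one_iff.1 hl
  rfl

end Correspondence

/-! ### Deviations -/

section Deviations

variable {S : CommitmentScheme} {n : ℕ+}

theorem exists_guess_eq_replyProb (M : Strategy (commitmentGame S) 1) (n : ℕ+) (x : Bool) :
    ∃ σ : envelopeGame.Mixed 1, ∀ y,
      σ.toMeasure.real {s | guessBit s = y} = replyProb M n x y := by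
  let p : PMF Bool := .ofFintype (fun y => ENNReal.ofReal (replyProb M n x y)) (by
    rw [Fintype.sum_bool, ← ENNReal.ofReal_add (replyProb_nonneg M x _) (replyProb_nonneg M x _),
      replyProb_true_add_false, ENNReal.ofReal_one])
  refine ⟨p.map guessStrategy, fun y => ?_⟩
  have preimage_eq : guessStrategy ⁻¹' {s | guessBit s = y} = {y} := by
    ext b
    simp [guessBit_guessStrategy]
  rw [measureReal_def, PMF.toMeasure_map_apply _ _ _ (measurable_of_countable _) .of_discrete,
    preimage_eq, PMF.toMeasure_apply_singleton _ _ (.singleton y)]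
  exact ENNReal.toReal_ofReal (replyProb_nonneg M x y)

theorem CommitsTo.exists_deviation {σ : ∀ i, envelopeGame.EffMixed i}
    {M : ∀ i, Strategy (commitmentGame S) i} (h : CommitsTo S (σ 0) (M 0))
    (M' : Strategy (commitmentGame S) 1) :
    ∃ σ' : ℕ+ → envelopeGame.Mixed 1, CompIndist
      (imageDist (commitmentGame S) (toEnvelope S) (Function.update M 1 M'))
      fun n => envelopeGame.outcomeDist (Function.update (fun i => (σ i).1) 1 (σ' n)) := by
  choose σ' guess_eq using fun n => exists_guess_eq_replyProb M' n false
  obtain ⟨ε, hε, put_close⟩ := h.close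
  obtain ⟨δ, hδ, reply_close⟩ := exists_replyProb_close M'
  have zero_ne_one : (0 : Fin 2) ≠ 1 := by decide
  refine ⟨σ', StatClose.compIndist (envelopeGame_statClose (hε.add hδ) fun n x y d => ?_)
    (fun n _ => imageDist_eq_zero (toEnvelope_historyMap S n) _)
    fun n _ => Game.outcomeDist_eq_zero⟩
  rw [h.imageDist_envHist (Function.update_of_ne zero_ne_one M' M), envelopeGame_outcomeDist,
    Function.update_self, Function.update_self, Function.update_of_ne zero_ne_one, guess_eq]
  exact (abs_mul_sub_mul_le (abs_measureReal_le_one _ _) (abs_replyProb_le_one _ _ _)).trans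
    (add_le_add (put_close n x y d) (reply_close n x y))

/-- The event that the strategy `M` of player `0` commits to `x` and after `y` opens the commitment
(if `d` holds) or not. -/
def openEvent (M : Strategy (commitmentGame S) 0) (n : ℕ+) (x y d : Bool) : Set Tape :=
  {r | S.bit (M.M [unary n] r) = x ∧
    (S.R (M.M [unary n] r) (M.M [unary n, M.M [unary n] r, [y]] r)).isSome = d}

variable (M : Strategy (commitmentGame S) 0) (x y d : Bool)

theorem openEvent_eq_biUnion :
    openEvent M n x y d = ⋃ c ∈ commitmentFinset S n, commitEvent M n x y d c := by
  ext r
  simp only [Set.mem_iUnion, exists_prop]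
  constructor
  · exact fun opened => ⟨_, mem_commitmentFinset.2 (M.commit_mem r), rfl, opened⟩
  · rintro ⟨c, -, rfl, opened⟩
    exact opened

theorem measurableSet_openEvent : MeasurableSet (openEvent M n x y d) := by
  rw [openEvent_eq_biUnion]
  exact Finset.measurableSet_biUnion _ fun c _ => measurableSet_commitEvent M x y d c

theorem sum_coin_commitEvent :
    ∑ c ∈ commitmentFinset S n, coin.real (commitEvent M n x y d c) =
      coin.real (openEvent M n x y d) := by
  rw [openEvent_eq_biUnion, measureReal_biUnion_finset]
  · exact fun c _ c' _ hne => Set.disjoint_left.2 fun r hr hr' => hne (hr.1.symm.trans hr'.1)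
  · exact fun c _ => measurableSet_commitEvent M x y d c

theorem Guesses.imageDist_envHist {σ : envelopeGame.EffMixed 1}
    {F : Strategy (commitmentGame S) 1} (h : Guesses S σ F)
    {M : ∀ i, Strategy (commitmentGame S) i} (hM : M 1 = F) (x y d : Bool) :
    imageDist (commitmentGame S) (toEnvelope S) M n (envHist (x, y, d)) =
      coin.real (openEvent (M 0) n x y d) * coin.real {r | h.bit n r = y} := by
  simp only [CompGame.imageDist_envHist, hM, h.setOf_guess_eq]
  rw [← Finset.sum_mul, sum_coin_commitEvent]

theorem exists_pmf_toMeasure_real_eq {Ω β γ : Type*} [MeasurableSpace Ω] (μ : Measure Ω)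
    [IsProbabilityMeasure μ] [MeasurableSpace β] [Countable β] [MeasurableSingletonClass β]
    [MeasurableSpace γ] [DiscreteMeasurableSpace γ] {T : Ω → β} (hT : Measurable T) (f : β → γ) :
    ∃ p : PMF γ, ∀ E, p.toMeasure.real E = μ.real {ω | f (T ω) ∈ E} := by
  have := Measure.isProbabilityMeasure_map (μ := μ) hT.aemeasurable
  refine ⟨(μ.map T).toPMF.map f, fun E => ?_⟩
  have hf : Measurable f := measurable_of_countable f
  rw [← PMF.toMeasure_map f _ hf, Measure.toPMF_toMeasure, Measure.map_map hf hT,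
    map_measureReal_apply (hf.comp hT) (.of_discrete)]
  rfl

theorem exists_put_eq_openEvent (n : ℕ+) : ∃ σ : envelopeGame.Mixed 0, ∀ x y d,
    σ.toMeasure.real {s | putBit s = x ∧ openBit s x y = d} =
      coin.real (openEvent M n x y d) := by
  let opened (y : Bool) (r : Tape) : Bool :=
    (S.R (M.M [unary n] r) (M.M [unary n, M.M [unary n] r, [y]] r)).isSome
  let moves (r : Tape) : Bool × Bool × Bool :=
    (S.bit (M.M [unary n] r), opened false r, opened true r)
  have measurable_moves : Measurable moves := measurable_to_countable' fun ⟨x, a, b⟩ => by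
    convert (measurableSet_openEvent (n := n) M x false a).inter
      (measurableSet_openEvent (n := n) M x true b) using 1
    ext r
    simp only [moves, openEvent, opened, Set.mem_preimage, Set.mem_singleton_iff, Prod.mk.injEq,
      Set.mem_inter_iff, Set.mem_ofPred_eq]
    tauto
  obtain ⟨σ, real_eq⟩ := exists_pmf_toMeasure_real_eq coin measurable_moves
    fun t => putStrategy t.1 fun y => if y then t.2.2 else t.2.1
  refine ⟨σ, fun x y d => ?_⟩
  rw [real_eq]
  congr 1
  ext r
  simp only [Set.mem_ofPred_eq, putBit_putStrategy, openBit_putStrategy]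
  cases y <;> rfl

theorem Guesses.exists_deviation {σ : ∀ i, envelopeGame.EffMixed i}
    {M : ∀ i, Strategy (commitmentGame S) i} (h : Guesses S (σ 1) (M 1))
    (M' : Strategy (commitmentGame S) 0) :
    ∃ σ' : ℕ+ → envelopeGame.Mixed 0, CompIndist
      (imageDist (commitmentGame S) (toEnvelope S) (Function.update M 0 M'))
      fun n => envelopeGame.outcomeDist (Function.update (fun i => (σ i).1) 0 (σ' n)) := by
  choose σ' put_eq using exists_put_eq_openEvent M'
  obtain ⟨ε, hε, guess_close⟩ := h.close
  have one_ne_zero : (1 : Fin 2) ≠ 0 := by decide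
  refine ⟨σ', StatClose.compIndist (envelopeGame_statClose hε fun n x y d => ?_)
    (fun n _ => imageDist_eq_zero (toEnvelope_historyMap S n) _)
    fun n _ => Game.outcomeDist_eq_zero⟩
  rw [h.imageDist_envHist (Function.update_of_ne one_ne_zero M' M), envelopeGame_outcomeDist,
    Function.update_self, Function.update_self, Function.update_of_ne one_ne_zero, put_eq,
    ← mul_sub, abs_mul]
  exact (mul_le_of_le_one_left (abs_nonneg _) (abs_measureReal_le_one _ _)).trans
    (guess_close n y)

end Deviations

/-! ### The representation -/

theorem exists_strategyMap (S : CommitmentScheme) :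
    ∃ F : ∀ i, envelopeGame.EffMixed i → Strategy (commitmentGame S) i,
      StrategyMap (commitmentGame S) envelopeGame (fun _ => toEnvelope S) F := by
  choose F₀ commitsTo using exists_commitsTo S
  choose F₁ guesses using exists_guesses S
  let F : ∀ i, envelopeGame.EffMixed i → Strategy (commitmentGame S) i :=
    Fin.cons F₀ (Fin.cons F₁ finZeroElim)
  have h₀ (σ) : CommitsTo S σ (F 0 σ) := (commitsTo σ).some
  have h₁ (σ) : Guesses S σ (F 1 σ) := (guesses σ).some
  exact ⟨F, {
    corresponds := fun σ => CommitsTo.statClose (M := fun i => F i (σ i)) (h₀ _) (h₁ _)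
    knows := Fin.forall_fin_two.2 ⟨fun σ => (h₀ σ).exists_isPPT_getLast?, fun σ =>
      (F 1 σ).exists_isPPT_getLast?_one.imp fun _ hN => hN.imp_right fun last n l hl r _ =>
        last n l hl r⟩
    deviation := fun σ => Fin.forall_fin_two.2
      ⟨Guesses.exists_deviation (M := fun i => F i (σ i)) (h₁ _),
        CommitsTo.exists_deviation (M := fun i => F i (σ i)) (h₀ _)⟩ }⟩

theorem commitmentGame_represents (S : CommitmentScheme) :
    Represents (commitmentGame S) envelopeGame :=
  ⟨commitmentGame_isComputableUniform S, fun _ => toEnvelope S, toEnvelope_historyMap S,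
    fun _ _ => commitmentGame_u_eq, exists_strategyMap S⟩

end CompGame

end

theorem mainTheorem6 (S : CompGame.CommitmentScheme) :
    CompGame.Represents (CompGame.commitmentGame S) CompGame.envelopeGame ∧
    (CompGame.PPTDecides {h | h.length = 1} (fun n => {h | ∃ c ∈ S.commitments n, h = [c]}) →
      CompGame.PPTDecides Set.univ (fun n => (CompGame.commitmentGame S n).H)) :=
  ⟨CompGame.commitmentGame_represents S, CompGame.commitmentGame_pptDecides S⟩
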